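/- Let $\mathcal H$ be a separable complex Hilbert space and let $A$ and $B$ be (possibly unbounded) self-adjoint operators on $\mathcal H$ with the same domain such that $A-B$ extends to a trace class operator on $\mathcal H$. Write $\|\cdot\|_1$ for both the trace norm of operators and the norm of $L^1(\mathbb R)$, and $\sigma(\cdot)$ for the spectrum. Then there is a real-valued function $\xi\in L^1(\mathbb R)$ (a spectral shift function) such that the following holds. Let $\mu$ be any finite positive Borel measure on $\mathbb R$, and let $$f(x)=i\int_{\mathbb R}\frac{e^{-isx}-1}{s}\,d\mu(s),\qquad x\in\mathbb R,$$ where the integrand is given its limit value $-ix$ at $s=0$. Then $f$ is differentiable, $f'\xi$ is integrable, the operator $f(A)-f(B)$ (with $f(A)$, $f(B)$ given by the Borel functional calculus) is densely defined and extends to a trace class operator on $\mathcal H$, and $$\operatorname{tr}\bigl(f(A)-f(B)\bigr)=\int_{\mathbb R}f'(\lambda)\,\xi(\lambda)\,d\lambda .$$ Furthermore: (a) $\operatorname{tr}(A-B)=\int_{\mathbb R}\xi(\lambda)\,d\lambda$; (b) $\|\xi\|_1\le\|A-B\|_1$; (c) if $B\le A$, then $\xi\ge 0$ almost everywhere; (d)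 $\xi=0$ almost everywhere outside the interval $\bigl(\inf(\sigma(A)\cup\sigma(B)),\ \sup(\sigma(A)\cup\sigma(B))\bigr)$, whose end points may be infinite. -/

import Mathlib

open MeasureTheory
open scoped ENNReal InnerProductSpace

section TraceClass

variable {H : Type*} [NormedAddCommGroup H] [InnerProductSpace ℂ H] [CompleteSpace H]

variable (H) in
/-- The index set of a fixed orthonormal (Hilbert) basis of `H`. -/
def onbIndex : Set H := (exists_hilbertBasis ℂ H).choose

variable (H) in
/-- A fixed orthonormal (Hilbert) basis of `H`. -/
noncomputable def onb : HilbertBasis (onbIndex H) ℂ H :=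
  (exists_hilbertBasis ℂ H).choose_spec.choose

/-- The trace norm `‖T‖₁ = tr |T| = ∑ᵢ ⟪eᵢ, |T| eᵢ⟫`, where `|T| = (T* T)^{1/2}`. The sum has
nonnegative terms and does not depend on the orthonormal basis. -/
noncomputable def traceNorm (T : H →L[ℂ] H) : ℝ≥0∞ :=
  ∑' i, ENNReal.ofReal (⟪onb H i, CFC.abs T (onb H i)⟫_ℂ).re

/-- `T` is a trace class operator: its trace norm is finite. -/
def IsTraceClass (T : H →L[ℂ] H) : Prop := traceNorm T < ∞

/-- The trace `tr T = ∑ᵢ ⟪eᵢ, T eᵢ⟫`. For trace class `T` the series converges absolutely and its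
sum does not depend on the orthonormal basis. -/
noncomputable def opTrace (T : H →L[ℂ] H) : ℂ :=
  ∑' i, ⟪onb H i, T (onb H i)⟫_ℂ

end TraceClass

section Unbounded

variable {H : Type*} [NormedAddCommGroup H] [InnerProductSpace ℂ H]

/-- The densely defined operator `S` is the restriction of the bounded everywhere defined operator
`T`; such a `T` is unique, it is the closure of `S`. -/
def IsBoundedExtension (S : H →ₗ.[ℂ] H) (T : H →L[ℂ] H) : Prop :=
  Dense (S.domain : Set H) ∧ ∀ x : S.domain, T x = S x

/-- The order `B ≤ A` of symmetric operators `A`, `B` with a common domain: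
`⟪x, B x⟫ ≤ ⟪x, A x⟫` on that domain. (The `≤` of `LinearPMap` means extension of operators,
which is not what is wanted here.) -/
def FormLE (B A : H →ₗ.[ℂ] H) : Prop :=
  ∀ (x : H) (hB : x ∈ B.domain) (hA : x ∈ A.domain),
    (⟪x, B ⟨x, hB⟩⟫_ℂ).re ≤ (⟪x, A ⟨x, hA⟩⟫_ℂ).re

/-- The resolvent set of an unbounded operator: `A - z` is a bijection from the domain of `A` onto
`H` with bounded inverse `R`. -/
def unboundedResolventSet (A : H →ₗ.[ℂ] H) : Set ℂ :=
  {z | ∃ R : H →L[ℂ] H,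
    (∀ y : H, ∃ h : R y ∈ A.domain, A ⟨R y, h⟩ - z • R y = y) ∧
    ∀ x : A.domain, R (A x - z • (x : H)) = x}

/-- The spectrum of an unbounded operator. -/
def unboundedSpectrum (A : H →ₗ.[ℂ] H) : Set ℂ := (unboundedResolventSet A)ᶜ

/-- The real points of the spectrum, as a set of extended real numbers. The spectrum of a
self-adjoint operator consists of real points. -/
def realSpectrum (A : H →ₗ.[ℂ] H) : Set EReal :=
  (fun t : ℝ => (t : EReal)) '' {t : ℝ | (t : ℂ) ∈ unboundedSpectrum A}

end Unbounded

section SpectralMeasure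

variable {H : Type*} [NormedAddCommGroup H] [InnerProductSpace ℂ H] [CompleteSpace H]

/-- A spectral (projection-valued) measure on the Borel sets of `ℝ`, countably additive in the
strong operator topology. The values on sets that are not Borel play no role. -/
structure SpectralMeasure (H : Type*) [NormedAddCommGroup H] [InnerProductSpace ℂ H]
    [CompleteSpace H] where
  /-- The projection attached to a Borel set. -/
  proj : Set ℝ → H →L[ℂ] H
  isStarProjection : ∀ S, MeasurableSet S → IsStarProjection (proj S)
  proj_empty : proj ∅ = 0
  proj_univ : proj Set.univ = 1
  hasSum_iUnion : ∀ S : ℕ → Set ℝ, (∀ n, MeasurableSet (S n)) →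
    Pairwise (Function.onFun Disjoint S) →
    ∀ x : H, HasSum (fun n => proj (S n) x) (proj (⋃ n, S n) x)

theorem SpectralMeasure.re_inner_nonneg (E : SpectralMeasure H) (x : H) {S : Set ℝ}
    (hS : MeasurableSet S) : 0 ≤ (⟪x, E.proj S x⟫_ℂ).re := by
  obtain ⟨hi, hs⟩ := E.isStarProjection S hS
  have h1 : E.proj S x = E.proj S (E.proj S x) := by
    conv_lhs => rw [← hi.eq]
    rfl
  have h2 : ⟪x, E.proj S x⟫_ℂ = ⟪E.proj S x, E.proj S x⟫_ℂ := by
    rw [← ContinuousLinearMap.adjoint_inner_right, hs.adjoint_eq, ← h1]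
  rw [h2]
  exact inner_self_nonneg (𝕜 := ℂ)

/-- The finite positive Borel measure `S ↦ ⟪x, E(S) x⟫`. -/
noncomputable def SpectralMeasure.scalarMeasure (E : SpectralMeasure H) (x : H) : Measure ℝ :=
  Measure.ofMeasurable (fun S _ => ENNReal.ofReal (⟪x, E.proj S x⟫_ℂ).re)
    (by simp [E.proj_empty])
    (by
      intro S hS hd
      have h := E.hasSum_iUnion S hS hd x
      have h1 : HasSum (fun n => (⟪x, E.proj (S n) x⟫_ℂ).re) (⟪x, E.proj (⋃ n, S n) x⟫_ℂ).re :=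
        Complex.hasSum_re (h.mapL (innerSL ℂ x))
      change ENNReal.ofReal _ = ∑' n, ENNReal.ofReal _
      rw [← h1.tsum_eq]
      exact ENNReal.ofReal_tsum_of_nonneg (fun n => E.re_inner_nonneg x (hS n)) h1.summable)

/-- `T = ∫ f dE` for a Borel function `f : ℝ → ℂ`: the domain of `T` is
`{x | ∫ |f|² d⟪x, E x⟫ < ∞}` and `⟪x, T x⟫ = ∫ f d⟪x, E x⟫` for `x` in the domain. By polarization
(the domain being a dense subspace) these two conditions determine `T`. -/
def IsSpectralIntegral (E : SpectralMeasure H) (f : ℝ → ℂ) (T : H →ₗ.[ℂ] H) : Prop :=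
  Measurable f ∧
  (T.domain : Set H) = {x | ∫⁻ t, ‖f t‖ₑ ^ 2 ∂(E.scalarMeasure x) < ∞} ∧
  ∀ x : T.domain, ⟪(x : H), T x⟫_ℂ = ∫ t, f t ∂(E.scalarMeasure (x : H))

/-- `T = f(A)` in the Borel functional calculus of the self-adjoint operator `A`: for a
spectral measure `E` with `A = ∫ t dE(t)` one has `T = ∫ f(t) dE(t)`. -/
def IsFunctionOf (A : H →ₗ.[ℂ] H) (f : ℝ → ℂ) (T : H →ₗ.[ℂ] H) : Prop :=
  ∃ E : SpectralMeasure H,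
    IsSpectralIntegral E (fun t : ℝ => (t : ℂ)) A ∧ IsSpectralIntegral E f T

end SpectralMeasure

/-- The function `s ↦ (e^{-isx} - 1) / s`, with its limit `-ix` as value at `s = 0`. -/
noncomputable def kreinKernel (x s : ℝ) : ℂ :=
  if s = 0 then -(Complex.I * x) else (Complex.exp (-(Complex.I * s * x)) - 1) / s

/-!
Krein's trace formula, for functions whose derivative is the Fourier transform of a finite measure.

*Reduction to the unitary groups.* With `V = A - B` put
`K s = (e^{-isA} - e^{-isB}) / s` and `K 0 = -iV`. The operator `T = i ∫ K s dμ(s)` has, on the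
common domain, the quadratic form of `f(A) - f(B)` (`inner_self_of_integral`). Polarization
identifies `T*` with the difference of the functions `conj ∘ f` on the common domain, and duality
then identifies `T` with `f(A) - f(B)` on the possibly larger domain of the latter
(`isBoundedExtension_pmap_sub`). Duhamel's formula bounds the trace norm of `K s` by that of `V`.
So the formula follows by Fubini's theorem (`opTrace_of_integral`) from the single identity
`tr (e^{-isA} - e^{-isB}) = -is ∫ e^{-isλ} ξ(λ) dλ` for all `s`, with `tr V = ∫ ξ`.

*The spectral shift function.* For a rank one perturbation `V = ⟪ψ, ·⟫ ψ` the trace of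
`e^{-is(B + tV)} - e^{-isB}` has the derivative `-is ⟪ψ, e^{-is(B + tV)} ψ⟫` in `t`; so the
identity holds with the measure `ν` that is the average over `t ∈ [0, 1]` of the spectral measures
of `ψ` for `B + tV` (`exists_spectralShift_rankOne`). This measure is absolutely continuous: along
the segment the Borel transforms are `F / (1 + tF)`, the average of their imaginary parts is a
difference of two values of the arc tangent, hence at most `π`, so the Poisson integrals of `ν` are
at most `1` (`lintegral_im_orbit_le`, `absolutelyContinuous_of_poisson`). A positive trace class
operator is a sum of rank one operators whose trace norms add up, and the measures add up likewise
(`exists_spectralShift_of_isRankOneSum`). In general one goes from `B` to `B + V⁺ = A + V⁻` and back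
to `A`, and `ξ` is the difference of two densities (`exists_spectralShift`); since
`‖V‖₁ = tr V⁺ + tr V⁻`, the trace, norm and sign statements are visible from this construction.

*The support.* Let `f'` be a test function supported off the smallest interval that carries both
spectra. It is the Fourier transform of an integrable function, so the formula applies to it; but
`f` is constant on that interval, `f(A) - f(B) = 0`, and `∫ f' ξ = 0`
(`ae_eq_zero_of_spectrum_subset`).

*The spectral theorem* is obtained in the form of a `BorelCalculus`: the commutative C*-algebra
generated by the normal operator `(A - i)⁻¹` represents the continuous functions on a compact
space, vector measures come from the Riesz–Markov theorem, and the calculus is the isometric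
extension of `F ↦ F(N) x` to `L²` of the measure of `x`, carried to the line by the change of
variable that recovers `A` from its resolvent. The trace ideal enters only through `TraceBound`,
a bound on `∑ |⟪aᵢ, D bᵢ⟫|` for all Bessel families, which is stable under integrals.
-/

open Filter Topology ComplexConjugate

set_option linter.unusedSectionVars false

/-! ### The Borel functional calculus of a representation of `C(K)` -/

section Representation

variable {H : Type*} [NormedAddCommGroup H] [InnerProductSpace ℂ H] [CompleteSpace H]
variable {K : Type*} [MetricSpace K] [CompactSpace K]

/-- A real continuous function, regarded as a complex one. -/
def realToComplex (g : C(K, ℝ)) : C(K, ℂ) := ⟨fun k => (g k : ℂ), by fun_prop⟩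

@[simp] theorem realToComplex_apply (g : C(K, ℝ)) (k : K) : realToComplex g k = (g k : ℂ) := rfl

theorem inner_rep_realToComplex (π : C(K, ℂ) →⋆ₐ[ℂ] (H →L[ℂ] H)) (x : H) (g : C(K, ℝ)) :
    ⟪x, π (realToComplex g) x⟫_ℂ = ((⟪x, π (realToComplex g) x⟫_ℂ).re : ℂ) := by
  have h : star (realToComplex g) = realToComplex g := by
    ext k; simp
  have h2 : ContinuousLinearMap.adjoint (π (realToComplex g)) = π (realToComplex g) := by
    rw [← ContinuousLinearMap.star_eq_adjoint, ← map_star, h]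
  have h3 : conj ⟪x, π (realToComplex g) x⟫_ℂ = ⟪x, π (realToComplex g) x⟫_ℂ := by
    rw [inner_conj_symm, ← ContinuousLinearMap.adjoint_inner_right, h2]
  exact (Complex.conj_eq_iff_re.mp h3).symm

theorem norm_rep_sq (π : C(K, ℂ) →⋆ₐ[ℂ] (H →L[ℂ] H)) (x : H) (h : C(K, ℂ)) (g : C(K, ℝ))
    (hg : ∀ k, g k = ‖h k‖ ^ 2) : ‖π h x‖ ^ 2 = (⟪x, π (realToComplex g) x⟫_ℂ).re := by
  have h1 : realToComplex g = star h * h := by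
    ext k
    simp [hg, Complex.conj_mul']
  rw [h1, map_mul, map_star, ContinuousLinearMap.star_eq_adjoint, mul_apply_eq_comp,
    ContinuousLinearMap.adjoint_inner_right, inner_self_eq_norm_sq_to_K]
  norm_cast

/-- The positive functional `g ↦ ⟪x, π(g) x⟫` on the real continuous functions. -/
noncomputable def repFunctional (π : C(K, ℂ) →⋆ₐ[ℂ] (H →L[ℂ] H)) (x : H) :
    CompactlySupportedContinuousMap K ℝ →ₚ[ℝ] ℝ :=
  PositiveLinearMap.mk₀
    { toFun := fun g => (⟪x, π (realToComplex g.toContinuousMap) x⟫_ℂ).re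
      map_add' := by
        intro a b
        have : realToComplex (a + b).toContinuousMap
            = realToComplex a.toContinuousMap + realToComplex b.toContinuousMap := by
          ext k; simp
        simp [this]
      map_smul' := by
        intro c a
        have : realToComplex (c • a).toContinuousMap
            = (c : ℂ) • realToComplex a.toContinuousMap := by
          ext k; simp
        rw [this, map_smul, smul_apply, inner_smul_right, Complex.re_ofReal_mul]
        simp }
    (by
      intro g hg
      have hg' : ∀ k, 0 ≤ g k := hg
      have := norm_rep_sq π x
        (realToComplex ⟨fun k => Real.sqrt (g k), by fun_prop⟩) g.toContinuousMap (by
          intro k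
          simp [abs_of_nonneg (Real.sqrt_nonneg _), Real.sq_sqrt (hg' k)])
      change 0 ≤ (⟪x, π (realToComplex g.toContinuousMap) x⟫_ℂ).re
      rw [← this]
      positivity)

variable [MeasurableSpace K] [BorelSpace K]

/-- The spectral measure of the vector `x`: the measure that represents `g ↦ ⟪x, π(g) x⟫`. -/
noncomputable def repMeasure (π : C(K, ℂ) →⋆ₐ[ℂ] (H →L[ℂ] H)) (x : H) : Measure K :=
  RealRMK.rieszMeasure (repFunctional π x)

instance (π : C(K, ℂ) →⋆ₐ[ℂ] (H →L[ℂ] H)) (x : H) : (repMeasure π x).Regular :=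
  RealRMK.regular_rieszMeasure _

instance (π : C(K, ℂ) →⋆ₐ[ℂ] (H →L[ℂ] H)) (x : H) : IsFiniteMeasure (repMeasure π x) :=
  inferInstance

theorem integral_repMeasure_real (π : C(K, ℂ) →⋆ₐ[ℂ] (H →L[ℂ] H)) (x : H) (g : C(K, ℝ)) :
    ∫ k, g k ∂(repMeasure π x) = (⟪x, π (realToComplex g) x⟫_ℂ).re := by
  exact RealRMK.integral_rieszMeasure (repFunctional π x)
    (⟨g, HasCompactSupport.of_compactSpace g⟩ : CompactlySupportedContinuousMap K ℝ)

theorem integral_repMeasure (π : C(K, ℂ) →⋆ₐ[ℂ] (H →L[ℂ] H)) (x : H) (g : C(K, ℂ)) :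
    ∫ k, g k ∂(repMeasure π x) = ⟪x, π g x⟫_ℂ := by
  have hi : Integrable (fun k => g k) (repMeasure π x) :=
    (BoundedContinuousFunction.mkOfCompact g).integrable _
  let a : C(K, ℝ) := ⟨fun k => (g k).re, by fun_prop⟩
  let b : C(K, ℝ) := ⟨fun k => (g k).im, by fun_prop⟩
  have hab : g = realToComplex a + Complex.I • realToComplex b := by
    ext k
    simp [a, b, mul_comm Complex.I, Complex.re_add_im]
  have h1 := integral_re_add_im hi
  rw [← h1]
  have ha := integral_repMeasure_real π x a
  have hb := integral_repMeasure_real π x b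
  have ha' : ∫ k, RCLike.re (g k) ∂(repMeasure π x) = (⟪x, π (realToComplex a) x⟫_ℂ).re := ha
  have hb' : ∫ k, RCLike.im (g k) ∂(repMeasure π x) = (⟪x, π (realToComplex b) x⟫_ℂ).re := hb
  rw [ha', hb']
  conv_rhs => rw [hab]
  simp only [map_add, map_smul, add_apply, smul_apply,
    inner_add_right, inner_smul_right]
  rw [inner_rep_realToComplex π x a, inner_rep_realToComplex π x b]
  simp [mul_comm]

theorem lintegral_repMeasure (π : C(K, ℂ) →⋆ₐ[ℂ] (H →L[ℂ] H)) (x : H) (h : C(K, ℂ)) :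
    ∫⁻ k, ‖h k‖ₑ ^ 2 ∂(repMeasure π x) = ‖π h x‖ₑ ^ 2 := by
  let g : C(K, ℝ) := ⟨fun k => ‖h k‖ ^ 2, by fun_prop⟩
  have h1 := integral_repMeasure_real π x g
  rw [← norm_rep_sq π x h g (fun k => rfl)] at h1
  have h2 := ofReal_integral_eq_lintegral_ofReal (μ := repMeasure π x) (f := fun k => ‖h k‖ ^ 2)
    ((BoundedContinuousFunction.mkOfCompact g).integrable _)
    (Eventually.of_forall fun k => by positivity)
  have h3 : ∫ k, ‖h k‖ ^ 2 ∂(repMeasure π x) = ‖π h x‖ ^ 2 := h1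
  rw [h3] at h2
  rw [← ofReal_norm, ← ENNReal.ofReal_pow (norm_nonneg _), h2]
  refine lintegral_congr fun k => ?_
  rw [← ofReal_norm, ← ENNReal.ofReal_pow (norm_nonneg _)]

theorem eLpNorm_two_sq {α : Type*} [MeasurableSpace α] (μ : Measure α) (f : α → ℂ) :
    eLpNorm f 2 μ ^ 2 = ∫⁻ a, ‖f a‖ₑ ^ 2 ∂μ := by
  have := eLpNorm_nnreal_pow_eq_lintegral (f := f) (μ := μ) (p := 2) two_ne_zero
  simpa using this

theorem eLpNorm_repMeasure (π : C(K, ℂ) →⋆ₐ[ℂ] (H →L[ℂ] H)) (x : H) (h : C(K, ℂ)) :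
    eLpNorm h 2 (repMeasure π x) = ‖π h x‖ₑ := by
  have h1 := eLpNorm_two_sq (repMeasure π x) h
  rw [lintegral_repMeasure] at h1
  exact (ENNReal.pow_right_strictMono two_ne_zero).injective h1

/-- Finite measures are determined by the `L²` norms of continuous functions. -/
theorem measure_ext_of_lintegral_sq {μ ν : Measure K} [IsFiniteMeasure μ]
    (h : ∀ g : C(K, ℂ), ∫⁻ k, ‖g k‖ₑ ^ 2 ∂μ = ∫⁻ k, ‖g k‖ₑ ^ 2 ∂ν) : μ = ν := by
  refine ext_of_forall_lintegral_eq_of_IsFiniteMeasure fun f => ?_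
  have := h (realToComplex ⟨fun k => Real.sqrt (f k), by fun_prop⟩)
  have e : ∀ k, ‖realToComplex ⟨fun k => Real.sqrt (f k), by fun_prop⟩ k‖ₑ ^ 2
      = (f k : ℝ≥0∞) := by
    intro k
    rw [← ofReal_norm, ← ENNReal.ofReal_pow (norm_nonneg _)]
    simp [abs_of_nonneg (Real.sqrt_nonneg _)]
  simpa only [e] using this

theorem memLp_continuousMap (μ : Measure K) [IsFiniteMeasure μ] (g : C(K, ℂ)) (p : ℝ≥0∞) :
    MemLp g p μ :=
  MemLp.of_bound g.continuous.aestronglyMeasurable ‖g‖ (Eventually.of_forall g.norm_coe_le_norm)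

theorem exists_continuous_tendsto_eLpNorm {μ : Measure K} [IsFiniteMeasure μ] {F : K → ℂ}
    (hF : MemLp F 2 μ) :
    ∃ g : ℕ → C(K, ℂ), Tendsto (fun n => eLpNorm (fun k => F k - g n k) 2 μ) atTop (𝓝 0) := by
  have h : ∀ n : ℕ, ∃ g : C(K, ℂ), eLpNorm (fun k => F k - g k) 2 μ ≤ ((n : ℝ≥0∞) + 1)⁻¹ := by
    intro n
    obtain ⟨g, hg, -⟩ := hF.exists_boundedContinuous_eLpNorm_sub_le (by simp)
      (ε := ((n : ℝ≥0∞) + 1)⁻¹) (by simp)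
    exact ⟨g.toContinuousMap, hg⟩
  choose g hg using h
  refine ⟨g, tendsto_of_tendsto_of_tendsto_of_le_of_le tendsto_const_nhds ?_
    (fun n => zero_le) hg⟩
  have := ENNReal.tendsto_inv_nat_nhds_zero
  simpa [Function.comp_def] using this.comp (tendsto_add_atTop_nat 1)

theorem aestronglyMeasurable_continuousMap (μ : Measure K) (g : C(K, ℂ)) :
    AEStronglyMeasurable (g : K → ℂ) μ := g.continuous.aestronglyMeasurable

theorem edist_rep_le (π : C(K, ℂ) →⋆ₐ[ℂ] (H →L[ℂ] H)) (x : H) {F : K → ℂ}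
    (hF : MemLp F 2 (repMeasure π x)) (g h : C(K, ℂ)) :
    edist (π g x) (π h x) ≤
      eLpNorm (fun k => F k - g k) 2 (repMeasure π x) + eLpNorm (fun k => F k - h k) 2 (repMeasure π x) := by
  have e1 : edist (π g x) (π h x) = eLpNorm ((fun k => F k - h k) - (fun k => F k - g k)) 2
      (repMeasure π x) := by
    rw [edist_eq_enorm_sub, ← sub_apply, ← map_sub, ← eLpNorm_repMeasure]
    congr 1
    ext k
    simp
  rw [e1, add_comm]
  exact eLpNorm_sub_le (hF.1.sub (aestronglyMeasurable_continuousMap _ h))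
    (hF.1.sub (aestronglyMeasurable_continuousMap _ g)) (by norm_num)

theorem cauchySeq_rep (π : C(K, ℂ) →⋆ₐ[ℂ] (H →L[ℂ] H)) (x : H) {F : K → ℂ}
    (hF : MemLp F 2 (repMeasure π x)) {g : ℕ → C(K, ℂ)}
    (hg : Tendsto (fun n => eLpNorm (fun k => F k - g n k) 2 (repMeasure π x)) atTop (𝓝 0)) :
    CauchySeq fun n => π (g n) x := by
  rw [EMetric.cauchySeq_iff]
  intro ε hε
  have h2 : 0 < ε / 2 := ENNReal.half_pos hε.ne'
  obtain ⟨N, hN⟩ := eventually_atTop.mp (hg.eventually (gt_mem_nhds h2))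
  refine ⟨N, fun m hm n hn => (edist_rep_le π x hF _ _).trans_lt ?_⟩
  calc _ < ε / 2 + ε / 2 := ENNReal.add_lt_add (hN m hm) (hN n hn)
    _ = ε := ENNReal.add_halves ε

open Classical in
/-- The vector `F(π) x` for a Borel function `F` that is square integrable with respect to the
spectral measure of `x`: the limit of `π(g) x` for continuous `g → F` in `L²`. -/
noncomputable def repFun (π : C(K, ℂ) →⋆ₐ[ℂ] (H →L[ℂ] H)) (F : K → ℂ) (x : H) : H :=
  if h : MemLp F 2 (repMeasure π x) then
    limUnder atTop fun n => π ((exists_continuous_tendsto_eLpNorm h).choose n) x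
  else 0

theorem tendsto_repFun (π : C(K, ℂ) →⋆ₐ[ℂ] (H →L[ℂ] H)) (x : H) {F : K → ℂ}
    (hF : MemLp F 2 (repMeasure π x)) {g : ℕ → C(K, ℂ)}
    (hg : Tendsto (fun n => eLpNorm (fun k => F k - g n k) 2 (repMeasure π x)) atTop (𝓝 0)) :
    Tendsto (fun n => π (g n) x) atTop (𝓝 (repFun π F x)) := by
  have hc := (exists_continuous_tendsto_eLpNorm hF).choose_spec
  have h1 : Tendsto (fun n => π ((exists_continuous_tendsto_eLpNorm hF).choose n) x) atTop
      (𝓝 (repFun π F x)) := by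
    rw [repFun, dif_pos hF]
    exact (cauchySeq_rep π x hF hc).tendsto_limUnder
  have h2 : Tendsto (fun n => edist (π ((exists_continuous_tendsto_eLpNorm hF).choose n) x)
      (π (g n) x)) atTop (𝓝 0) := by
    refine tendsto_of_tendsto_of_tendsto_of_le_of_le tendsto_const_nhds ?_ (fun n => zero_le)
      (fun n => edist_rep_le π x hF _ _)
    simpa using hc.add hg
  refine h1.congr_dist ?_
  simpa [edist_dist, ENNReal.toReal_ofReal, Function.comp_def] using
    (ENNReal.tendsto_toReal ENNReal.zero_ne_top).comp h2

theorem repFun_continuousMap (π : C(K, ℂ) →⋆ₐ[ℂ] (H →L[ℂ] H)) (x : H) (g : C(K, ℂ)) :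
    repFun π g x = π g x := by
  have hg : MemLp g 2 (repMeasure π x) := memLp_continuousMap _ g 2
  exact tendsto_nhds_unique (tendsto_repFun π x hg (g := fun _ => g) (by simp))
    tendsto_const_nhds

variable (π : C(K, ℂ) →⋆ₐ[ℂ] (H →L[ℂ] H))

theorem memLp_two_add_measure {μ ν : Measure K} {F : K → ℂ} (hμ : MemLp F 2 μ)
    (hν : MemLp F 2 ν) : MemLp F 2 (μ + ν) := by
  refine ⟨hμ.1.add_measure hν.1, ?_⟩
  have h : eLpNorm F 2 (μ + ν) ^ 2 < ∞ := by
    rw [eLpNorm_two_sq, lintegral_add_measure, ← eLpNorm_two_sq, ← eLpNorm_two_sq]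
    exact ENNReal.add_lt_top.mpr ⟨ENNReal.pow_lt_top hμ.2, ENNReal.pow_lt_top hν.2⟩
  exact (ENNReal.pow_lt_top_iff.mp h).resolve_right two_ne_zero

/-- One sequence of continuous functions approximates `F` in the spaces `L²` of finitely many
measures at once. -/
theorem exists_continuous_tendsto_eLpNorm_add {μ ν : Measure K} [IsFiniteMeasure μ]
    [IsFiniteMeasure ν] {F : K → ℂ} (hμ : MemLp F 2 μ) (hν : MemLp F 2 ν) :
    ∃ g : ℕ → C(K, ℂ), Tendsto (fun n => eLpNorm (fun k => F k - g n k) 2 μ) atTop (𝓝 0) ∧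
      Tendsto (fun n => eLpNorm (fun k => F k - g n k) 2 ν) atTop (𝓝 0) := by
  obtain ⟨g, hg⟩ := exists_continuous_tendsto_eLpNorm (memLp_two_add_measure hμ hν)
  refine ⟨g, ?_, ?_⟩
  · exact tendsto_of_tendsto_of_tendsto_of_le_of_le tendsto_const_nhds hg (fun n => zero_le)
      (fun n => eLpNorm_mono_measure _ (Measure.le_add_right le_rfl))
  · exact tendsto_of_tendsto_of_tendsto_of_le_of_le tendsto_const_nhds hg (fun n => zero_le)
      (fun n => eLpNorm_mono_measure _ (Measure.le_add_left le_rfl))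

theorem enorm_repFun (x : H) {F : K → ℂ} (hF : MemLp F 2 (repMeasure π x)) :
    ‖repFun π F x‖ₑ = eLpNorm F 2 (repMeasure π x) := by
  obtain ⟨g, hg⟩ := exists_continuous_tendsto_eLpNorm hF
  have h1 := (tendsto_repFun π x hF hg).enorm
  simp_rw [← eLpNorm_repMeasure] at h1
  have hm : ∀ n, AEStronglyMeasurable (fun k => F k - g n k) (repMeasure π x) := fun n =>
    hF.1.sub (aestronglyMeasurable_continuousMap _ _)
  apply le_antisymm
  · refine le_of_tendsto_of_tendsto h1
      (b := atTop) (f := fun n => eLpNorm (g n) 2 (repMeasure π x))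
      (g := fun n => eLpNorm F 2 (repMeasure π x) +
        eLpNorm (fun k => F k - g n k) 2 (repMeasure π x)) (by simpa using hg.const_add _) ?_
    refine Eventually.of_forall fun n => ?_
    have := eLpNorm_sub_le (p := 2) hF.1 (hm n) (by norm_num)
    have e : F - (fun k => F k - g n k) = g n := by
      ext k
      simp
    rwa [e] at this
  · refine le_of_tendsto_of_tendsto (tendsto_const_nhds (x := eLpNorm F 2 (repMeasure π x)))
      (b := atTop)
      (g := fun n => eLpNorm (g n) 2 (repMeasure π x) +
        eLpNorm (fun k => F k - g n k) 2 (repMeasure π x)) (by simpa using h1.add hg) ?_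
    refine Eventually.of_forall fun n => ?_
    have := eLpNorm_add_le (p := 2) (aestronglyMeasurable_continuousMap _ (g n)) (hm n)
      (by norm_num)
    have e : (g n : K → ℂ) + (fun k => F k - g n k) = F := by
      ext k
      simp
    rwa [e] at this

theorem inner_repFun (x : H) {F : K → ℂ} (hF : MemLp F 2 (repMeasure π x)) :
    ⟪x, repFun π F x⟫_ℂ = ∫ k, F k ∂(repMeasure π x) := by
  obtain ⟨g, hg⟩ := exists_continuous_tendsto_eLpNorm hF
  have h1 : Tendsto (fun n => ⟪x, π (g n) x⟫_ℂ) atTop (𝓝 ⟪x, repFun π F x⟫_ℂ) :=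
    tendsto_const_nhds.inner (tendsto_repFun π x hF hg)
  simp_rw [← integral_repMeasure] at h1
  refine tendsto_nhds_unique h1 (tendsto_integral_of_L1 F hF.1
    (Eventually.of_forall fun n => (memLp_continuousMap _ (g n) 1).integrable (by norm_num)) ?_)
  have h2 : ∀ n, ∫⁻ k, ‖g n k - F k‖ₑ ∂(repMeasure π x) ≤
      eLpNorm (fun k => F k - g n k) 2 (repMeasure π x) *
        (repMeasure π x) Set.univ ^ (1 / (1 : ℝ≥0∞).toReal - 1 / (2 : ℝ≥0∞).toReal) := by
    intro n
    have := eLpNorm_le_eLpNorm_mul_rpow_measure_univ (p := 1) (q := 2)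
      (f := fun k => F k - g n k) (μ := repMeasure π x) (by norm_num)
      (hF.1.sub (aestronglyMeasurable_continuousMap _ _))
    rw [eLpNorm_one_eq_lintegral_enorm] at this
    refine le_trans (le_of_eq (lintegral_congr fun k => ?_)) this
    rw [← enorm_neg, neg_sub]
  refine tendsto_of_tendsto_of_tendsto_of_le_of_le tendsto_const_nhds ?_ (fun n => zero_le) h2
  have h3 := ENNReal.Tendsto.mul_const (b := (repMeasure π x) Set.univ ^
    (1 / (1 : ℝ≥0∞).toReal - 1 / (2 : ℝ≥0∞).toReal)) hg
    (Or.inr (ENNReal.rpow_ne_top_of_nonneg (by norm_num) (measure_ne_top _ _)))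
  simpa using h3

theorem enorm_sq_add_sub (x y : H) :
    ‖x + y‖ₑ ^ 2 + ‖x - y‖ₑ ^ 2 = 2 * ‖x‖ₑ ^ 2 + 2 * ‖y‖ₑ ^ 2 := by
  have h := parallelogram_law_with_norm ℂ x y
  have e : ∀ z : H, ‖z‖ₑ ^ 2 = ENNReal.ofReal (‖z‖ * ‖z‖) := fun z => by
    rw [← ofReal_norm, ← ENNReal.ofReal_pow (norm_nonneg _), sq]
  simp only [sq] at h
  rw [e, e, e, e, ← ENNReal.ofReal_add (by positivity) (by positivity), h, mul_add,
    ENNReal.ofReal_add (by positivity) (by positivity), ENNReal.ofReal_mul (by norm_num),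
    ENNReal.ofReal_mul (by norm_num)]
  simp

theorem repMeasure_add_add_sub (x y : H) :
    repMeasure π (x + y) + repMeasure π (x - y) =
      (2 : ℝ≥0∞) • repMeasure π x + (2 : ℝ≥0∞) • repMeasure π y := by
  refine measure_ext_of_lintegral_sq fun g => ?_
  simp only [lintegral_add_measure, lintegral_smul_measure, lintegral_repMeasure, map_add,
    map_sub, smul_eq_mul]
  exact enorm_sq_add_sub _ _

theorem repMeasure_add_le (x y : H) :
    repMeasure π (x + y) ≤ (2 : ℝ≥0∞) • repMeasure π x + (2 : ℝ≥0∞) • repMeasure π y := by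
  rw [← repMeasure_add_add_sub]
  exact Measure.le_add_right le_rfl

theorem repMeasure_smul (c : ℂ) (x : H) :
    repMeasure π (c • x) = (‖c‖ₑ ^ 2) • repMeasure π x := by
  refine measure_ext_of_lintegral_sq fun g => ?_
  simp only [lintegral_smul_measure, lintegral_repMeasure, map_smul, smul_eq_mul, enorm_smul,
    mul_pow]

theorem memLp_repMeasure_add {x y : H} {F : K → ℂ} (hx : MemLp F 2 (repMeasure π x))
    (hy : MemLp F 2 (repMeasure π y)) : MemLp F 2 (repMeasure π (x + y)) :=
  MemLp.mono_measure (repMeasure_add_le π x y)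
    (memLp_two_add_measure (hx.smul_measure (c := 2) (by simp))
      (hy.smul_measure (c := 2) (by simp)))

theorem repFun_vec_add {x y : H} {F : K → ℂ} (hx : MemLp F 2 (repMeasure π x))
    (hy : MemLp F 2 (repMeasure π y)) :
    repFun π F (x + y) = repFun π F x + repFun π F y := by
  have hxy := memLp_repMeasure_add π hx hy
  obtain ⟨g, hg⟩ := exists_continuous_tendsto_eLpNorm
    (memLp_two_add_measure (memLp_two_add_measure hx hy) hxy)
  have hm : ∀ ν : Measure K, ν ≤ repMeasure π x + repMeasure π y + repMeasure π (x + y) →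
      Tendsto (fun n => eLpNorm (fun k => F k - g n k) 2 ν) atTop (𝓝 0) := fun ν hν =>
    tendsto_of_tendsto_of_tendsto_of_le_of_le tendsto_const_nhds hg (fun n => zero_le)
      (fun n => eLpNorm_mono_measure _ hν)
  have h1 := tendsto_repFun π x hx (hm _ (Measure.le_add_right (Measure.le_add_right le_rfl)))
  have h2 := tendsto_repFun π y hy (hm _ (Measure.le_add_right (Measure.le_add_left le_rfl)))
  have h3 := tendsto_repFun π _ hxy (hm _ (Measure.le_add_left le_rfl))
  refine tendsto_nhds_unique h3 ?_
  simpa using h1.add h2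

theorem memLp_repMeasure_smul (c : ℂ) {x : H} {F : K → ℂ} (hx : MemLp F 2 (repMeasure π x)) :
    MemLp F 2 (repMeasure π (c • x)) := by
  rw [repMeasure_smul]
  exact hx.smul_measure (by simp)

theorem repFun_vec_smul (c : ℂ) {x : H} {F : K → ℂ} (hx : MemLp F 2 (repMeasure π x)) :
    repFun π F (c • x) = c • repFun π F x := by
  have hc := memLp_repMeasure_smul π c hx
  obtain ⟨g, h1, h2⟩ := exists_continuous_tendsto_eLpNorm_add hx hc
  refine tendsto_nhds_unique (tendsto_repFun π _ hc h2) ?_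
  simpa using (tendsto_repFun π _ hx h1).const_smul c

theorem repFun_add {x : H} {F G : K → ℂ} (hF : MemLp F 2 (repMeasure π x))
    (hG : MemLp G 2 (repMeasure π x)) :
    repFun π (fun k => F k + G k) x = repFun π F x + repFun π G x := by
  obtain ⟨f, hf⟩ := exists_continuous_tendsto_eLpNorm hF
  obtain ⟨g, hg⟩ := exists_continuous_tendsto_eLpNorm hG
  have h1 := tendsto_repFun π x (hF.add hG) (g := fun n => f n + g n) (by
    refine tendsto_of_tendsto_of_tendsto_of_le_of_le tendsto_const_nhds
      (by simpa using hf.add hg) (fun n => zero_le) (fun n => ?_)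
    refine le_trans (le_of_eq ?_) (eLpNorm_add_le (p := 2)
      (hF.1.sub (aestronglyMeasurable_continuousMap _ (f n)))
      (hG.1.sub (aestronglyMeasurable_continuousMap _ (g n))) (by norm_num))
    congr 1
    ext k
    simp
    ring)
  refine tendsto_nhds_unique h1 ?_
  simpa using (tendsto_repFun π x hF hf).add (tendsto_repFun π x hG hg)

theorem inner_repFun_left {x y : H} {F : K → ℂ} (hx : MemLp F 2 (repMeasure π x))
    (hy : MemLp F 2 (repMeasure π y)) :
    ⟪repFun π (fun k => conj (F k)) y, x⟫_ℂ = ⟪y, repFun π F x⟫_ℂ := by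
  obtain ⟨g, h1, h2⟩ := exists_continuous_tendsto_eLpNorm_add hx hy
  have h3 := tendsto_repFun π y (F := fun k => conj (F k)) hy.star (g := fun n => star (g n)) (by
    refine h2.congr fun n => ?_
    refine eLpNorm_congr_norm_ae (Eventually.of_forall fun k => ?_)
    rw [← RCLike.norm_conj (K := ℂ)]
    simp)
  have h4 := h3.inner (tendsto_const_nhds (x := x)) (𝕜 := ℂ)
  have h5 := (tendsto_const_nhds (x := y)).inner (tendsto_repFun π x hx h1) (𝕜 := ℂ)
  refine tendsto_nhds_unique h4 (h5.congr fun n => ?_)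
  rw [map_star, ContinuousLinearMap.star_eq_adjoint, ContinuousLinearMap.adjoint_inner_left]

theorem memLp_continuousMap_mul {μ : Measure K} (g : C(K, ℂ)) {F : K → ℂ} (hF : MemLp F 2 μ) :
    MemLp (fun k => g k * F k) 2 μ :=
  hF.of_le_mul (c := ‖g‖) (g.continuous.aestronglyMeasurable.mul hF.1)
    (Eventually.of_forall fun k => by
      rw [norm_mul]
      gcongr
      exact g.norm_coe_le_norm k)

theorem rep_repFun {x : H} (g : C(K, ℂ)) {F : K → ℂ} (hF : MemLp F 2 (repMeasure π x)) :
    π g (repFun π F x) = repFun π (fun k => g k * F k) x := by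
  obtain ⟨f, hf⟩ := exists_continuous_tendsto_eLpNorm hF
  have h1 := tendsto_repFun π x (memLp_continuousMap_mul g hF) (g := fun n => g * f n) (by
    have h0 := ENNReal.Tendsto.const_mul (a := ‖g‖ₑ) hf (Or.inr enorm_ne_top)
    refine tendsto_of_tendsto_of_tendsto_of_le_of_le tendsto_const_nhds
      (by simpa using h0) (fun n => zero_le) (fun n => ?_)
    have := eLpNorm_le_mul_eLpNorm_of_ae_le_mul (μ := repMeasure π x)
      (f := fun k => g k * F k - (g * f n) k) (g := fun k => F k - f n k) (c := ‖g‖)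
      (Eventually.of_forall fun k => by
        rw [ContinuousMap.mul_apply, ← mul_sub, norm_mul]
        gcongr
        exact g.norm_coe_le_norm k) 2
    rwa [ofReal_norm] at this)
  refine tendsto_nhds_unique ?_ h1
  simp only [map_mul, mul_apply_eq_comp]
  exact ((π g).continuous.tendsto _).comp (tendsto_repFun π x hF hf)

theorem repMeasure_repFun {x : H} {F : K → ℂ} (hF : MemLp F 2 (repMeasure π x)) :
    repMeasure π (repFun π F x) = (repMeasure π x).withDensity fun k => ‖F k‖ₑ ^ 2 := by
  refine measure_ext_of_lintegral_sq fun g => ?_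
  rw [lintegral_repMeasure, rep_repFun π g hF, enorm_repFun π x (memLp_continuousMap_mul g hF),
    eLpNorm_two_sq, lintegral_withDensity_eq_lintegral_mul₀ (hF.1.enorm.pow_const 2)
      (by fun_prop)]
  refine lintegral_congr fun k => ?_
  simp [mul_pow, mul_comm]

theorem eLpNorm_withDensity_sq {μ : Measure K} {F G : K → ℂ} (hF : AEStronglyMeasurable F μ)
    (hG : Measurable G) : eLpNorm G 2 (μ.withDensity fun k => ‖F k‖ₑ ^ 2)
      = eLpNorm (fun k => G k * F k) 2 μ := by
  apply (ENNReal.pow_right_strictMono two_ne_zero).injective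
  dsimp only
  rw [eLpNorm_two_sq, eLpNorm_two_sq, lintegral_withDensity_eq_lintegral_mul₀
    (hF.enorm.pow_const 2) (by fun_prop)]
  refine lintegral_congr fun k => ?_
  simp [mul_pow, mul_comm]

theorem repFun_repFun {x : H} {F G : K → ℂ} (hF : MemLp F 2 (repMeasure π x)) (hG : Measurable G)
    (hGF : MemLp (fun k => G k * F k) 2 (repMeasure π x)) :
    MemLp G 2 (repMeasure π (repFun π F x)) ∧
    repFun π G (repFun π F x) = repFun π (fun k => G k * F k) x := by
  have hm : MemLp G 2 (repMeasure π (repFun π F x)) := by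
    refine ⟨hG.aestronglyMeasurable, ?_⟩
    rw [repMeasure_repFun π hF, eLpNorm_withDensity_sq hF.1 hG]
    exact hGF.2
  refine ⟨hm, ?_⟩
  obtain ⟨g, hg⟩ := exists_continuous_tendsto_eLpNorm hm
  have h1 := tendsto_repFun π _ hm hg
  simp_rw [rep_repFun π _ hF] at h1
  refine tendsto_nhds_unique h1 ?_
  rw [tendsto_iff_edist_tendsto_0]
  refine hg.congr fun n => ?_
  have hgF := memLp_continuousMap_mul (g n) hF
  have e1 : repFun π (fun k => G k * F k) x = repFun π (fun k => g n k * F k) x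
      + repFun π (fun k => (G k - g n k) * F k) x := by
    rw [← repFun_add π hgF]
    · congr 1
      ext k
      ring
    · convert hGF.sub hgF using 1
      ext k
      simp [sub_mul]
  have hd : MemLp (fun k => (G k - g n k) * F k) 2 (repMeasure π x) := by
    convert hGF.sub hgF using 1
    ext k
    simp [sub_mul]
  rw [edist_comm, edist_eq_enorm_sub, e1, add_sub_cancel_left, enorm_repFun π x hd,
    repMeasure_repFun π hF, eLpNorm_withDensity_sq hF.1]
  exact hG.sub (g n).continuous.measurable

theorem repFun_congr {x : H} {F G : K → ℂ} (hF : MemLp F 2 (repMeasure π x))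
    (h : F =ᵐ[repMeasure π x] G) : repFun π F x = repFun π G x := by
  obtain ⟨g, hg⟩ := exists_continuous_tendsto_eLpNorm hF
  refine tendsto_nhds_unique (tendsto_repFun π x hF hg)
    (tendsto_repFun π x (hF.ae_eq h) (hg.congr fun n => eLpNorm_congr_ae ?_))
  filter_upwards [h] with k hk
  rw [hk]

end Representation

/-! ### Borel functional calculi on the real line -/

section Calculus

variable (H : Type*) [NormedAddCommGroup H] [InnerProductSpace ℂ H] [CompleteSpace H]

/-- A Borel functional calculus on the line: to each vector `x` belongs a finite measure `meas x`,
and `fn f x` is the vector `f(A) x`, meaningful when `f` is square integrable for `meas x`; the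
map `f ↦ f(A) x` is then an isometry on `L²(meas x)`. -/
structure BorelCalculus where
  /-- The spectral measure of a vector. -/
  meas : H → Measure ℝ
  /-- The vector `f(A) x`. -/
  fn : (ℝ → ℂ) → H → H
  finite : ∀ x, IsFiniteMeasure (meas x)
  enorm_fn : ∀ {x f}, MemLp f 2 (meas x) → ‖fn f x‖ₑ = eLpNorm f 2 (meas x)
  inner_fn : ∀ {x f}, MemLp f 2 (meas x) → ⟪x, fn f x⟫_ℂ = ∫ t, f t ∂(meas x)
  meas_add_le : ∀ x y, meas (x + y) ≤ (2 : ℝ≥0∞) • meas x + (2 : ℝ≥0∞) • meas y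
  meas_smul : ∀ (c : ℂ) x, meas (c • x) = (‖c‖ₑ ^ 2) • meas x
  fn_vec_add : ∀ {x y f}, MemLp f 2 (meas x) → MemLp f 2 (meas y) →
    fn f (x + y) = fn f x + fn f y
  fn_vec_smul : ∀ (c : ℂ) {x f}, MemLp f 2 (meas x) → fn f (c • x) = c • fn f x
  fn_add : ∀ {x f g}, MemLp f 2 (meas x) → MemLp g 2 (meas x) →
    fn (fun t => f t + g t) x = fn f x + fn g x
  fn_const : ∀ (c : ℂ) x, fn (fun _ => c) x = c • x
  inner_fn_left : ∀ {x y f}, MemLp f 2 (meas x) → MemLp f 2 (meas y) →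
    ⟪fn (fun t => conj (f t)) y, x⟫_ℂ = ⟪y, fn f x⟫_ℂ
  memLp_fn : ∀ {x f g}, MemLp f 2 (meas x) → Measurable g →
    MemLp (fun t => g t * f t) 2 (meas x) → MemLp g 2 (meas (fn f x))
  fn_fn : ∀ {x f g}, MemLp f 2 (meas x) → Measurable g →
    MemLp (fun t => g t * f t) 2 (meas x) → fn g (fn f x) = fn (fun t => g t * f t) x

variable {H}

/-- The calculus is that of the operator `A`: `A` is the function `t ↦ t` of itself. -/
def BorelCalculus.Represents (C : BorelCalculus H) (A : H →ₗ.[ℂ] H) : Prop :=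
  (∀ x, x ∈ A.domain ↔ MemLp (fun t : ℝ => (t : ℂ)) 2 (C.meas x)) ∧
    ∀ x : A.domain, A x = C.fn (fun t : ℝ => (t : ℂ)) x

/-- The Borel functional calculus that a representation of `C(K)` and a Borel function
`φ : K → ℝ` generate: `f` acts as `f ∘ φ`. -/
noncomputable def repCalculus {K : Type*} [MetricSpace K] [CompactSpace K] [MeasurableSpace K]
    [BorelSpace K] (π : C(K, ℂ) →⋆ₐ[ℂ] (H →L[ℂ] H)) (φ : K → ℝ) (hφ : Measurable φ) :
    BorelCalculus H :=
  have hm : ∀ {x : H} {f : ℝ → ℂ}, MemLp f 2 ((repMeasure π x).map φ) →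
      MemLp (fun k => f (φ k)) 2 (repMeasure π x) := fun {x f} h =>
    (memLp_map_measure_iff h.1 hφ.aemeasurable).mp h
  { meas := fun x => (repMeasure π x).map φ
    fn := fun f x => repFun π (fun k => f (φ k)) x
    finite := fun x => inferInstance
    enorm_fn := by
      intro x f hf
      rw [enorm_repFun π x (hm hf), eLpNorm_map_measure hf.1 hφ.aemeasurable]
      rfl
    inner_fn := by
      intro x f hf
      rw [inner_repFun π x (hm hf), integral_map hφ.aemeasurable hf.1]
    meas_add_le := by
      intro x y
      rw [← Measure.map_smul, ← Measure.map_smul, ← Measure.map_add _ _ hφ]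
      exact Measure.map_mono (repMeasure_add_le π x y) hφ
    meas_smul := by
      intro c x
      rw [repMeasure_smul, Measure.map_smul]
    fn_vec_add := fun hx hy => repFun_vec_add π (hm hx) (hm hy)
    fn_vec_smul := fun c _ _ hx => repFun_vec_smul π c (hm hx)
    fn_add := fun hf hg => repFun_add π (hm hf) (hm hg)
    fn_const := by
      intro c x
      have h := repFun_continuousMap π x (c • 1)
      rw [map_smul, map_one] at h
      have e : ((c • (1 : C(K, ℂ)) : C(K, ℂ)) : K → ℂ) = fun _ => c := by
        ext k
        simp
      rw [e] at h
      exact h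
    inner_fn_left := fun hx hy => inner_repFun_left π (hm hx) (hm hy)
    memLp_fn := by
      intro x f g hf hg hgf
      exact (memLp_map_measure_iff hg.aestronglyMeasurable hφ.aemeasurable).mpr
        (repFun_repFun π (G := fun k => g (φ k)) (hm hf) (hg.comp hφ) (hm hgf)).1
    fn_fn := by
      intro x f g hf hg hgf
      have h1 := hm hf
      have h2 := hm hgf
      exact (repFun_repFun π (G := fun k => g (φ k)) h1 (hg.comp hφ) h2).2 }

end Calculus

/-! ### The spectral theorem for unbounded self-adjoint operators -/

section SpectralTheorem

variable {H : Type*} [NormedAddCommGroup H] [InnerProductSpace ℂ H] [CompleteSpace H]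

theorem LinearPMap.inner_apply_eq {A : H →ₗ.[ℂ] H} (hA : IsSelfAdjoint A) (x y : A.domain) :
    ⟪A x, (y : H)⟫_ℂ = ⟪(x : H), A y⟫_ℂ := by
  have h := LinearPMap.adjoint_isFormalAdjoint hA.dense_domain
  rw [LinearPMap.isSelfAdjoint_def.mp hA] at h
  exact h x y

theorem LinearPMap.mem_domain_of_inner {A : H →ₗ.[ℂ] H} (hA : IsSelfAdjoint A) {y w : H}
    (h : ∀ x : A.domain, ⟪w, (x : H)⟫_ℂ = ⟪y, A x⟫_ℂ) :
    ∃ hy : y ∈ A.domain, A ⟨y, hy⟩ = w := by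
  have h1 := LinearPMap.mem_adjoint_domain_of_exists (T := A) y ⟨w, h⟩
  have h2 := LinearPMap.adjoint_apply_eq hA.dense_domain ⟨y, h1⟩ h
  have h3 := LinearPMap.isSelfAdjoint_def.mp hA
  have h1' : y ∈ A.domain := by rwa [h3] at h1
  refine ⟨h1', ?_⟩
  rw [← h2]
  exact ((LinearPMap.ext_iff.mp h3).2 (x := y) (hf := h1) (hg := h1')).symm

theorem LinearPMap.norm_apply_sub_smul_sq {A : H →ₗ.[ℂ] H} (hA : IsSelfAdjoint A) (σ : ℝ)
    (x : A.domain) :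
    ‖A x - (σ * Complex.I) • (x : H)‖ ^ 2 = ‖A x‖ ^ 2 + σ ^ 2 * ‖(x : H)‖ ^ 2 := by
  have h0 : (⟪A x, (x : H)⟫_ℂ).im = 0 := by
    have h1 : conj ⟪A x, (x : H)⟫_ℂ = ⟪A x, (x : H)⟫_ℂ := by
      rw [inner_conj_symm, LinearPMap.inner_apply_eq hA]
    exact Complex.conj_eq_iff_im.mp h1
  rw [norm_sub_sq (𝕜 := ℂ), inner_smul_right, norm_smul, mul_pow]
  simp [h0]

/-- `A - iσ` is a bijection from the domain of a self-adjoint `A` onto the whole space when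
`σ = ±1`: it expands distances, its range is closed because `A` is closed, and a vector
orthogonal to the range is an eigenvector for the eigenvalue `-iσ`. -/
theorem LinearPMap.exists_resolvent {A : H →ₗ.[ℂ] H} (hA : IsSelfAdjoint A) {σ : ℝ}
    (hσ : σ ^ 2 = 1) :
    ∃ N : H →L[ℂ] H,
      (∀ y : H, ∃ h : N y ∈ A.domain, A ⟨N y, h⟩ - (σ * Complex.I) • N y = y) ∧
      ∀ x : A.domain, N (A x - (σ * Complex.I) • (x : H)) = x := by
  have hle : ∀ x : A.domain, ‖(x : H)‖ ≤ ‖A x - (σ * Complex.I) • (x : H)‖ := by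
    intro x
    have := norm_apply_sub_smul_sq hA σ x
    rw [hσ] at this
    refine le_of_sq_le_sq ?_ (norm_nonneg _)
    rw [this]
    nlinarith [sq_nonneg ‖A x‖]
  have hle2 : ∀ x : A.domain, ‖A x‖ ≤ ‖A x - (σ * Complex.I) • (x : H)‖ := by
    intro x
    have := norm_apply_sub_smul_sq hA σ x
    rw [hσ] at this
    refine le_of_sq_le_sq ?_ (norm_nonneg _)
    rw [this]
    nlinarith [sq_nonneg ‖(x : H)‖]
  -- the map `(x, A x) ↦ A x - iσ x` on the graph of `A`
  let T : A.graph →L[ℂ] H := (ContinuousLinearMap.snd ℂ H H -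
    (σ * Complex.I : ℂ) • ContinuousLinearMap.fst ℂ H H).comp A.graph.subtypeL
  have hT : ∀ p : A.graph, ‖p‖ ≤ 1 * ‖T p‖ := by
    rintro ⟨⟨a, b⟩, hp⟩
    obtain ⟨x, rfl, rfl⟩ := (LinearPMap.mem_graph_iff A).mp hp
    rw [one_mul]
    exact max_le (hle x) (hle2 x)
  have hcl : _root_.IsClosed (A.graph : Set (H × H)) := hA.isClosed
  have : CompleteSpace A.graph := hcl.completeSpace_coe
  have hrc : _root_.IsClosed (T.range : Set H) := by
    have := (AddMonoidHomClass.antilipschitz_of_bound T (K := 1) hT).isClosed_range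
      T.uniformContinuous
    rw [LinearMap.coe_range]
    exact this
  have hbot : T.rangeᗮ = ⊥ := by
    rw [Submodule.eq_bot_iff]
    intro y hy
    have h1 : ∀ x : A.domain, ⟪(-(σ * Complex.I)) • y, (x : H)⟫_ℂ = ⟪y, A x⟫_ℂ := by
      intro x
      have := (Submodule.mem_orthogonal' _ _).mp hy
        (A x - (σ * Complex.I) • (x : H)) ⟨⟨((x : H), A x), A.mem_graph x⟩, rfl⟩
      rw [inner_sub_right, inner_smul_right, sub_eq_zero] at this
      rw [this, inner_smul_left]
      simp
    obtain ⟨hy', hy2⟩ := LinearPMap.mem_domain_of_inner hA h1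
    have h3 := norm_apply_sub_smul_sq hA (-σ) ⟨y, hy'⟩
    rw [hy2] at h3
    simp only [Complex.ofReal_neg, neg_mul, sub_self, norm_zero, even_two, Even.neg_pow, hσ] at h3
    have : ‖y‖ ^ 2 = 0 := by nlinarith [sq_nonneg ‖y‖, sq_nonneg ‖-(σ * Complex.I : ℂ) • y‖]
    simpa using this
  have htop : T.range = ⊤ := by
    have : CompleteSpace T.range := hrc.completeSpace_coe
    exact Submodule.orthogonal_eq_bot_iff.mp hbot
  have hsurj : ∀ y : H, ∃ x : A.domain, A x - (σ * Complex.I) • (x : H) = y := by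
    intro y
    obtain ⟨⟨⟨a, b⟩, hp⟩, rfl⟩ : y ∈ T.range := htop ▸ Submodule.mem_top
    obtain ⟨x, rfl, rfl⟩ := (LinearPMap.mem_graph_iff A).mp hp
    exact ⟨x, rfl⟩
  have hinj : ∀ x x' : A.domain, A x - (σ * Complex.I) • (x : H)
      = A x' - (σ * Complex.I) • (x' : H) → x = x' := by
    intro x x' h
    have h2 := hle (x - x')
    have e : A (x - x') - (σ * Complex.I) • ((x - x' : A.domain) : H) = 0 := by
      rw [LinearPMap.map_sub, Submodule.coe_sub, smul_sub]
      rw [← sub_eq_zero] at h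
      rw [← h]
      abel
    rw [e, norm_zero, norm_le_zero_iff] at h2
    exact sub_eq_zero.mp (Subtype.ext h2)
  choose R hR using hsurj
  let N : H →ₗ[ℂ] H :=
    { toFun := fun y => R y
      map_add' := by
        intro y y'
        rw [← Submodule.coe_add]
        congr 1
        apply hinj
        rw [hR, LinearPMap.map_add, Submodule.coe_add, smul_add]
        nth_rewrite 1 [← hR y, ← hR y']
        abel
      map_smul' := by
        intro c y
        rw [RingHom.id_apply, ← Submodule.coe_smul]
        congr 1
        apply hinj
        rw [hR, LinearPMap.map_smul, Submodule.coe_smul, smul_comm _ c, ← smul_sub, hR] }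
  refine ⟨N.mkContinuous 1 fun y => ?_, fun y => ⟨(R y).2, hR y⟩, fun x => ?_⟩
  · have := hle (R y)
    rw [hR] at this
    simpa [N] using this
  · change ((R _ : A.domain) : H) = x
    congr 1
    exact hinj _ _ (hR _)

/-- Every self-adjoint operator has a Borel functional calculus. It is obtained from the
continuous functional calculus of the normal operator `N = (A - i)⁻¹`: the point `ζ ≠ 0` of the
spectrum of `N` corresponds to the real number `ζ⁻¹ + i`, and `0` carries no mass because `N` is
injective. -/
theorem exists_borelCalculus {A : H →ₗ.[ℂ] H} (hA : IsSelfAdjoint A) :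
    ∃ C : BorelCalculus H, C.Represents A := by
  obtain ⟨N, hN1, hN2⟩ := LinearPMap.exists_resolvent hA (σ := 1) (by norm_num)
  obtain ⟨M, hM1, hM2⟩ := LinearPMap.exists_resolvent hA (σ := -1) (by norm_num)
  simp only [Complex.ofReal_one, one_mul, Complex.ofReal_neg, neg_smul, sub_neg_eq_add,
    neg_mul] at hN1 hN2 hM1 hM2
  have hadj : star N = M := by
    rw [ContinuousLinearMap.star_eq_adjoint]
    symm
    rw [ContinuousLinearMap.eq_adjoint_iff]
    intro z y
    obtain ⟨h1, h2⟩ := hN1 y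
    obtain ⟨h3, h4⟩ := hM1 z
    conv_rhs => rw [← h4]
    conv_lhs => rw [← h2]
    rw [inner_sub_right, inner_add_left, inner_smul_left, inner_smul_right,
      LinearPMap.inner_apply_eq hA ⟨M z, h3⟩ ⟨N y, h1⟩]
    simp [sub_eq_add_neg]
  have hNM : ∀ y, N y - M y = (2 * Complex.I) • N (M y) := by
    intro y
    obtain ⟨h3, h4⟩ := hM1 y
    have h5 := hN2 ⟨M y, h3⟩
    have h6 : A ⟨M y, h3⟩ - Complex.I • M y = y - (2 * Complex.I) • M y := by
      rw [eq_sub_of_add_eq h4]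
      module
    rw [h6, map_sub, map_smul] at h5
    change _ = M y at h5
    conv_lhs => rw [← h5]
    abel
  have hMN : ∀ y, N y - M y = (2 * Complex.I) • M (N y) := by
    intro y
    obtain ⟨h3, h4⟩ := hN1 y
    have h5 := hM2 ⟨N y, h3⟩
    have h6 : A ⟨N y, h3⟩ + Complex.I • N y = y + (2 * Complex.I) • N y := by
      rw [eq_add_of_sub_eq h4]
      module
    rw [h6, map_add, map_smul] at h5
    change _ = N y at h5
    conv_lhs => rw [← h5]
    abel
  have h2I : (2 * Complex.I : ℂ) ≠ 0 := by simp
  have hnormal : IsStarNormal N := by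
    refine ⟨?_⟩
    rw [hadj]
    ext y
    exact (smul_right_injective H h2I) ((hMN y).symm.trans (hNM y))
  have hNinj : ∀ y, N y = 0 → y = 0 := by
    intro y hy
    obtain ⟨h1, h2⟩ := hN1 y
    have e : (⟨N y, h1⟩ : A.domain) = 0 := Subtype.ext hy
    rw [e, hy] at h2
    simpa using h2.symm
  let π : C(spectrum ℂ N, ℂ) →⋆ₐ[ℂ] (H →L[ℂ] H) := cfcHom hnormal
  let ζ : C(spectrum ℂ N, ℂ) := (ContinuousMap.id ℂ).restrict (spectrum ℂ N)
  have hπζ : π ζ = N := cfcHom_id hnormal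
  have hζ : ζ - star ζ = (2 * Complex.I) • (star ζ * ζ) := by
    apply (cfcHom_isClosedEmbedding hnormal).injective
    change π _ = π _
    rw [map_sub, map_smul, map_mul, map_star, hπζ, hadj]
    ext y
    exact hMN y
  have hζ' : ∀ k, (ζ k).im = ‖ζ k‖ ^ 2 := by
    intro k
    have h1 := congrArg (fun f : C(spectrum ℂ N, ℂ) => (f k).im) hζ
    simp only [ContinuousMap.sub_apply, ContinuousMap.star_apply, RCLike.star_def,
      ContinuousMap.smul_apply, ContinuousMap.mul_apply, smul_eq_mul] at h1
    rw [Complex.conj_mul', mul_assoc, ← Complex.ofReal_pow] at h1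
    simp only [Complex.sub_im, Complex.conj_im, Complex.mul_im, Complex.I_re, Complex.I_im,
      Complex.ofReal_re, Complex.ofReal_im, Complex.mul_re, Complex.re_ofNat,
      Complex.im_ofNat] at h1
    linarith
  let _ : MeasurableSpace (spectrum ℂ N) := borel _
  have _ : BorelSpace (spectrum ℂ N) := ⟨rfl⟩
  let φ : spectrum ℂ N → ℝ := fun k => ((ζ k)⁻¹).re
  have hφ : Measurable φ := Complex.measurable_re.comp ζ.continuous.measurable.inv
  have hφ' : ∀ k, ζ k ≠ 0 → (φ k : ℂ) - Complex.I = (ζ k)⁻¹ := by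
    intro k hk
    have h1 : Complex.normSq (ζ k) ≠ 0 := by simpa using hk
    apply Complex.ext
    · simp [φ]
    · simp only [Complex.sub_im, Complex.ofReal_im, Complex.I_im, Complex.inv_im, hζ' k]
      rw [Complex.normSq_eq_norm_sq] at h1 ⊢
      field_simp
      norm_num
  -- the point `0` of the spectrum of `N` carries no mass
  have hnull : ∀ x : H, ∀ᵐ k ∂(repMeasure π x), ζ k ≠ 0 := by
    intro x
    let F : spectrum ℂ N → ℂ := Set.indicator {k | ζ k = 0} (fun _ => 1)
    have hS : MeasurableSet {k | ζ k = 0} := ζ.continuous.measurable (measurableSet_singleton 0)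
    have hF : MemLp F 2 (repMeasure π x) :=
      memLp_indicator_const 2 hS 1 (Or.inr (measure_ne_top _ _))
    have h1 := rep_repFun π ζ hF
    have h2 : (fun k => ζ k * F k) = ((0 : C(spectrum ℂ N, ℂ)) : spectrum ℂ N → ℂ) := by
      ext k
      by_cases hk : ζ k = 0 <;> simp [F, hk]
    rw [h2, repFun_continuousMap, map_zero, hπζ] at h1
    have h3 := enorm_repFun π x hF
    rw [hNinj _ h1, enorm_zero] at h3
    have h4 := (eLpNorm_eq_zero_iff hF.1 (by norm_num)).mp h3.symm
    filter_upwards [h4] with k hk hk0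
    simp [F, hk0] at hk
  refine ⟨repCalculus π φ hφ, ?_⟩
  have hmem : ∀ x : H, MemLp (fun t : ℝ => (t : ℂ)) 2 ((repCalculus π φ hφ).meas x) ↔
      MemLp (fun k => (φ k : ℂ)) 2 (repMeasure π x) := fun x =>
    memLp_map_measure_iff (by fun_prop) hφ.aemeasurable
  have hφζ : ∀ k, ζ k ≠ 0 → (φ k : ℂ) * ζ k = 1 + Complex.I * ζ k := by
    intro k hk
    have := hφ' k hk
    rw [sub_eq_iff_eq_add] at this
    rw [this, add_mul, inv_mul_cancel₀ hk]
  have hdir : ∀ x : A.domain, MemLp (fun k => (φ k : ℂ)) 2 (repMeasure π (x : H)) ∧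
      A x = repFun π (fun k => (φ k : ℂ)) x := by
    intro x
    set y := A x - Complex.I • (x : H) with hy
    have hx : (x : H) = repFun π ζ y := by rw [repFun_continuousMap, hπζ, hN2]
    have hae : (((1 : C(spectrum ℂ N, ℂ)) + Complex.I • ζ : C(spectrum ℂ N, ℂ)) :
        spectrum ℂ N → ℂ) =ᵐ[repMeasure π y] fun k => (φ k : ℂ) * ζ k := by
      filter_upwards [hnull y] with k hk
      simp [hφζ k hk]
    have h0 := memLp_continuousMap (repMeasure π y) (1 + Complex.I • ζ) 2
    have h1 := repFun_repFun π (memLp_continuousMap (repMeasure π y) ζ 2)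
      (G := fun k => (φ k : ℂ)) (Complex.measurable_ofReal.comp hφ) (h0.ae_eq hae)
    rw [← hx] at h1
    refine ⟨h1.1, ?_⟩
    rw [h1.2, ← repFun_congr π h0 hae, repFun_continuousMap, map_add, map_smul, hπζ, map_one]
    simp only [add_apply, smul_apply, one_apply_eq_self]
    rw [hN2, hy]
    abel
  refine ⟨fun x => ⟨fun hx => (hmem x).mpr (hdir ⟨x, hx⟩).1, fun hx => ?_⟩, fun x => (hdir x).2⟩
  have hx' := (hmem x).mp hx
  have hG : MemLp (fun k => (φ k : ℂ) - Complex.I) 2 (repMeasure π x) :=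
    hx'.sub (memLp_const _)
  have h1 := rep_repFun π ζ hG
  have hae : ((1 : C(spectrum ℂ N, ℂ)) : spectrum ℂ N → ℂ) =ᵐ[repMeasure π x]
      fun k => ζ k * ((φ k : ℂ) - Complex.I) := by
    filter_upwards [hnull x] with k hk
    rw [hφ' k hk, mul_inv_cancel₀ hk]
    rfl
  rw [← repFun_congr π (memLp_continuousMap _ _ _) hae, repFun_continuousMap, map_one, hπζ] at h1
  obtain ⟨h, -⟩ := hN1 (repFun π (fun k => (φ k : ℂ) - Complex.I) x)
  rw [h1] at h
  exact h

end SpectralTheorem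

/-! ### Bounded functions, the unitary group and the resolvent -/

section Consequences

variable {H : Type*} [NormedAddCommGroup H] [InnerProductSpace ℂ H] [CompleteSpace H]

namespace BorelCalculus

variable (C : BorelCalculus H)

instance (x : H) : IsFiniteMeasure (C.meas x) := C.finite x

theorem meas_univ (x : H) : C.meas x Set.univ = ‖x‖ₑ ^ 2 := by
  have h1 := C.enorm_fn (x := x) (f := fun _ => 1) (memLp_const _)
  rw [C.fn_const, one_smul] at h1
  rw [h1, eLpNorm_two_sq]
  simp

theorem memLp_of_bound {f : ℝ → ℂ} (hf : Measurable f) {c : ℝ} (hc : ∀ t, ‖f t‖ ≤ c) (x : H)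
    (p : ℝ≥0∞) : MemLp f p (C.meas x) :=
  MemLp.of_bound hf.aestronglyMeasurable c (Eventually.of_forall hc)

theorem enorm_fn_sq {x : H} {f : ℝ → ℂ} (hf : MemLp f 2 (C.meas x)) :
    ‖C.fn f x‖ₑ ^ 2 = ∫⁻ t, ‖f t‖ₑ ^ 2 ∂(C.meas x) := by
  rw [C.enorm_fn hf, eLpNorm_two_sq]

theorem norm_fn_le {f : ℝ → ℂ} (hf : Measurable f) {c : ℝ} (hc : ∀ t, ‖f t‖ ≤ c) (x : H) :
    ‖C.fn f x‖ ≤ c * ‖x‖ := by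
  have hc0 : 0 ≤ c := (norm_nonneg _).trans (hc 0)
  have h1 := C.enorm_fn_sq (C.memLp_of_bound hf hc x 2)
  have h2 : ∫⁻ t, ‖f t‖ₑ ^ 2 ∂(C.meas x) ≤ ∫⁻ _, ENNReal.ofReal c ^ 2 ∂(C.meas x) := by
    refine lintegral_mono fun t => ?_
    gcongr
    rw [← ofReal_norm]
    exact ENNReal.ofReal_le_ofReal (hc t)
  rw [lintegral_const, meas_univ, ← mul_pow, ← h1] at h2
  have h3 : ‖C.fn f x‖ₑ ≤ ENNReal.ofReal c * ‖x‖ₑ :=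
    (ENNReal.pow_right_strictMono two_ne_zero).le_iff_le.mp h2
  rw [← ofReal_norm, ← ofReal_norm, ← ENNReal.ofReal_mul hc0] at h3
  exact (ENNReal.ofReal_le_ofReal_iff (by positivity)).mp h3

theorem fn_smul {x : H} {f : ℝ → ℂ} (hf : MemLp f 2 (C.meas x)) (c : ℂ) :
    C.fn (fun t => c * f t) x = c • C.fn f x := by
  rw [← C.fn_const c (C.fn f x), C.fn_fn hf measurable_const (hf.const_mul c)]

theorem fn_sub {x : H} {f g : ℝ → ℂ} (hf : MemLp f 2 (C.meas x)) (hg : MemLp g 2 (C.meas x)) :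
    C.fn (fun t => f t - g t) x = C.fn f x - C.fn g x := by
  have h := C.fn_add hf (hg.const_mul (-1))
  rw [C.fn_smul hg] at h
  simpa [sub_eq_add_neg] using h

theorem fn_finset_sum {ι : Type*} {x : H} {f : ι → ℝ → ℂ} (s : Finset ι)
    (hf : ∀ i ∈ s, MemLp (f i) 2 (C.meas x)) :
    C.fn (fun t => ∑ i ∈ s, f i t) x = ∑ i ∈ s, C.fn (f i) x := by
  classical
  induction s using Finset.induction_on with
  | empty => simpa using C.fn_const 0 x
  | insert a s ha ih =>
    rw [Finset.sum_insert ha, ← ih fun i hi => hf i (Finset.mem_insert_of_mem hi)]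
    simp_rw [Finset.sum_insert ha]
    exact C.fn_add (hf a (Finset.mem_insert_self _ _))
      (memLp_finsetSum s fun i hi => hf i (Finset.mem_insert_of_mem hi))

/-- Dominated convergence for the functional calculus. -/
theorem tendsto_fn {ι : Type*} {l : Filter ι} [l.IsCountablyGenerated] {x : H}
    {F : ι → ℝ → ℂ} {f b : ℝ → ℂ} (hF : ∀ n, Measurable (F n)) (hfm : Measurable f)
    (hf : MemLp f 2 (C.meas x)) (hb : MemLp b 2 (C.meas x)) (h : ∀ n t, ‖F n t‖ ≤ ‖b t‖)
    (hlim : ∀ t, Tendsto (fun n => F n t) l (𝓝 (f t))) :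
    Tendsto (fun n => C.fn (F n) x) l (𝓝 (C.fn f x)) := by
  have hF' : ∀ n, MemLp (F n) 2 (C.meas x) := fun n =>
    hb.mono (hF n).aestronglyMeasurable (Eventually.of_forall (h n))
  have h1 : Tendsto (fun n => ∫⁻ t, ‖F n t - f t‖ₑ ^ 2 ∂(C.meas x)) l (𝓝 0) := by
    have h2 := tendsto_lintegral_filter_of_dominated_convergence (μ := C.meas x) (l := l)
      (F := fun n t => ‖F n t - f t‖ₑ ^ 2) (f := fun _ => 0)
      (fun t => ‖(‖b t‖ + ‖f t‖ : ℂ)‖ₑ ^ 2) ?_ ?_ ?_ ?_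
    · simpa using h2
    · refine Eventually.of_forall fun n => ?_
      have := hF n
      fun_prop
    · refine Eventually.of_forall fun n => Eventually.of_forall fun t => ?_
      gcongr
      rw [enorm_le_iff_norm_le, ← Complex.ofReal_add, Complex.norm_real, Real.norm_of_nonneg
        (by positivity)]
      exact (norm_sub_le _ _).trans (by gcongr; exact h n t)
    · have h3 : MemLp (fun t => (‖b t‖ + ‖f t‖ : ℂ)) 2 (C.meas x) := by
        have := (hb.norm.add hf.norm).ofReal (K := ℂ)
        refine this.ae_eq (Eventually.of_forall fun t => ?_)
        simp
      have h4 := h3.2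
      rw [← eLpNorm_two_sq]
      exact (ENNReal.pow_lt_top h4).ne
    · refine Eventually.of_forall fun t => ?_
      have h3 := ((hlim t).sub_const (f t)).enorm
      rw [sub_self, enorm_zero] at h3
      simpa using ENNReal.Tendsto.pow (n := 2) h3
  rw [tendsto_iff_edist_tendsto_0]
  have h5 := ((ENNReal.continuous_rpow_const (y := (1 / 2 : ℝ))).tendsto 0).comp h1
  rw [ENNReal.zero_rpow_of_pos (by norm_num)] at h5
  refine h5.congr fun n => ?_
  have h6 : MemLp (fun t => F n t - f t) 2 (C.meas x) := (hF' n).sub hf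
  rw [Function.comp_apply, ← C.enorm_fn_sq h6, edist_eq_enorm_sub,
    C.fn_sub (hF' n) hf, ← ENNReal.rpow_natCast, ← ENNReal.rpow_mul]
  norm_num

open Classical in
/-- The bounded operator `f(A)` for a bounded Borel function `f`; it is `0` for other `f`. -/
noncomputable def bdd (f : ℝ → ℂ) : H →L[ℂ] H :=
  if h : Measurable f ∧ ∃ c, ∀ t, ‖f t‖ ≤ c then
    LinearMap.mkContinuous
      { toFun := C.fn f
        map_add' := fun x y => C.fn_vec_add (C.memLp_of_bound h.1 h.2.choose_spec x 2)
          (C.memLp_of_bound h.1 h.2.choose_spec y 2)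
        map_smul' := fun c x => C.fn_vec_smul c (C.memLp_of_bound h.1 h.2.choose_spec x 2) }
      h.2.choose fun x => C.norm_fn_le h.1 h.2.choose_spec x
  else 0

theorem bdd_apply {f : ℝ → ℂ} (hf : Measurable f) {c : ℝ} (hc : ∀ t, ‖f t‖ ≤ c) (x : H) :
    C.bdd f x = C.fn f x := by
  rw [bdd, dif_pos ⟨hf, c, hc⟩]
  rfl

/-- The character `t ↦ e^{-ist}`. -/
noncomputable def _root_.expChar (s t : ℝ) : ℂ := Complex.exp (-(Complex.I * s * t))

theorem _root_.expChar_eq (s t : ℝ) :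
    expChar s t = Complex.exp (((-(s * t) : ℝ) : ℂ) * Complex.I) := by
  rw [expChar]
  congr 1
  push_cast
  ring

@[simp] theorem _root_.norm_expChar (s t : ℝ) : ‖expChar s t‖ = 1 := by
  rw [expChar_eq]
  exact Complex.norm_exp_ofReal_mul_I _

theorem _root_.norm_expChar_sub_one_le (s t : ℝ) : ‖expChar s t - 1‖ ≤ |s| * |t| := by
  rw [expChar_eq, mul_comm]
  have := Real.norm_exp_I_mul_ofReal_sub_one_le (x := -(s * t))
  simpa [abs_mul] using this

theorem _root_.continuous_expChar (s : ℝ) : Continuous (expChar s) := by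
  unfold expChar
  fun_prop

theorem _root_.measurable_expChar (s : ℝ) : Measurable (expChar s) :=
  (continuous_expChar s).measurable

theorem _root_.expChar_add (s r t : ℝ) : expChar (s + r) t = expChar s t * expChar r t := by
  rw [expChar, expChar, expChar, ← Complex.exp_add]
  congr 1
  push_cast
  ring

theorem _root_.expChar_zero (t : ℝ) : expChar 0 t = 1 := by simp [expChar]

theorem _root_.conj_expChar (s t : ℝ) : conj (expChar s t) = expChar (-s) t := by
  rw [expChar, expChar, ← Complex.exp_conj]
  congr 1
  simp

theorem memLp_expChar (s : ℝ) (x : H) : MemLp (expChar s) 2 (C.meas x) :=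
  C.memLp_of_bound (measurable_expChar s) (fun t => (norm_expChar s t).le) x 2

/-- The unitary group `e^{-isA}`. -/
noncomputable def group (s : ℝ) : H →L[ℂ] H := C.bdd (expChar s)

theorem group_apply (s : ℝ) (x : H) : C.group s x = C.fn (expChar s) x :=
  C.bdd_apply (measurable_expChar s) (fun t => (norm_expChar s t).le) x

theorem norm_group_apply_le (s : ℝ) (x : H) : ‖C.group s x‖ ≤ ‖x‖ := by
  rw [group_apply]
  simpa using C.norm_fn_le (measurable_expChar s) (fun t => (norm_expChar s t).le) x

theorem norm_group_le (s : ℝ) : ‖C.group s‖ ≤ 1 :=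
  ContinuousLinearMap.opNorm_le_bound _ zero_le_one fun x => by
    simpa using C.norm_group_apply_le s x

@[simp] theorem group_zero : C.group 0 = 1 := by
  ext x
  rw [group_apply]
  have : expChar 0 = fun _ => 1 := funext expChar_zero
  rw [this, C.fn_const]
  simp

theorem group_add_apply (s r : ℝ) (x : H) : C.group (s + r) x = C.group s (C.group r x) := by
  rw [group_apply, group_apply, group_apply, C.fn_fn (C.memLp_expChar r x) (measurable_expChar s)]
  · simp_rw [← expChar_add]
  · simp_rw [← expChar_add]
    exact C.memLp_expChar _ x

theorem inner_group_left (s : ℝ) (x y : H) : ⟪C.group (-s) y, x⟫_ℂ = ⟪y, C.group s x⟫_ℂ := by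
  rw [group_apply, group_apply, ← C.inner_fn_left (C.memLp_expChar s x) (C.memLp_expChar s y)]
  simp_rw [conj_expChar]

theorem inner_group (s : ℝ) (x : H) : ⟪x, C.group s x⟫_ℂ = ∫ t, expChar s t ∂(C.meas x) := by
  rw [group_apply, C.inner_fn (C.memLp_expChar s x)]

theorem continuous_group_apply (x : H) : Continuous fun s => C.group s x := by
  rw [continuous_iff_continuousAt]
  intro s
  simp_rw [ContinuousAt, group_apply]
  refine C.tendsto_fn (b := fun _ => 1) measurable_expChar
    (measurable_expChar s) (C.memLp_expChar s x) (memLp_const _)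
    (by simp) fun t => ?_
  have : Continuous fun s : ℝ => expChar s t := by
    unfold expChar
    fun_prop
  exact this.tendsto s

variable {C} {A : H →ₗ.[ℂ] H}

theorem Represents.memLp (hC : C.Represents A) (x : A.domain) :
    MemLp (fun t : ℝ => (t : ℂ)) 2 (C.meas (x : H)) := (hC.1 x).mp x.2

theorem Represents.group_mem (hC : C.Represents A) (s : ℝ) (x : A.domain) :
    C.group s x ∈ A.domain := by
  rw [hC.1, group_apply]
  refine C.memLp_fn (C.memLp_expChar s x) (by fun_prop) ?_
  refine (hC.memLp x).mono ?_ (Eventually.of_forall fun t => by simp)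
  have := measurable_expChar s
  exact Measurable.aestronglyMeasurable (by fun_prop)

theorem Represents.hasDerivAt_group (hC : C.Represents A) (x : A.domain) (s : ℝ) :
    HasDerivAt (fun s => C.group s x) (-Complex.I • C.group s (A x)) s := by
  have h0 : HasDerivAt (fun s => C.group s x) (-Complex.I • A x) 0 := by
    rw [hasDerivAt_iff_tendsto_slope]
    have h1 : ∀ h : ℝ, slope (fun s => C.group s x) 0 h
        = C.fn (fun t => ((h : ℂ))⁻¹ * (expChar h t - 1)) x := by
      intro h
      have h6 : MemLp (fun t => expChar h t - 1) 2 (C.meas (x : H)) :=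
        (C.memLp_expChar h x).sub (memLp_const _)
      rw [slope_def_module, sub_zero, C.fn_smul h6,
        C.fn_sub (C.memLp_expChar h x) (memLp_const _), C.fn_const, one_smul, group_zero,
        group_apply, one_apply_eq_self, ← Complex.ofReal_inv, Complex.coe_smul]
    rw [funext h1, hC.2, ← C.fn_smul (hC.memLp x)]
    refine C.tendsto_fn (b := fun t => (t : ℂ)) (fun h => ?_) (by fun_prop)
      ((hC.memLp x).const_mul _)
      (hC.memLp x) (fun h t => ?_) (fun t => ?_)
    · have := measurable_expChar h
      fun_prop
    · rw [norm_mul, norm_inv, Complex.norm_real, Complex.norm_real, Real.norm_eq_abs,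
        Real.norm_eq_abs]
      rcases eq_or_ne h 0 with rfl | hh
      · simp
      · rw [inv_mul_le_iff₀ (by positivity)]
        exact norm_expChar_sub_one_le h t
    · have h2 : HasDerivAt (fun h : ℝ => expChar h t) (-Complex.I * t) 0 := by
        have h3 : HasDerivAt (fun h : ℝ => -(Complex.I * h * t)) (-(Complex.I * 1 * t)) 0 :=
          (((Complex.ofRealCLM.hasDerivAt (x := 0)).const_mul Complex.I).mul_const (t : ℂ)).neg
        have h4 := h3.cexp
        simpa [expChar] using h4
      rw [hasDerivAt_iff_tendsto_slope] at h2
      refine h2.congr fun h => ?_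
      rw [slope_def_module, expChar_zero, sub_zero, ← Complex.coe_smul, smul_eq_mul,
        Complex.ofReal_inv]
  have h1 : (fun r => C.group r x) = fun r => C.group s (C.group (r - s) x) := by
    funext r
    rw [← group_add_apply]
    congr 2
    ring
  have h2 : HasDerivAt (fun r => C.group (r - s) x) (-Complex.I • A x) s := by
    have := HasDerivAt.comp_sub_const (f := fun s => C.group s (x : H)) s s (by rwa [sub_self])
    exact this
  rw [h1, ← map_smul]
  exact ((C.group s).restrictScalars ℝ).hasFDerivAt.comp_hasDerivAt s h2

/-- The resolvent `(A - z)⁻¹` at a nonreal point `z`. -/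
noncomputable def resolvent (C : BorelCalculus H) (z : ℂ) : H →L[ℂ] H :=
  C.bdd fun t => ((t : ℂ) - z)⁻¹

theorem _root_.norm_inv_sub_le {z : ℂ} (hz : z.im ≠ 0) (t : ℝ) :
    ‖((t : ℂ) - z)⁻¹‖ ≤ |z.im|⁻¹ := by
  rw [norm_inv]
  refine inv_anti₀ (by positivity) ?_
  have := Complex.abs_im_le_norm ((t : ℂ) - z)
  simpa using this

theorem resolvent_apply (C : BorelCalculus H) {z : ℂ} (hz : z.im ≠ 0) (x : H) :
    C.resolvent z x = C.fn (fun t => ((t : ℂ) - z)⁻¹) x :=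
  C.bdd_apply (by fun_prop) (norm_inv_sub_le hz) x

theorem memLp_inv_sub (C : BorelCalculus H) {z : ℂ} (hz : z.im ≠ 0) (x : H) (p : ℝ≥0∞) :
    MemLp (fun t : ℝ => ((t : ℂ) - z)⁻¹) p (C.meas x) :=
  C.memLp_of_bound (by fun_prop) (norm_inv_sub_le hz) x p

theorem _root_.sub_ne_zero_of_im {z : ℂ} (hz : z.im ≠ 0) (t : ℝ) : (t : ℂ) - z ≠ 0 := by
  intro h
  apply hz
  have := congrArg Complex.im h
  simpa using this

theorem Represents.apply_resolvent (hC : C.Represents A) {z : ℂ} (hz : z.im ≠ 0) (y : H) :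
    ∃ h : C.resolvent z y ∈ A.domain,
      A ⟨C.resolvent z y, h⟩ - z • C.resolvent z y = y := by
  have h0 := C.memLp_inv_sub hz y 2
  have e : (fun t : ℝ => (t : ℂ) * ((t : ℂ) - z)⁻¹) = fun t : ℝ => 1 + z * ((t : ℂ) - z)⁻¹ := by
    ext t
    have := sub_ne_zero_of_im hz t
    field_simp
    ring
  have h1 : MemLp (fun t : ℝ => (t : ℂ) * ((t : ℂ) - z)⁻¹) 2 (C.meas y) := by
    have h2 : MemLp (fun _ : ℝ => (1 : ℂ)) 2 (C.meas y) := memLp_const _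
    have h3 : MemLp (fun t : ℝ => z * ((t : ℂ) - z)⁻¹) 2 (C.meas y) := h0.const_mul z
    rw [e]
    exact h2.add h3
  have h2 : C.resolvent z y ∈ A.domain := by
    rw [hC.1, resolvent_apply C hz]
    exact C.memLp_fn (g := fun t => (t : ℂ)) h0 (by fun_prop) h1
  refine ⟨h2, ?_⟩
  rw [hC.2]
  change C.fn _ (C.resolvent z y) - _ = y
  rw [resolvent_apply C hz, C.fn_fn (g := fun t => (t : ℂ)) h0 (by fun_prop) h1, e,
    C.fn_add (f := fun _ => 1) (g := fun t => z * ((t : ℂ) - z)⁻¹) (memLp_const _)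
      (h0.const_mul z), C.fn_const, C.fn_smul h0, one_smul, add_sub_cancel_right]

theorem Represents.resolvent_sub_apply (hC : C.Represents A) {z : ℂ} (hz : z.im ≠ 0)
    (x : A.domain) : C.resolvent z (A x - z • (x : H)) = x := by
  have h1 : A x - z • (x : H) = C.fn (fun t => (t : ℂ) - z) x := by
    rw [C.fn_sub (hC.memLp x) (memLp_const _), C.fn_const, hC.2]
  have e : (fun t : ℝ => ((t : ℂ) - z)⁻¹ * ((t : ℂ) - z)) = fun _ => 1 := by
    ext t
    exact inv_mul_cancel₀ (sub_ne_zero_of_im hz t)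
  have h2 : MemLp (fun t : ℝ => (t : ℂ) - z) 2 (C.meas (x : H)) :=
    (hC.memLp x).sub (memLp_const _)
  have h3 : MemLp (fun t : ℝ => ((t : ℂ) - z)⁻¹ * ((t : ℂ) - z)) 2 (C.meas (x : H)) := by
    rw [e]
    exact memLp_const _
  rw [h1, resolvent_apply C hz, C.fn_fn (g := fun t => ((t : ℂ) - z)⁻¹) h2 (by fun_prop) h3, e,
    C.fn_const, one_smul]

theorem inner_resolvent (C : BorelCalculus H) {z : ℂ} (hz : z.im ≠ 0) (x : H) :
    ⟪x, C.resolvent z x⟫_ℂ = ∫ t, ((t : ℂ) - z)⁻¹ ∂(C.meas x) := by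
  rw [resolvent_apply C hz, C.inner_fn (C.memLp_inv_sub hz x 2)]

end BorelCalculus

end Consequences

/-! ### Spectral measures and spectral integrals -/

section SpectralIntegrals

variable {H : Type*} [NormedAddCommGroup H] [InnerProductSpace ℂ H] [CompleteSpace H]

namespace BorelCalculus

variable (C : BorelCalculus H)

/-- The indicator function of a set, with complex values. -/
noncomputable def _root_.chi (S : Set ℝ) : ℝ → ℂ := S.indicator fun _ => 1

theorem _root_.measurable_chi {S : Set ℝ} (hS : MeasurableSet S) : Measurable (chi S) :=
  measurable_const.indicator hS

theorem _root_.norm_chi_le (S : Set ℝ) (t : ℝ) : ‖chi S t‖ ≤ 1 := by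
  unfold chi
  by_cases h : t ∈ S <;> simp [h]

theorem memLp_chi {S : Set ℝ} (hS : MeasurableSet S) (x : H) (p : ℝ≥0∞) :
    MemLp (chi S) p (C.meas x) :=
  C.memLp_of_bound (measurable_chi hS) (norm_chi_le S) x p

theorem bdd_chi_apply {S : Set ℝ} (hS : MeasurableSet S) (x : H) :
    C.bdd (chi S) x = C.fn (chi S) x := C.bdd_apply (measurable_chi hS) (norm_chi_le S) x

/-- The projection-valued measure of a Borel functional calculus: the projection of a Borel set
is its indicator function applied to the operator. -/
noncomputable def spectralMeasure : SpectralMeasure H where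
  proj S := C.bdd (chi S)
  isStarProjection := by
    intro S hS
    have e : (fun t => chi S t * chi S t) = chi S := by
      ext t
      by_cases h : t ∈ S <;> simp [chi, h]
    refine ⟨?_, ?_⟩
    · ext x
      have h := C.fn_fn (g := chi S) (C.memLp_chi hS x 2) (measurable_chi hS)
        (by rw [e]; exact C.memLp_chi hS x 2)
      rw [e] at h
      rw [mul_apply_eq_comp, C.bdd_chi_apply hS, C.bdd_chi_apply hS, h]
    · rw [ContinuousLinearMap.isSelfAdjoint_iff']
      symm
      rw [ContinuousLinearMap.eq_adjoint_iff]
      intro x y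
      have h := C.inner_fn_left (C.memLp_chi hS y 2) (C.memLp_chi hS x 2)
      have e2 : (fun t => conj (chi S t)) = chi S := by
        ext t
        by_cases h : t ∈ S <;> simp [chi, h]
      rw [e2] at h
      rw [C.bdd_chi_apply hS, C.bdd_chi_apply hS, h]
  proj_empty := by
    ext x
    have e : chi ∅ = fun _ => 0 := by
      ext t
      simp [chi]
    rw [C.bdd_chi_apply MeasurableSet.empty, e, C.fn_const]
    simp
  proj_univ := by
    ext x
    have e : chi Set.univ = fun _ => 1 := by
      ext t
      simp [chi]
    rw [C.bdd_chi_apply MeasurableSet.univ, e, C.fn_const]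
    simp
  hasSum_iUnion := by
    intro S hS hd x
    have hU := MeasurableSet.iUnion hS
    simp only [HasSum, SummationFilter.unconditional_filter]
    have e : ∀ s : Finset ℕ, ∑ n ∈ s, C.bdd (chi (S n)) x = C.fn (chi (⋃ n ∈ s, S n)) x := by
      intro s
      simp_rw [C.bdd_chi_apply (hS _)]
      rw [← C.fn_finset_sum s fun i _ => C.memLp_chi (hS i) x 2]
      congr 1
      unfold chi
      rw [Finset.indicator_biUnion]
      intro i _ j _ hij
      exact hd hij
    simp_rw [e]
    rw [C.bdd_chi_apply hU]
    refine C.tendsto_fn (b := fun _ => 1)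
      (fun s => measurable_chi (Finset.measurableSet_biUnion s fun i _ => hS i))
      (measurable_chi hU) (C.memLp_chi hU x 2) (memLp_const _)
      (fun s t => by simpa using norm_chi_le _ t) fun t => ?_
    exact (tendsto_indicator_biUnion_finset S (fun _ => (1 : ℂ)) t).mono_right (pure_le_nhds _)

theorem scalarMeasure_spectralMeasure (x : H) :
    C.spectralMeasure.scalarMeasure x = C.meas x := by
  ext S hS
  rw [SpectralMeasure.scalarMeasure, Measure.ofMeasurable_apply S hS]
  change ENNReal.ofReal (⟪x, C.bdd (chi S) x⟫_ℂ).re = _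
  rw [C.bdd_chi_apply hS, C.inner_fn (C.memLp_chi hS x 2), chi, integral_indicator hS]
  simp

theorem memLp_add {x y : H} {f : ℝ → ℂ} (hx : MemLp f 2 (C.meas x))
    (hy : MemLp f 2 (C.meas y)) : MemLp f 2 (C.meas (x + y)) := by
  refine MemLp.mono_measure (C.meas_add_le x y) ?_
  have h1 := hx.smul_measure (c := 2) (by simp)
  have h2 := hy.smul_measure (c := 2) (by simp)
  refine ⟨h1.1.add_measure h2.1, ?_⟩
  have h : eLpNorm f 2 ((2 : ℝ≥0∞) • C.meas x + (2 : ℝ≥0∞) • C.meas y) ^ 2 < ∞ := by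
    rw [eLpNorm_two_sq, lintegral_add_measure, ← eLpNorm_two_sq, ← eLpNorm_two_sq]
    exact ENNReal.add_lt_top.mpr ⟨ENNReal.pow_lt_top h1.2, ENNReal.pow_lt_top h2.2⟩
  exact (ENNReal.pow_lt_top_iff.mp h).resolve_right two_ne_zero

/-- The operator `f(A)` with its natural domain. -/
noncomputable def pmap (f : ℝ → ℂ) : H →ₗ.[ℂ] H where
  domain :=
    { carrier := {x | MemLp f 2 (C.meas x) ∨ x = 0}
      zero_mem' := Or.inr rfl
      add_mem' := by
        rintro x y (hx | rfl) (hy | rfl)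
        · exact Or.inl (C.memLp_add hx hy)
        · rw [add_zero]
          exact Or.inl hx
        · rw [zero_add]
          exact Or.inl hy
        · exact Or.inr (add_zero 0)
      smul_mem' := by
        rintro c x (hx | rfl)
        · left
          rw [C.meas_smul]
          exact hx.smul_measure (by simp)
        · exact Or.inr (smul_zero c) }
  toFun :=
    have h0 : ∀ x : H, MemLp f 2 (C.meas x) ∨ x = 0 → MemLp f 2 (C.meas x) := by
      rintro x (hx | rfl)
      · exact hx
      · have : C.meas 0 = 0 := by
          rw [← Measure.measure_univ_eq_zero, C.meas_univ]
          simp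
        rw [this]
        exact ⟨aestronglyMeasurable_zero_measure f, by simp⟩
    { toFun := fun x => C.fn f x
      map_add' := fun x y => C.fn_vec_add (h0 x x.2) (h0 y y.2)
      map_smul' := fun c x => C.fn_vec_smul c (h0 x x.2) }

theorem mem_pmap_domain (f : ℝ → ℂ) (x : H) :
    x ∈ (C.pmap f).domain ↔ MemLp f 2 (C.meas x) := by
  constructor
  · rintro (hx | rfl)
    · exact hx
    · have : C.meas 0 = 0 := by
        rw [← Measure.measure_univ_eq_zero, C.meas_univ]
        simp
      rw [this]
      exact ⟨aestronglyMeasurable_zero_measure f, by simp⟩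
  · exact Or.inl

theorem memLp_iff_lintegral {f : ℝ → ℂ} (hf : Measurable f) (x : H) :
    MemLp f 2 (C.meas x) ↔ ∫⁻ t, ‖f t‖ₑ ^ 2 ∂(C.meas x) < ∞ := by
  rw [← eLpNorm_two_sq, ENNReal.pow_lt_top_iff]
  simp [MemLp, hf.aestronglyMeasurable]

theorem isSpectralIntegral {f : ℝ → ℂ} (hf : Measurable f) {T : H →ₗ.[ℂ] H}
    (hdom : ∀ x, x ∈ T.domain ↔ MemLp f 2 (C.meas x)) (hT : ∀ x : T.domain, T x = C.fn f x) :
    IsSpectralIntegral C.spectralMeasure f T := by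
  refine ⟨hf, ?_, fun x => ?_⟩
  · ext x
    rw [Set.mem_ofPred_eq, scalarMeasure_spectralMeasure, ← C.memLp_iff_lintegral hf, ← hdom]
    rfl
  · rw [scalarMeasure_spectralMeasure, hT, C.inner_fn ((hdom x).mp x.2)]

variable {C} {A : H →ₗ.[ℂ] H}

theorem Represents.isFunctionOf (hC : C.Represents A) {f : ℝ → ℂ} (hf : Measurable f) :
    IsFunctionOf A f (C.pmap f) :=
  ⟨C.spectralMeasure, C.isSpectralIntegral (by fun_prop) hC.1 hC.2,
    C.isSpectralIntegral hf (C.mem_pmap_domain f) fun _ => rfl⟩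

/-- The spectral measures vanish near every real point of the resolvent set. A vector in the
range of the spectral projection of `(t - δ, t + δ)` satisfies `‖(A - t) y‖ ≤ δ ‖y‖`, which
contradicts boundedness of the inverse of `A - t` for small `δ`. -/
theorem Represents.meas_Ioo_eq_zero (hC : C.Represents A) {t : ℝ}
    (ht : (t : ℂ) ∈ unboundedResolventSet A) :
    ∃ δ > 0, ∀ x : H, C.meas x (Set.Ioo (t - δ) (t + δ)) = 0 := by
  obtain ⟨R, -, hR⟩ := ht
  set δ : ℝ := (‖R‖ + 1)⁻¹ with hδ
  have hδ0 : 0 < δ := by positivity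
  refine ⟨δ, hδ0, fun x => ?_⟩
  set S := Set.Ioo (t - δ) (t + δ) with hS
  have hSm : MeasurableSet S := measurableSet_Ioo
  have hch := C.memLp_chi hSm x 2
  have hbound : ∀ s : ℝ, ‖((s : ℂ) - t) * chi S s‖ ≤ δ := by
    intro s
    by_cases h : s ∈ S
    · simp only [chi, h, Set.indicator_of_mem, mul_one]
      rw [← Complex.ofReal_sub, Complex.norm_real, Real.norm_eq_abs, abs_le]
      constructor <;> linarith [h.1, h.2]
    · simp [chi, h, hδ0.le]
  have hbound' : ∀ s : ℝ, ‖(s : ℂ) * chi S s‖ ≤ δ + |t| := by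
    intro s
    by_cases h : s ∈ S
    · simp only [chi, h, Set.indicator_of_mem, mul_one]
      rw [Complex.norm_real, Real.norm_eq_abs, abs_le]
      constructor <;> linarith [h.1, h.2, neg_abs_le t, le_abs_self t]
    · simp [chi, h]
      positivity
  have hcm := measurable_chi hSm
  have h1 : MemLp (fun s : ℝ => (s : ℂ) * chi S s) 2 (C.meas x) :=
    C.memLp_of_bound (by fun_prop) hbound' x 2
  have h2 : MemLp (fun s : ℝ => ((s : ℂ) - t) * chi S s) 2 (C.meas x) :=
    C.memLp_of_bound (by fun_prop) hbound x 2
  set y := C.fn (chi S) x with hy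
  have hyd : y ∈ A.domain := by
    rw [hC.1]
    exact C.memLp_fn (g := fun t => (t : ℂ)) hch (by fun_prop) h1
  have h3 : A ⟨y, hyd⟩ - (t : ℂ) • y = C.fn (fun s => ((s : ℂ) - t) * chi S s) x := by
    rw [hC.2]
    change C.fn _ y - _ = _
    rw [hy, C.fn_fn (g := fun t => (t : ℂ)) hch (by fun_prop) h1, ← C.fn_smul hch,
      ← C.fn_sub h1 (hch.const_mul _)]
    congr 1
    ext s
    ring
  have h4 : ‖A ⟨y, hyd⟩ - (t : ℂ) • y‖ ≤ δ * ‖y‖ := by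
    have h5 : C.fn (fun s => ((s : ℂ) - t) * chi S s) x
        = C.fn (fun s => ((s : ℂ) - t) * chi S s) y := by
      have e : (fun s : ℝ => (((s : ℂ) - t) * chi S s) * chi S s)
          = fun s : ℝ => ((s : ℂ) - t) * chi S s := by
        ext s
        by_cases h : s ∈ S <;> simp [chi, h]
      rw [hy, C.fn_fn (g := fun s => ((s : ℂ) - t) * chi S s) hch (by fun_prop)
        (by rw [e]; exact h2), e]
    rw [h3, h5]
    exact C.norm_fn_le (by fun_prop) hbound y
  have h6 : ‖y‖ ≤ ‖R‖ * (δ * ‖y‖) := by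
    have h7 := hR ⟨y, hyd⟩
    calc ‖y‖ = ‖R (A ⟨y, hyd⟩ - (t : ℂ) • y)‖ := by rw [h7]
      _ ≤ ‖R‖ * ‖A ⟨y, hyd⟩ - (t : ℂ) • y‖ := R.le_opNorm _
      _ ≤ ‖R‖ * (δ * ‖y‖) := by gcongr
  have h8 : ‖R‖ * δ < 1 := by
    rw [hδ, ← div_eq_mul_inv, div_lt_one (by positivity)]
    linarith
  have h9 : ‖y‖ = 0 := by
    by_contra h
    have : 0 < ‖y‖ := lt_of_le_of_ne (norm_nonneg _) (Ne.symm h)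
    nlinarith
  have h10 := C.enorm_fn_sq hch
  rw [← hy, norm_eq_zero.mp h9] at h10
  have e : ∀ s, ‖chi S s‖ₑ ^ 2 = S.indicator (fun _ => (1 : ℝ≥0∞)) s := by
    intro s
    by_cases h : s ∈ S <;> simp [chi, h]
  simp_rw [e] at h10
  rw [lintegral_indicator hSm] at h10
  simpa using h10.symm

/-- A set of real points of the resolvent set is null for all spectral measures, since it is
locally null. -/
theorem Represents.meas_eq_zero_of_subset (hC : C.Represents A) {S : Set ℝ}
    (hS : ∀ t ∈ S, (t : ℂ) ∈ unboundedResolventSet A) (x : H) : C.meas x S = 0 := by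
  refine measure_null_of_locally_null S fun t ht => ?_
  obtain ⟨δ, hδ, h⟩ := hC.meas_Ioo_eq_zero (hS t ht)
  exact ⟨Set.Ioo (t - δ) (t + δ),
    mem_nhdsWithin_of_mem_nhds (Ioo_mem_nhds (by linarith) (by linarith)), h x⟩

end BorelCalculus

end SpectralIntegrals

/-! ### Bounds for the trace norm by Bessel families -/

section TraceIdeal

variable {H : Type*} [NormedAddCommGroup H] [InnerProductSpace ℂ H] [CompleteSpace H]

/-- A family of vectors that satisfies Bessel's inequality. -/
def IsBessel {ι : Type*} (a : ι → H) : Prop :=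
  ∀ (s : Finset ι) (x : H), ∑ i ∈ s, ‖⟪a i, x⟫_ℂ‖ ^ 2 ≤ ‖x‖ ^ 2

/-- The trace norm of `D` is at most `C`, in a form that is stable under weak integrals and under
composition with contractions: `∑ |⟪aᵢ, D bᵢ⟫| ≤ C` for all Bessel families `a` and `b`. -/
def TraceBound (D : H →L[ℂ] H) (C : ℝ) : Prop :=
  ∀ (s : Finset (onbIndex H)) (a b : onbIndex H → H), IsBessel a → IsBessel b →
    ∑ i ∈ s, ‖⟪a i, D (b i)⟫_ℂ‖ ≤ C

theorem isBessel_onb : IsBessel (onb H) := fun _ x =>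
  (onb H).orthonormal.sum_inner_products_le x

theorem IsBessel.map {ι : Type*} {a : ι → H} (ha : IsBessel a) {W : H →L[ℂ] H} (hW : ‖W‖ ≤ 1) :
    IsBessel fun i => W (a i) := by
  intro s x
  have h1 := ha s (ContinuousLinearMap.adjoint W x)
  simp_rw [ContinuousLinearMap.adjoint_inner_right] at h1
  refine h1.trans ?_
  have h2 : ‖ContinuousLinearMap.adjoint W x‖ ≤ ‖x‖ := by
    refine (ContinuousLinearMap.le_opNorm _ _).trans ?_
    rw [LinearIsometryEquiv.norm_map]
    exact mul_le_of_le_one_left (norm_nonneg _) hW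
  gcongr

theorem IsBessel.sum_mul_le {ι : Type*} {a b : ι → H} (ha : IsBessel a) (hb : IsBessel b)
    (s : Finset ι) (x y : H) : ∑ i ∈ s, ‖⟪a i, x⟫_ℂ‖ * ‖⟪y, b i⟫_ℂ‖ ≤ ‖x‖ * ‖y‖ := by
  have h1 := Finset.sum_mul_sq_le_sq_mul_sq s (fun i => ‖⟪a i, x⟫_ℂ‖) (fun i => ‖⟪y, b i⟫_ℂ‖)
  have h2 := ha s x
  have h3 := hb s y
  have e : ∀ i, ‖⟪b i, y⟫_ℂ‖ = ‖⟪y, b i⟫_ℂ‖ := fun i => norm_inner_symm _ _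
  simp_rw [e] at h3
  refine le_of_sq_le_sq (h1.trans ?_) (by positivity)
  rw [mul_pow]
  gcongr

/-- The expansion `P = ∑ₖ ⟪ψₖ, ·⟫ ψₖ` into rank one operators, in the weak sense. -/
def IsRankOneSum {κ : Type*} (P : H →L[ℂ] H) (ψ : κ → H) : Prop :=
  ∀ x y : H, HasSum (fun k => ⟪y, ψ k⟫_ℂ * ⟪ψ k, x⟫_ℂ) ⟪y, P x⟫_ℂ

theorem IsRankOneSum.traceBound {κ : Type*} {P : H →L[ℂ] H} {ψ : κ → H} (h : IsRankOneSum P ψ)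
    {C : ℝ} (hC : HasSum (fun k => ‖ψ k‖ ^ 2) C) : TraceBound P C := by
  intro s a b ha hb
  have hs : ∀ i ∈ s, Summable fun k => ‖⟪a i, ψ k⟫_ℂ‖ * ‖⟪ψ k, b i⟫_ℂ‖ := by
    intro i _
    refine Summable.of_nonneg_of_le (fun k => by positivity) (fun k => ?_)
      (hC.summable.mul_left (‖a i‖ * ‖b i‖))
    calc ‖⟪a i, ψ k⟫_ℂ‖ * ‖⟪ψ k, b i⟫_ℂ‖ ≤ (‖a i‖ * ‖ψ k‖) * (‖ψ k‖ * ‖b i‖) := by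
          gcongr <;> exact norm_inner_le_norm _ _
      _ = _ := by ring
  calc ∑ i ∈ s, ‖⟪a i, P (b i)⟫_ℂ‖
      ≤ ∑ i ∈ s, ∑' k, ‖⟪a i, ψ k⟫_ℂ‖ * ‖⟪ψ k, b i⟫_ℂ‖ := by
        refine Finset.sum_le_sum fun i hi => ?_
        rw [← (h (b i) (a i)).tsum_eq]
        have h1 := hs i hi
        simp_rw [← norm_mul] at h1 ⊢
        exact norm_tsum_le_tsum_norm h1
    _ = ∑' k, ∑ i ∈ s, ‖⟪a i, ψ k⟫_ℂ‖ * ‖⟪ψ k, b i⟫_ℂ‖ := (Summable.tsum_finsetSum hs).symm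
    _ ≤ ∑' k, ‖ψ k‖ ^ 2 := by
        refine Summable.tsum_le_tsum (fun k => ?_) (summable_sum hs) hC.summable
        rw [sq]
        exact ha.sum_mul_le hb s _ _
    _ = C := hC.tsum_eq

/-- The operator `⟪ψ, ·⟫ ψ`. -/
noncomputable def rankOneOp (ψ : H) : H →L[ℂ] H := (innerSL ℂ ψ).smulRight ψ

@[simp] theorem rankOneOp_apply (ψ x : H) : rankOneOp ψ x = ⟪ψ, x⟫_ℂ • ψ := rfl

theorem isRankOneSum_rankOneOp (ψ : H) : IsRankOneSum (rankOneOp ψ) fun _ : Unit => ψ := by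
  intro x y
  simp [mul_comm]

theorem traceBound_rankOneOp (ψ : H) : TraceBound (rankOneOp ψ) (‖ψ‖ ^ 2) :=
  (isRankOneSum_rankOneOp ψ).traceBound (by simp)

theorem isSelfAdjoint_rankOneOp (ψ : H) : IsSelfAdjoint (rankOneOp ψ) := by
  rw [ContinuousLinearMap.isSelfAdjoint_iff']
  symm
  rw [ContinuousLinearMap.eq_adjoint_iff]
  intro x y
  simp [inner_smul_left, inner_smul_right, mul_comm]

theorem TraceBound.summable {D : H →L[ℂ] H} {C : ℝ} (h : TraceBound D C) :
    Summable fun i => ‖⟪onb H i, D (onb H i)⟫_ℂ‖ :=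
  summable_of_sum_le (fun _ => norm_nonneg _) fun s => h s _ _ isBessel_onb isBessel_onb

theorem TraceBound.norm_opTrace_le {D : H →L[ℂ] H} {C : ℝ} (h : TraceBound D C) :
    ‖opTrace D‖ ≤ C := by
  refine (norm_tsum_le_tsum_norm h.summable).trans ?_
  exact h.summable.tsum_le_of_sum_le fun s => h s _ _ isBessel_onb isBessel_onb

theorem TraceBound.opTrace_add {D E : H →L[ℂ] H} {C C' : ℝ} (h : TraceBound D C)
    (h' : TraceBound E C') : opTrace (D + E) = opTrace D + opTrace E := by
  unfold opTrace
  rw [← h.summable.of_norm.tsum_add h'.summable.of_norm]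
  simp

theorem opTrace_smul (c : ℂ) (D : H →L[ℂ] H) : opTrace (c • D) = c * opTrace D := by
  unfold opTrace
  rw [← tsum_mul_left]
  simp

theorem opTrace_rankOneOp (ψ : H) : opTrace (rankOneOp ψ) = (‖ψ‖ ^ 2 : ℝ) := by
  unfold opTrace
  have h := (onb H).tsum_inner_mul_inner ψ ψ
  rw [inner_self_eq_norm_sq_to_K] at h
  simp only [rankOneOp_apply, inner_smul_right]
  rw [h]
  norm_cast

theorem TraceBound.smul {D : H →L[ℂ] H} {C : ℝ} (h : TraceBound D C) (c : ℂ) :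
    TraceBound (c • D) (‖c‖ * C) := by
  intro s a b ha hb
  simp only [smul_apply, inner_smul_right, norm_mul]
  rw [← Finset.mul_sum]
  exact mul_le_mul_of_nonneg_left (h s a b ha hb) (norm_nonneg _)

theorem TraceBound.add {D E : H →L[ℂ] H} {C C' : ℝ} (h : TraceBound D C)
    (h' : TraceBound E C') : TraceBound (D + E) (C + C') := by
  intro s a b ha hb
  refine le_trans ?_ (add_le_add (h s a b ha hb) (h' s a b ha hb))
  rw [← Finset.sum_add_distrib]
  refine Finset.sum_le_sum fun i _ => ?_
  rw [add_apply, inner_add_right]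
  exact norm_add_le _ _

theorem traceBound_zero : TraceBound (0 : H →L[ℂ] H) 0 := by
  intro s a b _ _
  simp

/-- Operators with a bound in terms of Bessel families are trace class. Instead of the polar
decomposition, the contractions `W = T (|T| + ε)⁻¹` are used, for which
`W* T = |T|² (|T| + ε)⁻¹` differs from `|T|` by at most `ε`. -/
theorem TraceBound.traceNorm_le {T : H →L[ℂ] H} {C : ℝ} (h : TraceBound T C) :
    traceNorm T ≤ ENNReal.ofReal C := by
  set a := CFC.abs T with ha_def
  have ha0 : 0 ≤ a := CFC.abs_nonneg T
  have hapos := (ContinuousLinearMap.nonneg_iff_isPositive a).mp ha0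
  have hasa : IsSelfAdjoint a := hapos.isSelfAdjoint
  have haa : a * a = star T * T := CFC.abs_mul_abs T
  have hadj : ContinuousLinearMap.adjoint a = a := hasa
  have hsp : ∀ x ∈ spectrum ℝ a, 0 ≤ x := fun x hx => spectrum_nonneg_of_nonneg ha0 hx
  have hterm : ∀ i, 0 ≤ (⟪onb H i, a (onb H i)⟫_ℂ).re := fun i => by
    have := hapos.re_inner_nonneg_right (onb H i)
    exact this
  have key : ∀ ε : ℝ, 0 < ε → ∃ W : H →L[ℂ] H, ‖W‖ ≤ 1 ∧ ∀ x : H,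
      (⟪x, a x⟫_ℂ).re ≤ ‖⟪W x, T x⟫_ℂ‖ + ε * ‖x‖ ^ 2 := by
    intro ε hε
    have hc : ContinuousOn (fun x : ℝ => (x + ε)⁻¹) (spectrum ℝ a) :=
      ContinuousOn.inv₀ (by fun_prop) fun x hx => (add_pos_of_nonneg_of_pos (hsp x hx) hε).ne'
    set G := cfc (fun x : ℝ => (x + ε)⁻¹) a with hG
    set Q := cfc (fun x : ℝ => x * (x + ε)⁻¹) a with hQ
    have haG : a * G = Q := by
      rw [hQ, cfc_mul (fun x : ℝ => x) _ a (by fun_prop) hc, cfc_id' ℝ a]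
    have hc' : ContinuousOn (fun x : ℝ => x * (x + ε)⁻¹) (spectrum ℝ a) := by fun_prop
    have hsub : a - Q * a = ε • Q := by
      have e1 : Q * a = cfc (fun x : ℝ => (x * (x + ε)⁻¹) * x) a := by
        rw [cfc_mul _ (fun x : ℝ => x) a hc' (by fun_prop), cfc_id' ℝ a]
      have e2 : a - Q * a = cfc (fun x : ℝ => x - (x * (x + ε)⁻¹) * x) a := by
        rw [cfc_sub (fun x : ℝ => x) _ a (by fun_prop) (by fun_prop), cfc_id' ℝ a, e1]
      rw [e2, hQ, ← cfc_smul ε _ a hc']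
      refine cfc_congr fun x hx => ?_
      have : x + ε ≠ 0 := (add_pos_of_nonneg_of_pos (hsp x hx) hε).ne'
      simp only [smul_eq_mul]
      field_simp
      ring
    have hQ1 : ‖Q‖ ≤ 1 := by
      refine norm_cfc_le zero_le_one fun x hx => ?_
      have h0 := hsp x hx
      rw [Real.norm_of_nonneg (by positivity), ← div_eq_mul_inv, div_le_one (by positivity)]
      linarith
    have hQsa : ContinuousLinearMap.adjoint Q = Q := by
      have : IsSelfAdjoint Q := cfc_predicate _ a
      exact this
    have hTT : ∀ x y : H, ⟪T x, T y⟫_ℂ = ⟪a x, a y⟫_ℂ := by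
      intro x y
      rw [← ContinuousLinearMap.adjoint_inner_right, ← ContinuousLinearMap.star_eq_adjoint,
        ← mul_apply_eq_comp, ← haa, mul_apply_eq_comp,
        ← ContinuousLinearMap.adjoint_inner_right, hadj]
    have hWT : ∀ x y : H, ⟪(T * G) x, T y⟫_ℂ = ⟪Q x, a y⟫_ℂ := by
      intro x y
      rw [mul_apply_eq_comp, hTT, ← mul_apply_eq_comp, haG]
    refine ⟨T * G, ?_, fun x => ?_⟩
    · refine ContinuousLinearMap.opNorm_le_bound _ zero_le_one fun x => ?_
      have h1 : ‖(T * G) x‖ ^ 2 = ‖Q x‖ ^ 2 := by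
        have := hTT (G x) (G x)
        rw [← mul_apply_eq_comp, ← mul_apply_eq_comp, haG, inner_self_eq_norm_sq_to_K,
          inner_self_eq_norm_sq_to_K] at this
        exact_mod_cast this
      have h2 : ‖(T * G) x‖ = ‖Q x‖ := by
        rwa [sq_eq_sq₀ (norm_nonneg _) (norm_nonneg _)] at h1
      rw [h2]
      exact Q.le_of_opNorm_le hQ1 x
    · have h1 : a x = Q (a x) + (ε : ℂ) • Q x := by
        have := congrArg (fun D : H →L[ℂ] H => D x) hsub
        simp only [sub_apply, mul_apply_eq_comp, smul_apply] at this
        rw [Complex.coe_smul, ← this]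
        abel
      have h2 : ⟪x, Q (a x)⟫_ℂ = ⟪(T * G) x, T x⟫_ℂ := by
        rw [hWT, ← ContinuousLinearMap.adjoint_inner_left, hQsa]
      rw [h1, inner_add_right, h2, Complex.add_re, inner_smul_right]
      refine add_le_add (Complex.re_le_norm _) ?_
      refine (Complex.re_le_norm _).trans ?_
      rw [norm_mul, Complex.norm_real, Real.norm_of_nonneg hε.le]
      gcongr
      calc ‖⟪x, Q x⟫_ℂ‖ ≤ ‖x‖ * ‖Q x‖ := norm_inner_le_norm _ _
        _ ≤ ‖x‖ * (1 * ‖x‖) := by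
            gcongr
            exact Q.le_of_opNorm_le hQ1 x
        _ = ‖x‖ ^ 2 := by ring
  have hfin : ∀ s : Finset (onbIndex H), ∑ i ∈ s, (⟪onb H i, a (onb H i)⟫_ℂ).re ≤ C := by
    intro s
    refine le_of_forall_pos_le_add fun δ hδ => ?_
    -- The errors of the `s.card` terms add up to less than `δ`.
    obtain ⟨W, hW, hWx⟩ := key (δ / (s.card + 1)) (by positivity)
    calc ∑ i ∈ s, (⟪onb H i, a (onb H i)⟫_ℂ).re
        ≤ ∑ i ∈ s, (‖⟪W (onb H i), T (onb H i)⟫_ℂ‖ + δ / (s.card + 1)) := by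
          refine Finset.sum_le_sum fun i _ => ?_
          have := hWx (onb H i)
          rwa [(onb H).orthonormal.1 i, one_pow, mul_one] at this
      _ = ∑ i ∈ s, ‖⟪W (onb H i), T (onb H i)⟫_ℂ‖ + s.card * (δ / (s.card + 1)) := by
          rw [Finset.sum_add_distrib, Finset.sum_const, nsmul_eq_mul]
      _ ≤ C + δ := by
          refine add_le_add (h s _ _ (isBessel_onb.map hW) isBessel_onb) ?_
          rw [← mul_div_assoc, div_le_iff₀ (by positivity)]
          nlinarith
  unfold traceNorm
  rw [ENNReal.tsum_eq_iSup_sum]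
  refine iSup_le fun s => ?_
  rw [← ENNReal.ofReal_sum_of_nonneg fun i _ => hterm i]
  exact ENNReal.ofReal_le_ofReal (hfin s)

/-- A positive operator `P` of finite trace is the sum of the rank one operators that belong to
the vectors `√P eᵢ`. -/
theorem exists_isRankOneSum_of_nonneg {P : H →L[ℂ] H} (hP : 0 ≤ P) (htr : traceNorm P < ∞) :
    IsRankOneSum P (fun i => CFC.sqrt P (onb H i)) ∧
      HasSum (fun i => ‖CFC.sqrt P (onb H i)‖ ^ 2) (traceNorm P).toReal := by
  set Q := CFC.sqrt P with hQ
  have hQQ : Q * Q = P := CFC.sqrt_mul_sqrt_self P hP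
  have hQadj : ContinuousLinearMap.adjoint Q = Q :=
    ((ContinuousLinearMap.nonneg_iff_isPositive Q).mp (CFC.sqrt_nonneg P)).isSelfAdjoint
  have hin : ∀ x y : H, ⟪y, P x⟫_ℂ = ⟪Q y, Q x⟫_ℂ := by
    intro x y
    rw [← hQQ, mul_apply_eq_comp, ← ContinuousLinearMap.adjoint_inner_left, hQadj]
  refine ⟨fun x y => ?_, ?_⟩
  · have h := (onb H).hasSum_inner_mul_inner (Q y) (Q x)
    rw [← hin] at h
    refine h.congr_fun fun i => ?_
    rw [← ContinuousLinearMap.adjoint_inner_right, hQadj,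
      ← ContinuousLinearMap.adjoint_inner_left, hQadj]
  · have e : ∀ i, (⟪onb H i, CFC.abs P (onb H i)⟫_ℂ).re = ‖Q (onb H i)‖ ^ 2 := by
      intro i
      rw [CFC.abs_of_nonneg P hP, hin, inner_self_eq_norm_sq_to_K]
      norm_cast
    have h1 : traceNorm P = ∑' i, ENNReal.ofReal (‖Q (onb H i)‖ ^ 2) := by
      unfold traceNorm
      simp_rw [e]
    rw [h1] at htr ⊢
    have hs := ENNReal.summable_toReal htr.ne
    have e2 : ∀ i, (ENNReal.ofReal (‖Q (onb H i)‖ ^ 2)).toReal = ‖Q (onb H i)‖ ^ 2 := fun i =>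
      ENNReal.toReal_ofReal (by positivity)
    rw [ENNReal.tsum_toReal_eq fun i => ENNReal.ofReal_ne_top]
    simp_rw [e2] at hs ⊢
    exact hs.hasSum

theorem traceNorm_eq_posPart_add_negPart {V : H →L[ℂ] H} (hV : IsSelfAdjoint V) :
    traceNorm V = traceNorm V⁺ + traceNorm V⁻ := by
  have hp : 0 ≤ V⁺ := CFC.posPart_nonneg V
  have hn : 0 ≤ V⁻ := CFC.negPart_nonneg V
  unfold traceNorm
  rw [← ENNReal.tsum_add, CFC.abs_of_nonneg _ hp, CFC.abs_of_nonneg _ hn,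
    ← CFC.posPart_add_negPart V hV]
  refine tsum_congr fun i => ?_
  have h1 := ((ContinuousLinearMap.nonneg_iff_isPositive _).mp hp).re_inner_nonneg_right (onb H i)
  have h2 := ((ContinuousLinearMap.nonneg_iff_isPositive _).mp hn).re_inner_nonneg_right (onb H i)
  have h1' : 0 ≤ (⟪onb H i, V⁺ (onb H i)⟫_ℂ).re := h1
  have h2' : 0 ≤ (⟪onb H i, V⁻ (onb H i)⟫_ℂ).re := h2
  rw [← ENNReal.ofReal_add h1' h2', add_apply, inner_add_right, Complex.add_re]

variable (H) in
/-- Basis vectors have mutual distance `√2 > 1`, so the balls of radius `1 / 2` around them are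
disjoint. -/
theorem countable_onbIndex [TopologicalSpace.SeparableSpace H] : Countable (onbIndex H) := by
  refine Pairwise.countable_of_isOpen_disjoint (s := fun i => Metric.ball (onb H i) (1 / 2)) ?_
    (fun i => Metric.isOpen_ball) (fun i => ⟨onb H i, Metric.mem_ball_self (by norm_num)⟩)
  intro i j hij
  rw [Function.onFun, Set.disjoint_left]
  intro z hz hz'
  have h1 : dist (onb H i) (onb H j) < 1 := by
    have := dist_triangle_right (onb H i) (onb H j) z
    rw [Metric.mem_ball, dist_comm] at hz hz'
    linarith
  have h2 : ‖onb H i - onb H j‖ ^ 2 = 2 := by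
    rw [norm_sub_sq (𝕜 := ℂ), (onb H).orthonormal.2 hij, (onb H).orthonormal.1 i,
      (onb H).orthonormal.1 j]
    norm_num
  rw [dist_eq_norm] at h1
  nlinarith [norm_nonneg (onb H i - onb H j)]

/-- The rank one expansion of a positive trace class operator, indexed by `ℕ`. -/
theorem exists_nat_isRankOneSum [TopologicalSpace.SeparableSpace H] {P : H →L[ℂ] H} (hP : 0 ≤ P)
    (htr : traceNorm P < ∞) :
    ∃ ψ : ℕ → H, IsRankOneSum P ψ ∧ HasSum (fun k => ‖ψ k‖ ^ 2) (traceNorm P).toReal := by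
  have : Countable (onbIndex H) := countable_onbIndex H
  obtain ⟨e, he⟩ := exists_injective_nat (onbIndex H)
  obtain ⟨h1, h2⟩ := exists_isRankOneSum_of_nonneg hP htr
  refine ⟨Function.extend e (fun i => CFC.sqrt P (onb H i)) 0, fun x y => ?_, ?_⟩
  · have h3 := (hasSum_extend_zero he).mpr (h1 x y)
    refine h3.congr_fun fun k => ?_
    rw [Function.apply_extend (fun v : H => ⟪y, v⟫_ℂ * ⟪v, x⟫_ℂ)]
    congr 1
    ext j
    simp
  · have h3 := (hasSum_extend_zero he).mpr h2
    refine h3.congr_fun fun k => ?_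
    rw [Function.apply_extend (fun v : H => ‖v‖ ^ 2)]
    congr 1
    ext j
    simp

/-- A self-adjoint operator of finite trace norm satisfies the bound by Bessel families. -/
theorem traceBound_traceNorm {V : H →L[ℂ] H} (hV : IsSelfAdjoint V) (htr : traceNorm V < ∞) :
    TraceBound V (traceNorm V).toReal := by
  have h := traceNorm_eq_posPart_add_negPart hV
  have h' := htr
  rw [h, ENNReal.add_lt_top] at h'
  obtain ⟨p1, p2⟩ := exists_isRankOneSum_of_nonneg (CFC.posPart_nonneg V) h'.1
  obtain ⟨n1, n2⟩ := exists_isRankOneSum_of_nonneg (CFC.negPart_nonneg V) h'.2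
  have h3 := (p1.traceBound p2).add ((n1.traceBound n2).smul (-1))
  rw [h, ENNReal.toReal_add h'.1.ne h'.2.ne]
  have e : V⁺ + (-1 : ℂ) • V⁻ = V := by
    rw [neg_one_smul, ← sub_eq_add_neg, CFC.posPart_sub_negPart V hV]
  rw [e] at h3
  simpa using h3

end TraceIdeal

/-! ### Bounded perturbations and Duhamel's formula -/

section Perturbation

variable {H : Type*} [NormedAddCommGroup H] [InnerProductSpace ℂ H] [CompleteSpace H]

/-- The operators `A` and `B` have the same domain and `A = B + V` there. -/
def IsPerturbation (A B : H →ₗ.[ℂ] H) (V : H →L[ℂ] H) : Prop :=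
  A.domain = B.domain ∧ ∀ x (hA : x ∈ A.domain) (hB : x ∈ B.domain),
    A ⟨x, hA⟩ = B ⟨x, hB⟩ + V x

/-- The operator `B + S` on the domain of `B`. -/
def addBounded (B : H →ₗ.[ℂ] H) (S : H →L[ℂ] H) : H →ₗ.[ℂ] H :=
  ⟨B.domain, B.toFun + S.toLinearMap.comp B.domain.subtype⟩

theorem addBounded_apply (B : H →ₗ.[ℂ] H) (S : H →L[ℂ] H) (x : H)
    (h : x ∈ (addBounded B S).domain) : addBounded B S ⟨x, h⟩ = B ⟨x, h⟩ + S x := rfl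

theorem isSelfAdjoint_addBounded {B : H →ₗ.[ℂ] H} (hB : IsSelfAdjoint B) {S : H →L[ℂ] H}
    (hS : IsSelfAdjoint S) : IsSelfAdjoint (addBounded B S) := by
  have hSadj : ContinuousLinearMap.adjoint S = S := hS
  have hSin : ∀ x y : H, ⟪S x, y⟫_ℂ = ⟪x, S y⟫_ℂ := fun x y => by
    rw [← ContinuousLinearMap.adjoint_inner_right, hSadj]
  have hd : Dense ((addBounded B S).domain : Set H) := hB.dense_domain
  have hf : (addBounded B S).IsFormalAdjoint (addBounded B S) := by
    rintro ⟨x, hx⟩ ⟨y, hy⟩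
    rw [addBounded_apply, addBounded_apply, inner_add_left, inner_add_right, hSin]
    rw [LinearPMap.inner_apply_eq hB ⟨x, hx⟩ ⟨y, hy⟩]
  have hle := hf.le_adjoint hd
  rw [LinearPMap.isSelfAdjoint_def]
  symm
  refine LinearPMap.eq_of_le_of_domain_eq hle (le_antisymm hle.1 fun y hy => ?_)
  have h1 := LinearPMap.adjoint_isFormalAdjoint hd ⟨y, hy⟩
  have h2 : ∀ x : B.domain,
      ⟪(addBounded B S).adjoint ⟨y, hy⟩ - S y, (x : H)⟫_ℂ = ⟪y, B x⟫_ℂ := by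
    intro x
    have h3 := h1 x
    change _ = ⟪y, B x + S x⟫_ℂ at h3
    rw [inner_sub_left, hSin]
    change ⟪(addBounded B S).adjoint ⟨y, hy⟩, (x : H)⟫_ℂ = _ at h3
    rw [h3, inner_add_right, add_sub_cancel_right]
  exact (LinearPMap.mem_domain_of_inner hB h2).1

theorem isPerturbation_addBounded (B : H →ₗ.[ℂ] H) (S S' : H →L[ℂ] H) :
    IsPerturbation (addBounded B S') (addBounded B S) (S' - S) := by
  refine ⟨rfl, fun x hA hB => ?_⟩
  rw [addBounded_apply, addBounded_apply, sub_apply]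
  abel

open BorelCalculus

variable {A B : H →ₗ.[ℂ] H} {CA CB : BorelCalculus H} {V : H →L[ℂ] H}

theorem BorelCalculus.Represents.apply_group {C : BorelCalculus H} (hC : C.Represents A) (s : ℝ)
    (x : A.domain) : A ⟨C.group s x, hC.group_mem s x⟩ = C.group s (A x) := by
  have h1 : MemLp (fun t : ℝ => (t : ℂ) * expChar s t) 2 (C.meas (x : H)) := by
    have := measurable_expChar s
    exact (hC.memLp x).mono (Measurable.aestronglyMeasurable (by fun_prop))
      (Eventually.of_forall fun t => by simp)
  have e : (fun t : ℝ => expChar s t * (t : ℂ)) = fun t : ℝ => (t : ℂ) * expChar s t := by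
    ext t
    ring
  rw [hC.2, hC.2]
  change C.fn _ (C.group s x) = _
  rw [group_apply, group_apply, C.fn_fn (g := fun t => (t : ℂ)) (C.memLp_expChar s x)
    (by fun_prop) h1, C.fn_fn (hC.memLp x) (measurable_expChar s) (by rw [e]; exact h1), e]

theorem norm_inner_group_le (CA CB : BorelCalculus H) (V : H →L[ℂ] H) (s r : ℝ) (x y : H) :
    ‖⟪CA.group s y, V (CB.group r x)⟫_ℂ‖ ≤ ‖V‖ * (‖y‖ * ‖x‖) := by
  calc _ ≤ ‖CA.group s y‖ * ‖V (CB.group r x)‖ := norm_inner_le_norm _ _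
    _ ≤ ‖y‖ * (‖V‖ * ‖x‖) := by
        gcongr
        · exact CA.norm_group_apply_le _ _
        · exact (V.le_opNorm _).trans (by gcongr; exact CB.norm_group_apply_le _ _)
    _ = _ := by ring

theorem continuous_inner_group (CA CB : BorelCalculus H) (V : H →L[ℂ] H) (s : ℝ) (x y : H) :
    Continuous fun r : ℝ => ⟪CA.group (r - s) y, V (CB.group r x)⟫_ℂ := by
  have h1 : Continuous fun r : ℝ => CA.group (r - s) y :=
    (CA.continuous_group_apply y).comp (continuous_id.sub continuous_const)
  have h2 := CB.continuous_group_apply x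
  fun_prop

/-- Duhamel's formula on the domain, where `r ↦ ⟪e^{-i(r-s)A} y, e^{-irB} x⟫` is differentiable. -/
theorem duhamel_of_mem (hA : IsSelfAdjoint A) (hCA : CA.Represents A) (hCB : CB.Represents B)
    (h : IsPerturbation A B V) (s : ℝ) {x y : H} (hx : x ∈ B.domain) (hy : y ∈ B.domain) :
    ⟪y, CA.group s x - CB.group s x⟫_ℂ =
      -Complex.I * ∫ r in (0 : ℝ)..s, ⟪CA.group (r - s) y, V (CB.group r x)⟫_ℂ := by
  have hyA : y ∈ A.domain := h.1 ▸ hy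
  have hd : ∀ r : ℝ, HasDerivAt (fun r => ⟪CA.group (r - s) y, CB.group r x⟫_ℂ)
      (Complex.I * ⟪CA.group (r - s) y, V (CB.group r x)⟫_ℂ) r := by
    intro r
    have h1 := hCB.hasDerivAt_group ⟨x, hx⟩ r
    have h2 : HasDerivAt (fun r => CA.group (r - s) y)
        (-Complex.I • CA.group (r - s) (A ⟨y, hyA⟩)) r :=
      HasDerivAt.comp_sub_const (f := fun s => CA.group s y) r s
        (hCA.hasDerivAt_group ⟨y, hyA⟩ (r - s))
    have h3 := h2.inner ℂ h1
    refine h3.congr_deriv ?_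
    have hvB := hCB.group_mem r ⟨x, hx⟩
    have hvA : CB.group r x ∈ A.domain := h.1 ▸ hvB
    have hu := hCA.group_mem (r - s) ⟨y, hyA⟩
    have h4 := h.2 _ hvA hvB
    have h5 := LinearPMap.inner_apply_eq hA ⟨_, hu⟩ ⟨_, hvA⟩
    have h6 : B ⟨CB.group r x, hvB⟩ = CB.group r (B ⟨x, hx⟩) := hCB.apply_group r ⟨x, hx⟩
    rw [hCA.apply_group, h4, h6, inner_add_right] at h5
    simp only at h5 ⊢
    rw [inner_smul_left, inner_smul_right, h5]
    simp only [map_neg, Complex.conj_I]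
    ring
  have h1 := intervalIntegral.integral_eq_sub_of_hasDerivAt (a := 0) (b := s)
    (fun r _ => hd r)
    ((continuous_const.mul (continuous_inner_group CA CB V s x y)).intervalIntegrable _ _)
  rw [intervalIntegral.integral_const_mul] at h1
  simp only [sub_self, zero_sub, group_zero, one_apply_eq_self] at h1
  rw [CA.inner_group_left] at h1
  rw [neg_mul, h1, inner_sub_right]
  ring

/-- Duhamel's formula for the difference of the unitary groups of `A = B + V` and `B`. -/
theorem duhamel (hA : IsSelfAdjoint A) (hB : IsSelfAdjoint B) (hCA : CA.Represents A)
    (hCB : CB.Represents B) (h : IsPerturbation A B V) (s : ℝ) (x y : H) :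
    ⟪y, CA.group s x - CB.group s x⟫_ℂ =
      -Complex.I * ∫ r in (0 : ℝ)..s, ⟪CA.group (r - s) y, V (CB.group r x)⟫_ℂ := by
  have hcont : Continuous fun p : H × H =>
      ∫ r in (0 : ℝ)..s, ⟪CA.group (r - s) p.2, V (CB.group r p.1)⟫_ℂ := by
    rw [continuous_iff_continuousAt]
    intro p
    refine intervalIntegral.continuousAt_of_dominated_interval
      (bound := fun _ => ‖V‖ * ((‖p.2‖ + 1) * (‖p.1‖ + 1))) ?_ ?_ ?_ ?_
    · exact Eventually.of_forall fun q =>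
        (continuous_inner_group CA CB V s q.1 q.2).aestronglyMeasurable
    · have h1 : ∀ᶠ q : H × H in 𝓝 p, ‖q.1‖ < ‖p.1‖ + 1 :=
        (continuous_fst.norm.tendsto p).eventually (gt_mem_nhds (by linarith))
      have h2 : ∀ᶠ q : H × H in 𝓝 p, ‖q.2‖ < ‖p.2‖ + 1 :=
        (continuous_snd.norm.tendsto p).eventually (gt_mem_nhds (by linarith))
      filter_upwards [h1, h2] with q hq1 hq2
      refine Eventually.of_forall fun r _ => (norm_inner_group_le CA CB V _ _ _ _).trans ?_
      gcongr
    · exact intervalIntegrable_const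
    · refine Eventually.of_forall fun r _ => ?_
      exact Continuous.continuousAt (by fun_prop)
  have hd : Dense ((B.domain : Set H) ×ˢ (B.domain : Set H)) :=
    hB.dense_domain.prod hB.dense_domain
  have hl : Continuous fun p : H × H => ⟪p.2, CA.group s p.1 - CB.group s p.1⟫_ℂ := by fun_prop
  have hr := hcont.const_mul (-Complex.I)
  have := hl.ext_on hd hr fun p hp => duhamel_of_mem hA hCA hCB h s hp.1 hp.2
  exact congrFun this (x, y)

theorem norm_group_sub_le (hA : IsSelfAdjoint A) (hB : IsSelfAdjoint B) (hCA : CA.Represents A)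
    (hCB : CB.Represents B) (h : IsPerturbation A B V) (s : ℝ) :
    ‖CA.group s - CB.group s‖ ≤ |s| * ‖V‖ := by
  have h0 : ∀ x y : H, ‖⟪y, CA.group s x - CB.group s x⟫_ℂ‖ ≤ |s| * ‖V‖ * (‖y‖ * ‖x‖) := by
    intro x y
    rw [duhamel hA hB hCA hCB h]
    have := intervalIntegral.norm_integral_le_of_norm_le_const (a := 0) (b := s)
      (f := fun r => ⟪CA.group (r - s) y, V (CB.group r x)⟫_ℂ) (C := ‖V‖ * (‖y‖ * ‖x‖))
      fun r _ => norm_inner_group_le CA CB V _ _ _ _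
    rw [sub_zero] at this
    rw [norm_mul, norm_neg, Complex.norm_I, one_mul]
    calc _ ≤ _ := this
      _ = _ := by ring
  refine ContinuousLinearMap.opNorm_le_bound _ (by positivity) fun x => ?_
  rw [sub_apply]
  set z := CA.group s x - CB.group s x
  have h1 := h0 x z
  rw [inner_self_eq_norm_sq_to_K] at h1
  simp only [norm_pow, RCLike.norm_ofReal, abs_norm] at h1
  rcases eq_or_lt_of_le (norm_nonneg z) with hz | hz
  · rw [← hz]
    positivity
  · nlinarith

/-- By Duhamel's formula a matrix element of `e^{-isA} - e^{-isB}` is an integral of matrix elements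
of `V` between vectors of Bessel families moved by contractions. -/
theorem traceBound_group_sub (hA : IsSelfAdjoint A) (hB : IsSelfAdjoint B)
    (hCA : CA.Represents A) (hCB : CB.Represents B) (h : IsPerturbation A B V) {C : ℝ}
    (hV : TraceBound V C) (s : ℝ) : TraceBound (CA.group s - CB.group s) (|s| * C) := by
  intro I a b ha hb
  have hi : ∀ i ∈ I, IntervalIntegrable
      (fun r => ‖⟪CA.group (r - s) (a i), V (CB.group r (b i))⟫_ℂ‖) volume 0 s := fun i _ =>
    (continuous_inner_group CA CB V s (b i) (a i)).norm.intervalIntegrable _ _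
  have h1 : ∀ i ∈ I, ‖⟪a i, (CA.group s - CB.group s) (b i)⟫_ℂ‖ ≤
      |∫ r in (0 : ℝ)..s, ‖⟪CA.group (r - s) (a i), V (CB.group r (b i))⟫_ℂ‖| := by
    intro i _
    rw [sub_apply, duhamel hA hB hCA hCB h, norm_mul, norm_neg, Complex.norm_I, one_mul]
    exact intervalIntegral.norm_integral_le_abs_integral_norm
  have h2 : ∀ r : ℝ, ∑ i ∈ I, ‖⟪CA.group (r - s) (a i), V (CB.group r (b i))⟫_ℂ‖ ≤ C := fun r =>
    hV I _ _ (ha.map (CA.norm_group_le _)) (hb.map (CB.norm_group_le _))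
  refine (Finset.sum_le_sum h1).trans ?_
  have h3 : ∑ i ∈ I, |∫ r in (0 : ℝ)..s, ‖⟪CA.group (r - s) (a i), V (CB.group r (b i))⟫_ℂ‖|
      = |∫ r in (0 : ℝ)..s, ∑ i ∈ I, ‖⟪CA.group (r - s) (a i), V (CB.group r (b i))⟫_ℂ‖| := by
    rw [intervalIntegral.integral_finsetSum hi]
    rcases le_total 0 s with hs | hs
    · have h4 : ∀ i, 0 ≤ ∫ r in (0 : ℝ)..s,
          ‖⟪CA.group (r - s) (a i), V (CB.group r (b i))⟫_ℂ‖ := fun i =>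
        intervalIntegral.integral_nonneg hs fun _ _ => norm_nonneg _
      rw [abs_of_nonneg (Finset.sum_nonneg fun i _ => h4 i)]
      exact Finset.sum_congr rfl fun i _ => abs_of_nonneg (h4 i)
    · have h4 : ∀ i, ∫ r in (0 : ℝ)..s,
          ‖⟪CA.group (r - s) (a i), V (CB.group r (b i))⟫_ℂ‖ ≤ 0 := fun i => by
        rw [intervalIntegral.integral_symm]
        exact neg_nonpos.mpr (intervalIntegral.integral_nonneg hs fun _ _ => norm_nonneg _)
      rw [abs_of_nonpos (Finset.sum_nonpos fun i _ => h4 i), ← Finset.sum_neg_distrib]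
      exact Finset.sum_congr rfl fun i _ => abs_of_nonpos (h4 i)
  rw [h3, ← Real.norm_eq_abs]
  have h5 := intervalIntegral.norm_integral_le_of_norm_le_const (a := 0) (b := s) (C := C)
    (f := fun r => ∑ i ∈ I, ‖⟪CA.group (r - s) (a i), V (CB.group r (b i))⟫_ℂ‖) fun r _ => by
      rw [Real.norm_of_nonneg (Finset.sum_nonneg fun i _ => norm_nonneg _)]
      exact h2 r
  rw [sub_zero] at h5
  linarith

end Perturbation

/-! ### Averages of measures and the Poisson kernel -/

section Measures

theorem integral_expChar_eq_charFun (μ : Measure ℝ) (s : ℝ) :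
    ∫ t, expChar s t ∂μ = charFun μ (-s) := by
  rw [charFun_apply_real]
  refine integral_congr_ae (Eventually.of_forall fun t => ?_)
  simp only [expChar_eq]
  congr 2
  push_cast
  ring

/-- A family of measures of constant mass is measurable if its characteristic functions are
continuous in the parameter; by Lévy's theorem the family is even weakly continuous. -/
theorem measurable_of_continuous_charFun {m : ℝ → Measure ℝ} {c : ℝ≥0∞} (hc0 : c ≠ 0)
    (hc : c ≠ ∞) (hm : ∀ t, m t Set.univ = c)
    (hcont : ∀ s, Continuous fun t => ∫ x, expChar s x ∂(m t)) : Measurable m := by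
  have hprob : ∀ t, IsProbabilityMeasure (c⁻¹ • m t) := fun t =>
    ⟨by rw [Measure.smul_apply, hm, smul_eq_mul, ENNReal.inv_mul_cancel hc0 hc]⟩
  let p : ℝ → ProbabilityMeasure ℝ := fun t => ⟨c⁻¹ • m t, hprob t⟩
  have hp : Continuous p := by
    refine SeqContinuous.continuous fun u t hu => ?_
    rw [ProbabilityMeasure.tendsto_iff_tendsto_charFun]
    intro s
    have h1 : ∀ t, charFun (p t : Measure ℝ) s = c⁻¹.toReal • ∫ x, expChar (-s) x ∂(m t) := by
      intro t
      rw [← integral_smul_measure, integral_expChar_eq_charFun, neg_neg]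
      rfl
    have h2 := ((hcont (-s)).tendsto t).comp hu
    refine (h1 t).symm ▸ ?_
    exact (h2.const_smul (c⁻¹.toReal)).congr fun n => (h1 (u n)).symm
  have hU : ∀ U : Set ℝ, IsOpen U → Measurable fun t => m t U := by
    intro U hU
    have h1 : LowerSemicontinuous fun t => (p t : Measure ℝ) U := by
      intro t
      refine lowerSemicontinuousAt_iff_le_liminf.mpr ?_
      exact ProbabilityMeasure.le_liminf_measure_open_of_tendsto (hp.tendsto t) hU
    have h2 : (fun t => m t U) = fun t => c * (p t : Measure ℝ) U := by
      funext t
      change _ = c * (c⁻¹ • m t) U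
      rw [Measure.smul_apply, smul_eq_mul, ← mul_assoc, ENNReal.mul_inv_cancel hc0 hc, one_mul]
    rw [h2]
    exact h1.measurable.const_mul c
  have hfin : ∀ t, IsFiniteMeasure (m t) := fun t => ⟨by rw [hm]; exact hc.lt_top⟩
  exact Measurable.measure_of_isPiSystem (BorelSpace.measurable_eq (α := ℝ)) isPiSystem_isOpen
    (fun s hs => hU s hs) (hU _ isOpen_univ)

/-- The average over the parameter interval `[0, 1]` of a family of measures of constant mass. -/
theorem exists_average_measure {m : ℝ → Measure ℝ} {c : ℝ≥0∞} (hc : c ≠ ∞)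
    (hm : ∀ t, m t Set.univ = c) (hcont : ∀ s, Continuous fun t => ∫ x, expChar s x ∂(m t)) :
    ∃ ν : Measure ℝ, IsFiniteMeasure ν ∧ ν Set.univ = c ∧
      (∀ s, ∫ x, expChar s x ∂ν = ∫ t in (0 : ℝ)..1, ∫ x, expChar s x ∂(m t)) ∧
      ∀ f : ℝ → ℝ≥0∞, Measurable f →
        ∫⁻ x, f x ∂ν = ∫⁻ t in Set.Ioc (0 : ℝ) 1, ∫⁻ x, f x ∂(m t) := by
  have hmeas : Measurable m := by
    rcases eq_or_ne c 0 with rfl | hc0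
    · have : m = fun _ => 0 := funext fun t => Measure.measure_univ_eq_zero.mp (hm t)
      rw [this]
      exact measurable_const
    · exact measurable_of_continuous_charFun hc0 hc hm hcont
  let κ : ProbabilityTheory.Kernel ℝ ℝ := ⟨m, hmeas⟩
  have hκ : ProbabilityTheory.IsFiniteKernel κ :=
    ⟨⟨c, hc.lt_top, fun t => (hm t).le⟩⟩
  let P : Measure (ℝ × ℝ) := (volume.restrict (Set.Ioc (0 : ℝ) 1)).compProd κ
  have hlint : ∀ f : ℝ → ℝ≥0∞, Measurable f →
      ∫⁻ x, f x ∂P.snd = ∫⁻ t in Set.Ioc (0 : ℝ) 1, ∫⁻ x, f x ∂(m t) := by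
    intro f hf
    have h1 := Measure.lintegral_compProd (μ := volume.restrict (Set.Ioc (0 : ℝ) 1)) (κ := κ)
      (f := fun p => f p.2) (hf.comp measurable_snd)
    rw [Measure.snd, lintegral_map hf measurable_snd, h1]
    rfl
  refine ⟨P.snd, inferInstance, ?_, fun s => ?_, hlint⟩
  · have h1 := hlint (fun _ => 1) measurable_const
    simpa [hm] using h1
  · have hi : Integrable (fun p : ℝ × ℝ => expChar s p.2) P :=
      Integrable.of_bound ((measurable_expChar s).comp measurable_snd).aestronglyMeasurable 1
        (Eventually.of_forall fun p => by simp)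
    rw [Measure.snd, integral_map measurable_snd.aemeasurable
      (measurable_expChar s).aestronglyMeasurable,
      Measure.integral_compProd hi, intervalIntegral.integral_of_le zero_le_one]
    rfl

/-- The Poisson kernel of the upper half plane. -/
noncomputable def poissonKernelLine (ε x l : ℝ) : ℝ := ε / (Real.pi * ((x - l) ^ 2 + ε ^ 2))

theorem continuous_poissonKernelLine {ε : ℝ} (hε : 0 < ε) :
    Continuous fun p : ℝ × ℝ => poissonKernelLine ε p.1 p.2 := by
  unfold poissonKernelLine
  refine Continuous.div (by fun_prop) (by fun_prop) fun p => ?_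
  have := Real.pi_pos
  positivity

theorem poissonKernelLine_nonneg {ε : ℝ} (hε : 0 < ε) (x l : ℝ) : 0 ≤ poissonKernelLine ε x l := by
  unfold poissonKernelLine
  have := Real.pi_pos
  positivity

theorem integral_poissonKernelLine {ε : ℝ} (hε : 0 < ε) (x : ℝ) {r : ℝ} :
    ∫ l in (x - r)..(x + r), poissonKernelLine ε x l = 2 / Real.pi * Real.arctan (r / ε) := by
  have hd : ∀ l : ℝ, HasDerivAt (fun l => Real.pi⁻¹ * Real.arctan ((l - x) / ε))
      (poissonKernelLine ε x l) l := by
    intro l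
    have h1 : HasDerivAt (fun l : ℝ => (l - x) / ε) (1 / ε) l :=
      ((hasDerivAt_id l).sub_const x).div_const ε
    have h2 := (h1.arctan).const_mul Real.pi⁻¹
    refine h2.congr_deriv ?_
    unfold poissonKernelLine
    have := Real.pi_pos
    have h3 : (x - l) ^ 2 + ε ^ 2 ≠ 0 := by positivity
    have h4 : 1 + ((l - x) / ε) ^ 2 ≠ 0 := by positivity
    field_simp
    ring
  have hc : Continuous fun l => poissonKernelLine ε x l :=
    (continuous_poissonKernelLine hε).comp (continuous_const.prodMk continuous_id)
  rw [intervalIntegral.integral_eq_sub_of_hasDerivAt (fun l _ => hd l)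
    (hc.intervalIntegrable _ _)]
  have e1 : (x + r - x) / ε = r / ε := by ring
  have e2 : (x - r - x) / ε = -(r / ε) := by ring
  rw [e1, e2, Real.arctan_neg]
  ring

/-- A finite measure whose Poisson integrals are at most `1` is absolutely continuous. -/
theorem absolutelyContinuous_of_poisson {ν : Measure ℝ} [IsFiniteMeasure ν]
    (h : ∀ ε > 0, ∀ l : ℝ, ∫⁻ x, ENNReal.ofReal (poissonKernelLine ε x l) ∂ν ≤ 1) :
    ν ≪ volume := by
  have hopen : ∀ U : Set ℝ, IsOpen U → ν U ≤ volume U := by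
    intro U hU
    let ε : ℕ → ℝ := fun n => 1 / ((n : ℝ) + 1)
    have hε : ∀ n, 0 < ε n := fun n => by positivity
    have hmeas : ∀ n, Measurable fun p : ℝ × ℝ =>
        ENNReal.ofReal (poissonKernelLine (ε n) p.1 p.2) := fun n =>
      (continuous_poissonKernelLine (hε n)).measurable.ennreal_ofReal
    have h1 : ∀ n, ∫⁻ x, (∫⁻ l in U, ENNReal.ofReal (poissonKernelLine (ε n) x l)) ∂ν
        ≤ volume U := by
      intro n
      rw [lintegral_lintegral_swap (hmeas n).aemeasurable]
      refine (lintegral_mono fun l => h (ε n) (hε n) l).trans ?_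
      simp
    have h2 : ∀ x, U.indicator (fun _ => (1 : ℝ≥0∞)) x ≤
        liminf (fun n => ∫⁻ l in U, ENNReal.ofReal (poissonKernelLine (ε n) x l)) atTop := by
      intro x
      by_cases hx : x ∈ U
      · rw [Set.indicator_of_mem hx]
        obtain ⟨r, hr, hball⟩ := Metric.isOpen_iff.mp hU x hx
        have h3 : ∀ n, ENNReal.ofReal (2 / Real.pi * Real.arctan (r / 2 / ε n)) ≤
            ∫⁻ l in U, ENNReal.ofReal (poissonKernelLine (ε n) x l) := by
          intro n
          have hc : Continuous fun l => poissonKernelLine (ε n) x l :=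
            (continuous_poissonKernelLine (hε n)).comp (continuous_const.prodMk continuous_id)
          rw [← integral_poissonKernelLine (hε n) x,
            intervalIntegral.integral_of_le (by linarith),
            ofReal_integral_eq_lintegral_ofReal]
          · refine lintegral_mono_set fun l hl => hball ?_
            rw [Metric.mem_ball, Real.dist_eq, abs_lt]
            constructor <;> linarith [hl.1, hl.2]
          · exact (hc.integrableOn_Icc (a := x - r / 2) (b := x + r / 2)).mono_set
              Set.Ioc_subset_Icc_self
          · exact Eventually.of_forall fun l => poissonKernelLine_nonneg (hε n) x l
        have h4 : Tendsto (fun n => ENNReal.ofReal (2 / Real.pi * Real.arctan (r / 2 / ε n)))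
            atTop (𝓝 1) := by
          have h5 : Tendsto (fun n => r / 2 / ε n) atTop atTop := by
            have : ∀ n, r / 2 / ε n = (r / 2) * ((n : ℝ) + 1) := fun n => by
              simp [ε]
            simp_rw [this]
            exact (tendsto_atTop_add_const_right _ 1 tendsto_natCast_atTop_atTop).const_mul_atTop
              (by positivity)
          have h6 := (Real.tendsto_arctan_atTop.mono_right nhdsWithin_le_nhds).comp h5
          have h7 := ENNReal.tendsto_ofReal (h6.const_mul (2 / Real.pi))
          have e : 2 / Real.pi * (Real.pi / 2) = 1 := by
            have := Real.pi_pos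
            field_simp
          rw [e, ENNReal.ofReal_one] at h7
          exact h7
        rw [← h4.liminf_eq]
        exact liminf_le_liminf (Eventually.of_forall h3)
      · rw [Set.indicator_of_notMem hx]
        exact zero_le
    calc ν U = ∫⁻ x, U.indicator (fun _ => (1 : ℝ≥0∞)) x ∂ν := by
          rw [lintegral_indicator hU.measurableSet]
          simp
      _ ≤ ∫⁻ x, liminf (fun n => ∫⁻ l in U, ENNReal.ofReal (poissonKernelLine (ε n) x l)) atTop
            ∂ν := lintegral_mono h2
      _ ≤ liminf (fun n => ∫⁻ x, (∫⁻ l in U, ENNReal.ofReal (poissonKernelLine (ε n) x l)) ∂ν)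
            atTop := lintegral_liminf_le fun n => (hmeas n).lintegral_prod_right'
      _ ≤ volume U := by
          refine (liminf_le_liminf (Eventually.of_forall h1)).trans ?_
          simp
  intro S hS
  refine le_antisymm (ENNReal.le_of_forall_pos_le_add fun δ hδ _ => ?_) zero_le
  obtain ⟨U, hSU, hU, hlt⟩ := Set.exists_isOpen_lt_of_lt (μ := volume) S (δ : ℝ≥0∞)
    (by rw [hS]; exact_mod_cast hδ)
  rw [zero_add]
  exact ((measure_mono hSU).trans (hopen U hU)).trans hlt.le

end Measures

/-! ### Rank one perturbations -/

section RankOne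

variable {H : Type*} [NormedAddCommGroup H] [InnerProductSpace ℂ H] [CompleteSpace H]
variable {A B : H →ₗ.[ℂ] H} {CA CB : BorelCalculus H}

/-- Integration of Duhamel's formula for a rank one perturbation over an orthonormal basis. -/
theorem opTrace_group_sub_rankOne [TopologicalSpace.SeparableSpace H] (hA : IsSelfAdjoint A)
    (hB : IsSelfAdjoint B) (hCA : CA.Represents A) (hCB : CB.Represents B) {c : ℂ} {ψ : H}
    (h : IsPerturbation A B (c • rankOneOp ψ)) (s : ℝ) :
    opTrace (CA.group s - CB.group s) =
      -Complex.I * (c * ∫ r in (0 : ℝ)..s, ⟪CB.group (-r) ψ, CA.group (s - r) ψ⟫_ℂ) := by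
  have : Countable (onbIndex H) := countable_onbIndex H
  let F : onbIndex H → ℝ → ℂ := fun i r =>
    ⟪CB.group (-r) ψ, onb H i⟫_ℂ * ⟪onb H i, CA.group (s - r) ψ⟫_ℂ
  have h1 : ∀ i, ⟪onb H i, (CA.group s - CB.group s) (onb H i)⟫_ℂ =
      -Complex.I * (c * ∫ r in (0 : ℝ)..s, F i r) := by
    intro i
    rw [sub_apply, duhamel hA hB hCA hCB h]
    congr 1
    rw [← intervalIntegral.integral_const_mul]
    refine intervalIntegral.integral_congr (E := ℂ) fun r _ => ?_
    simp only [F, smul_apply, rankOneOp_apply, inner_smul_right]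
    rw [CB.inner_group_left, ← CA.inner_group_left, neg_sub]
  have hcont : ∀ i, Continuous (F i) := by
    intro i
    have h2 : Continuous fun r : ℝ => CB.group (-r) ψ :=
      (CB.continuous_group_apply ψ).comp continuous_neg
    have h3 : Continuous fun r : ℝ => CA.group (s - r) ψ :=
      (CA.continuous_group_apply ψ).comp (continuous_const.sub continuous_id)
    fun_prop
  have hint : ∀ i, Integrable (F i) (volume.restrict (Set.uIoc 0 s)) := fun i =>
    (intervalIntegrable_iff.mp ((hcont i).intervalIntegrable 0 s))
  have hbound : ∀ (I : Finset (onbIndex H)) (r : ℝ), ∑ i ∈ I, ‖F i r‖ ≤ ‖ψ‖ * ‖ψ‖ := by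
    intro I r
    simp only [F, norm_mul]
    have h2 := (isBessel_onb (H := H)).sum_mul_le isBessel_onb I (CA.group (s - r) ψ)
      (CB.group (-r) ψ)
    simp_rw [mul_comm ‖⟪CB.group (-r) ψ, _⟫_ℂ‖]
    exact h2.trans (by gcongr <;> exact BorelCalculus.norm_group_apply_le _ _ _)
  have hsum : Summable fun i => ∫ r, ‖F i r‖ ∂(volume.restrict (Set.uIoc 0 s)) := by
    refine summable_of_sum_le (c := ∫ _ in Set.uIoc 0 s, ‖ψ‖ * ‖ψ‖)
      (fun i => integral_nonneg fun r => norm_nonneg _) fun I => ?_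
    rw [← integral_finsetSum _ fun i _ => (hint i).norm]
    refine integral_mono (integrable_finsetSum _ fun i _ => (hint i).norm) ?_ (hbound I)
    exact intervalIntegrable_iff.mp intervalIntegrable_const
  have h4 := hasSum_integral_of_summable_integral_norm hint hsum
  have h5 : ∀ r, ∑' i, F i r = ⟪CB.group (-r) ψ, CA.group (s - r) ψ⟫_ℂ := fun r =>
    (onb H).tsum_inner_mul_inner _ _
  simp_rw [h5] at h4
  unfold opTrace
  simp_rw [h1]
  rw [tsum_mul_left, tsum_mul_left]
  congr 2
  simp_rw [intervalIntegral.intervalIntegral_eq_integral_uIoc]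
  rw [← h4.tsum_eq]
  exact (tsum_const_smul'' _)

end RankOne

/-! ### Spectral averaging for rank one perturbations -/

section Averaging

variable {H : Type*} [NormedAddCommGroup H] [InnerProductSpace ℂ H] [CompleteSpace H]
variable {A B : H →ₗ.[ℂ] H} {CA CB : BorelCalculus H}

/-- Equal operators have the same group, whatever calculi are chosen for them. -/
theorem group_eq_of_isPerturbation_zero (hA : IsSelfAdjoint A) (hB : IsSelfAdjoint B)
    (hCA : CA.Represents A) (hCB : CB.Represents B) (h : IsPerturbation A B 0) (s : ℝ) :
    CA.group s = CB.group s := by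
  have h1 := norm_group_sub_le hA hB hCA hCB h s
  rw [norm_zero, mul_zero] at h1
  exact sub_eq_zero.mp (norm_le_zero_iff.mp h1)

theorem norm_rankOneOp_le (ψ : H) : ‖rankOneOp ψ‖ ≤ ‖ψ‖ ^ 2 := by
  refine ContinuousLinearMap.opNorm_le_bound _ (by positivity) fun x => ?_
  rw [rankOneOp_apply, norm_smul]
  calc _ ≤ ‖ψ‖ * ‖x‖ * ‖ψ‖ := by gcongr; exact norm_inner_le_norm _ _
    _ = _ := by ring

/-- Krein's formula for the resolvent of a rank one perturbation. -/
theorem inner_resolvent_rankOne (hCA : CA.Represents A) (hCB : CB.Represents B) {c : ℂ} {ψ : H}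
    (h : IsPerturbation A B (c • rankOneOp ψ)) {z : ℂ} (hz : z.im ≠ 0) :
    ⟪ψ, CB.resolvent z ψ⟫_ℂ =
      ⟪ψ, CA.resolvent z ψ⟫_ℂ * (1 + c * ⟪ψ, CB.resolvent z ψ⟫_ℂ) := by
  obtain ⟨hx, hx1⟩ := hCB.apply_resolvent hz ψ
  have hxA : CB.resolvent z ψ ∈ A.domain := by rw [h.1]; exact hx
  have h1 := hCA.resolvent_sub_apply hz ⟨_, hxA⟩
  rw [h.2 _ hxA hx] at h1
  have h2 : B ⟨CB.resolvent z ψ, hx⟩ + (c • rankOneOp ψ) (CB.resolvent z ψ)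
      - z • CB.resolvent z ψ = (1 + c * ⟪ψ, CB.resolvent z ψ⟫_ℂ) • ψ := by
    rw [add_sub_right_comm, hx1, smul_apply, rankOneOp_apply, smul_smul, add_smul, one_smul]
  change CA.resolvent z (_ - z • CB.resolvent z ψ) = CB.resolvent z ψ at h1
  rw [h2, map_smul] at h1
  conv_lhs => rw [← h1, inner_smul_right]
  ring

theorem im_inv_ofReal_sub (ε x l : ℝ) :
    ((x : ℂ) - (l + ε * Complex.I))⁻¹.im = ε / ((x - l) ^ 2 + ε ^ 2) := by
  rw [Complex.inv_im]
  simp [Complex.normSq_apply]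
  ring

theorem lintegral_poissonKernelLine (C : BorelCalculus H) {ε : ℝ} (hε : 0 < ε) (l : ℝ) (ψ : H) :
    ∫⁻ x, ENNReal.ofReal (poissonKernelLine ε x l) ∂(C.meas ψ) =
      ENNReal.ofReal (Real.pi⁻¹ * (⟪ψ, C.resolvent (l + ε * Complex.I) ψ⟫_ℂ).im) := by
  have hz : ((l : ℂ) + ε * Complex.I).im ≠ 0 := by simpa using hε.ne'
  have hi : Integrable (fun x : ℝ => ((x : ℂ) - (l + ε * Complex.I))⁻¹) (C.meas ψ) :=
    memLp_one_iff_integrable.mp (C.memLp_inv_sub hz ψ 1)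
  have h1 : (⟪ψ, C.resolvent (l + ε * Complex.I) ψ⟫_ℂ).im =
      ∫ x, ((x : ℂ) - (l + ε * Complex.I))⁻¹.im ∂(C.meas ψ) := by
    rw [C.inner_resolvent hz]
    exact (integral_im hi).symm
  have h2 : ∀ x, poissonKernelLine ε x l =
      Real.pi⁻¹ * ((x : ℂ) - (l + ε * Complex.I))⁻¹.im := by
    intro x
    rw [im_inv_ofReal_sub, poissonKernelLine]
    have := Real.pi_pos
    have : (x - l) ^ 2 + ε ^ 2 ≠ 0 := by positivity
    field_simp
  rw [h1, ← integral_const_mul,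
    ofReal_integral_eq_lintegral_ofReal (f := fun x : ℝ => Real.pi⁻¹ * (_ : ℂ).im)
      (hi.im.const_mul _)]
  · simp_rw [h2]
  · refine Eventually.of_forall fun x => ?_
    change 0 ≤ Real.pi⁻¹ * _
    rw [← h2]
    exact poissonKernelLine_nonneg hε x l

/-- The average of the imaginary part along the Möbius orbit `G t = F / (1 + t F)` is a difference
of two values of the arc tangent. -/
theorem lintegral_im_orbit_le {F : ℂ} (hF : 0 ≤ F.im) {G : ℝ → ℂ}
    (hG : ∀ t : ℝ, F = G t * (1 + t * F)) :
    ∫⁻ t in Set.Ioc (0 : ℝ) 1, ENNReal.ofReal (Real.pi⁻¹ * (G t).im) ≤ 1 := by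
  have hne : ∀ t : ℝ, 1 + t * F ≠ 0 := by
    intro t h
    have h1 := hG t
    rw [h, mul_zero] at h1
    rw [h1] at h
    simp at h
  have hGt : ∀ t : ℝ, (G t).im = F.im / Complex.normSq (1 + t * F) := by
    intro t
    have h1 : G t = F / (1 + t * F) := by rw [eq_div_iff (hne t)]; exact (hG t).symm
    have h2 : Complex.normSq (1 + t * F) ≠ 0 := by simpa [Complex.normSq_eq_zero] using hne t
    rw [h1, Complex.div_im, div_sub_div_same]
    congr 1
    simp
    ring
  rcases eq_or_lt_of_le hF with h0 | hpos
  · simp_rw [hGt, ← h0]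
    simp
  set a := F.re
  set b := F.im
  -- The derivative of `g` is `Im F / |1 + t F|²` up to the factor `π⁻¹`.
  let g : ℝ → ℝ := fun t => Real.pi⁻¹ * Real.arctan (((a ^ 2 + b ^ 2) * t + a) / b)
  have hd : ∀ t, HasDerivAt g (Real.pi⁻¹ * (G t).im) t := by
    intro t
    have h1 : HasDerivAt (fun t : ℝ => ((a ^ 2 + b ^ 2) * t + a) / b) ((a ^ 2 + b ^ 2) * 1 / b) t :=
      (((hasDerivAt_id t).const_mul _).add_const a).div_const b
    refine (h1.arctan.const_mul Real.pi⁻¹).congr_deriv ?_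
    rw [hGt]
    have h2 : Complex.normSq (1 + t * F) = (1 + t * a) ^ 2 + (t * b) ^ 2 := by
      rw [Complex.normSq_apply]
      simp [a, b]
      ring
    have h3 : (1 + t * a) ^ 2 + (t * b) ^ 2 ≠ 0 := by
      rw [← h2]
      simpa [Complex.normSq_eq_zero] using hne t
    rw [h2]
    have h4 : 1 + (((a ^ 2 + b ^ 2) * t + a) / b) ^ 2 =
        (a ^ 2 + b ^ 2) * ((1 + t * a) ^ 2 + (t * b) ^ 2) / b ^ 2 := by
      field_simp
      ring
    rw [h4]
    have h5 : a ^ 2 + b ^ 2 ≠ 0 := by positivity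
    field_simp
  have hcont : Continuous fun t => Real.pi⁻¹ * (G t).im := by
    simp_rw [hGt]
    refine continuous_const.mul (continuous_const.div ?_ fun t => ?_)
    · exact Complex.continuous_normSq.comp (by fun_prop)
    · simpa [Complex.normSq_eq_zero] using hne t
  have hi := hcont.intervalIntegrable (μ := volume) 0 1
  rw [← ofReal_integral_eq_lintegral_ofReal hi.1]
  · rw [← intervalIntegral.integral_of_le zero_le_one,
      intervalIntegral.integral_eq_sub_of_hasDerivAt (fun t _ => hd t) hi]
    refine ENNReal.ofReal_le_one.mpr ?_
    simp only [g]
    rw [← mul_sub, inv_mul_le_one₀ Real.pi_pos]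
    have h1 := Real.arctan_lt_pi_div_two (((a ^ 2 + b ^ 2) * 1 + a) / b)
    have h2 := Real.neg_pi_div_two_lt_arctan (((a ^ 2 + b ^ 2) * 0 + a) / b)
    linarith
  · refine Eventually.of_forall fun t => ?_
    have := Real.pi_pos
    change 0 ≤ Real.pi⁻¹ * (G t).im
    rw [hGt]
    exact mul_nonneg (by positivity) (div_nonneg hF (Complex.normSq_nonneg _))

/-- The derivative of the trace of the difference of the groups along the segment
`t ↦ B + t ⟪ψ, ·⟫ ψ`. -/
theorem hasDerivAt_opTrace_group [TopologicalSpace.SeparableSpace H] {ψ : H}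
    {D : ℝ → H →ₗ.[ℂ] H} {C : ℝ → BorelCalculus H} (hD : ∀ t, IsSelfAdjoint (D t))
    (hC : ∀ t, (C t).Represents (D t))
    (h : ∀ t u : ℝ, IsPerturbation (D u) (D t) (((u - t : ℝ) : ℂ) • rankOneOp ψ)) (s t : ℝ) :
    HasDerivAt (fun t => opTrace ((C t).group s - (C 0).group s))
      (-Complex.I * (s * ⟪ψ, (C t).group s ψ⟫_ℂ)) t := by
  have hTB : ∀ t u, TraceBound ((C u).group s - (C t).group s) _ := fun t u =>
    traceBound_group_sub (hD u) (hD t) (hC u) (hC t) (h t u) ((traceBound_rankOneOp ψ).smul _) s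
  rw [hasDerivAt_iff_isLittleO]
  refine Asymptotics.IsBigO.trans_isLittleO (g := fun u => ‖u - t‖ ^ 2) ?_
    (Asymptotics.isLittleO_pow_sub_sub t one_lt_two)
  -- The error of the linear approximation is quadratic in `u - t`, because the integrand of
  -- Duhamel's formula differs from its value at `u = t` by `O(|u - t|)`.
  refine Asymptotics.IsBigO.of_bound (‖ψ‖ ^ 4 * |s| ^ 2) (Eventually.of_forall fun u => ?_)
  have h1 : opTrace ((C u).group s - (C 0).group s) - opTrace ((C t).group s - (C 0).group s) =
      opTrace ((C u).group s - (C t).group s) := by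
    rw [sub_eq_iff_eq_add, ← (hTB t u).opTrace_add (hTB 0 t), sub_add_sub_cancel]
  rw [h1, opTrace_group_sub_rankOne (hD u) (hD t) (hC u) (hC t) (h t u)]
  have hcont : Continuous fun r : ℝ => ⟪(C t).group (-r) ψ, (C u).group (s - r) ψ⟫_ℂ :=
    (((C t).continuous_group_apply ψ).comp continuous_neg).inner
      (((C u).continuous_group_apply ψ).comp (continuous_const.sub continuous_id))
  have h2 : -Complex.I * (((u - t : ℝ) : ℂ) *
        ∫ r in (0 : ℝ)..s, ⟪(C t).group (-r) ψ, (C u).group (s - r) ψ⟫_ℂ) -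
      (u - t) • (-Complex.I * (s * ⟪ψ, (C t).group s ψ⟫_ℂ)) =
      -Complex.I * (((u - t : ℝ) : ℂ) * ∫ r in (0 : ℝ)..s,
        (⟪(C t).group (-r) ψ, (C u).group (s - r) ψ⟫_ℂ - ⟪ψ, (C t).group s ψ⟫_ℂ)) := by
    rw [intervalIntegral.integral_sub (hcont.intervalIntegrable _ _) intervalIntegrable_const,
      intervalIntegral.integral_const, Complex.real_smul, Complex.real_smul]
    push_cast
    ring
  have h3 : ∀ r ∈ Set.uIoc 0 s, ‖⟪(C t).group (-r) ψ, (C u).group (s - r) ψ⟫_ℂ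
      - ⟪ψ, (C t).group s ψ⟫_ℂ‖ ≤ |s| * |u - t| * ‖ψ‖ ^ 4 := by
    intro r hr
    have e1 : (C t).group s ψ = (C t).group r ((C t).group (s - r) ψ) := by
      rw [← (C t).group_add_apply, add_sub_cancel]
    rw [e1, ← (C t).inner_group_left, ← inner_sub_right, ← sub_apply]
    have e2 := norm_group_sub_le (hD u) (hD t) (hC u) (hC t) (h t u) (s - r)
    have e3 : |s - r| ≤ |s| := by
      have hr' := Set.uIoc_subset_uIcc hr
      have := Set.abs_sub_right_of_mem_uIcc hr'
      simpa using this
    rw [norm_smul, Complex.norm_real, Real.norm_eq_abs] at e2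
    calc _ ≤ ‖(C t).group (-r) ψ‖ * ‖((C u).group (s - r) - (C t).group (s - r)) ψ‖ :=
          norm_inner_le_norm _ _
      _ ≤ ‖ψ‖ * (‖(C u).group (s - r) - (C t).group (s - r)‖ * ‖ψ‖) := by
          gcongr
          · exact (C t).norm_group_apply_le _ _
          · exact ContinuousLinearMap.le_opNorm _ _
      _ ≤ ‖ψ‖ * (|s| * (|u - t| * ‖ψ‖ ^ 2) * ‖ψ‖) := by
          gcongr
          refine e2.trans ?_
          gcongr
          exact norm_rankOneOp_le ψ
      _ = _ := by ring
  have h4 := intervalIntegral.norm_integral_le_of_norm_le_const h3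
  rw [h2, norm_mul, norm_mul, norm_neg, Complex.norm_I, one_mul, Complex.norm_real,
    Real.norm_eq_abs, norm_pow, Real.norm_eq_abs, abs_abs]
  rw [sub_zero] at h4
  calc _ ≤ |u - t| * (|s| * |u - t| * ‖ψ‖ ^ 4 * |s|) := by gcongr
    _ = _ := by ring

/-- The spectral shift of a rank one perturbation is the average over `t ∈ [0, 1]` of the spectral
measures of `ψ` for the operators `B + t ⟪ψ, ·⟫ ψ`. -/
theorem exists_spectralShift_rankOne [TopologicalSpace.SeparableSpace H] (hA : IsSelfAdjoint A)
    (hB : IsSelfAdjoint B) (hCA : CA.Represents A) (hCB : CB.Represents B) {ψ : H}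
    (h : IsPerturbation A B (rankOneOp ψ)) :
    ∃ ν : Measure ℝ, IsFiniteMeasure ν ∧ ν ≪ volume ∧ ν Set.univ = ‖ψ‖ₑ ^ 2 ∧
      ∀ s, opTrace (CA.group s - CB.group s) = -Complex.I * (s * ∫ x, expChar s x ∂ν) := by
  let D : ℝ → H →ₗ.[ℂ] H := fun t => addBounded B ((t : ℂ) • rankOneOp ψ)
  have hD : ∀ t, IsSelfAdjoint (D t) := fun t => by
    refine isSelfAdjoint_addBounded hB (IsSelfAdjoint.smul ?_ (isSelfAdjoint_rankOneOp ψ))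
    exact Complex.conj_ofReal t
  choose C hC using fun t => exists_borelCalculus (hD t)
  have hP : ∀ t u : ℝ, IsPerturbation (D u) (D t) (((u - t : ℝ) : ℂ) • rankOneOp ψ) := by
    intro t u
    rw [Complex.ofReal_sub, sub_smul]
    exact isPerturbation_addBounded B _ _
  have h0 : ∀ s, (C 0).group s = CB.group s := by
    refine fun s => group_eq_of_isPerturbation_zero (hD 0) hB (hC 0) hCB ⟨rfl, fun x hx hx' => ?_⟩ s
    rw [addBounded_apply]
    simp
  have h1 : ∀ s, (C 1).group s = CA.group s := by
    refine fun s => group_eq_of_isPerturbation_zero (hD 1) hA (hC 1) hCA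
      ⟨h.1.symm, fun x hx hx' => ?_⟩ s
    rw [addBounded_apply, h.2 x hx' hx]
    simp
  have hlip : ∀ s t u : ℝ, ‖⟪ψ, (C u).group s ψ⟫_ℂ - ⟪ψ, (C t).group s ψ⟫_ℂ‖ ≤
      |s| * ‖ψ‖ ^ 4 * |u - t| := by
    intro s t u
    rw [← inner_sub_right, ← sub_apply]
    have e2 := norm_group_sub_le (hD u) (hD t) (hC u) (hC t) (hP t u) s
    rw [norm_smul, Complex.norm_real, Real.norm_eq_abs] at e2
    calc _ ≤ ‖ψ‖ * ‖((C u).group s - (C t).group s) ψ‖ := norm_inner_le_norm _ _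
      _ ≤ ‖ψ‖ * (‖(C u).group s - (C t).group s‖ * ‖ψ‖) := by
          gcongr
          exact ContinuousLinearMap.le_opNorm _ _
      _ ≤ ‖ψ‖ * (|s| * (|u - t| * ‖ψ‖ ^ 2) * ‖ψ‖) := by
          gcongr
          refine e2.trans ?_
          gcongr
          exact norm_rankOneOp_le ψ
      _ = _ := by ring
  have hcont : ∀ s, Continuous fun t => ⟪ψ, (C t).group s ψ⟫_ℂ := by
    intro s
    refine (LipschitzWith.of_dist_le' (K := |s| * ‖ψ‖ ^ 4) fun u t => ?_).continuous
    rw [dist_eq_norm, Real.dist_eq]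
    exact hlip s t u
  obtain ⟨ν, hfin, huniv, hchar, hlint⟩ := exists_average_measure (m := fun t => (C t).meas ψ)
    (c := ‖ψ‖ₑ ^ 2) (by finiteness) (fun t => (C t).meas_univ ψ) (by
      simp_rw [← BorelCalculus.inner_group]
      exact hcont)
  refine ⟨ν, hfin, absolutelyContinuous_of_poisson fun ε hε l => ?_, huniv, fun s => ?_⟩
  · rw [hlint _ ?_]
    · simp_rw [lintegral_poissonKernelLine _ hε]
      have hz : ((l : ℂ) + ε * Complex.I).im ≠ 0 := by simpa using hε.ne'
      refine lintegral_im_orbit_le (F := ⟪ψ, (C 0).resolvent (l + ε * Complex.I) ψ⟫_ℂ) ?_ fun t => ?_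
      · rw [BorelCalculus.inner_resolvent _ hz]
        have hi := memLp_one_iff_integrable.mp ((C 0).memLp_inv_sub hz ψ 1)
        refine le_of_le_of_eq ?_ (integral_im hi)
        refine integral_nonneg fun x => ?_
        change 0 ≤ (((x : ℂ) - (l + ε * Complex.I))⁻¹).im
        rw [im_inv_ofReal_sub]
        positivity
      · have h2 := hP 0 t
        rw [sub_zero] at h2
        exact inner_resolvent_rankOne (hC t) (hC 0) h2 hz
    · exact ((continuous_poissonKernelLine hε).comp
        (continuous_id.prodMk continuous_const)).measurable.ennreal_ofReal
  · have h2 := intervalIntegral.integral_eq_sub_of_hasDerivAt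
      (fun t _ => hasDerivAt_opTrace_group hD hC hP s t)
      ((continuous_const.mul (continuous_const.mul (hcont s))).intervalIntegrable 0 1)
    have h3 : opTrace (0 : H →L[ℂ] H) = 0 := by simp [opTrace]
    rw [sub_self, h3, sub_zero, h0, h1, intervalIntegral.integral_const_mul,
      intervalIntegral.integral_const_mul] at h2
    rw [← h2, hchar]
    simp_rw [BorelCalculus.inner_group]

end Averaging

/-! ### The spectral shift function -/

section SpectralShift

variable {H : Type*} [NormedAddCommGroup H] [InnerProductSpace ℂ H] [CompleteSpace H]

theorem IsRankOneSum.traceBound_sub_sum {P : H →L[ℂ] H} {ψ : ℕ → H} (h : IsRankOneSum P ψ) {c : ℝ}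
    (hc : HasSum (fun k => ‖ψ k‖ ^ 2) c) (n : ℕ) :
    TraceBound (P - ∑ k ∈ Finset.range n, rankOneOp (ψ k))
      (c - ∑ k ∈ Finset.range n, ‖ψ k‖ ^ 2) := by
  have h1 : IsRankOneSum (P - ∑ k ∈ Finset.range n, rankOneOp (ψ k)) fun k => ψ (k + n) := by
    intro x y
    have h2 := (hasSum_nat_add_iff' n).mpr (h x y)
    have e : ⟪y, (P - ∑ k ∈ Finset.range n, rankOneOp (ψ k)) x⟫_ℂ =
        ⟪y, P x⟫_ℂ - ∑ k ∈ Finset.range n, ⟪y, ψ k⟫_ℂ * ⟪ψ k, x⟫_ℂ := by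
      rw [sub_apply, inner_sub_right, sum_apply, inner_sum]
      simp [inner_smul_right, mul_comm]
    rw [e]
    exact h2
  exact h1.traceBound ((hasSum_nat_add_iff' n).mpr hc)

theorem traceBound_sum_rankOneOp (ψ : ℕ → H) (n : ℕ) :
    TraceBound (∑ k ∈ Finset.range n, rankOneOp (ψ k)) (∑ k ∈ Finset.range n, ‖ψ k‖ ^ 2) := by
  induction n with
  | zero => simpa using traceBound_zero
  | succ n ih =>
    rw [Finset.sum_range_succ, Finset.sum_range_succ]
    exact ih.add (traceBound_rankOneOp _)

theorem opTrace_sum_rankOneOp (ψ : ℕ → H) (n : ℕ) :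
    opTrace (∑ k ∈ Finset.range n, rankOneOp (ψ k)) =
      ((∑ k ∈ Finset.range n, ‖ψ k‖ ^ 2 : ℝ) : ℂ) := by
  induction n with
  | zero => simp [opTrace]
  | succ n ih =>
    rw [Finset.sum_range_succ, Finset.sum_range_succ,
      (traceBound_sum_rankOneOp ψ n).opTrace_add (traceBound_rankOneOp _), ih, opTrace_rankOneOp]
    push_cast
    rfl

/-- The trace of a sum of rank one operators; the trace is continuous for `TraceBound`, which
controls the remainders. -/
theorem IsRankOneSum.opTrace_eq {P : H →L[ℂ] H} {ψ : ℕ → H} (h : IsRankOneSum P ψ) {c : ℝ}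
    (hc : HasSum (fun k => ‖ψ k‖ ^ 2) c) : opTrace P = (c : ℂ) := by
  have h0 : Tendsto (fun n => c - ∑ k ∈ Finset.range n, ‖ψ k‖ ^ 2) atTop (𝓝 0) := by
    simpa using hc.tendsto_sum_nat.const_sub c
  have h1 : Tendsto (fun n => opTrace (P - ∑ k ∈ Finset.range n, rankOneOp (ψ k)) +
      ((∑ k ∈ Finset.range n, ‖ψ k‖ ^ 2 : ℝ) : ℂ)) atTop (𝓝 (0 + (c : ℂ))) := by
    refine Tendsto.add ?_ ?_
    · exact squeeze_zero_norm (fun n => (h.traceBound_sub_sum hc n).norm_opTrace_le) h0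
    · exact (Complex.continuous_ofReal.tendsto c).comp hc.tendsto_sum_nat
  have h2 : ∀ n, opTrace (P - ∑ k ∈ Finset.range n, rankOneOp (ψ k)) +
      ((∑ k ∈ Finset.range n, ‖ψ k‖ ^ 2 : ℝ) : ℂ) = opTrace P := by
    intro n
    rw [← opTrace_sum_rankOneOp, ← (h.traceBound_sub_sum hc n).opTrace_add
      (traceBound_sum_rankOneOp ψ n), sub_add_cancel]
  simp_rw [h2, zero_add] at h1
  exact tendsto_nhds_unique tendsto_const_nhds h1

variable {A B : H →ₗ.[ℂ] H} {CA CB : BorelCalculus H}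

/-- For a positive trace class perturbation the shifts of its rank one summands add up to a finite
absolutely continuous measure. -/
theorem exists_spectralShift_of_isRankOneSum [TopologicalSpace.SeparableSpace H]
    (hA : IsSelfAdjoint A) (hB : IsSelfAdjoint B) (hCA : CA.Represents A) (hCB : CB.Represents B)
    {P : H →L[ℂ] H} (h : IsPerturbation A B P) {ψ : ℕ → H} (hψ : IsRankOneSum P ψ) {c : ℝ}
    (hc : HasSum (fun k => ‖ψ k‖ ^ 2) c) :
    ∃ ν : Measure ℝ, IsFiniteMeasure ν ∧ ν ≪ volume ∧ ν Set.univ = ENNReal.ofReal c ∧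
      ∀ s, opTrace (CA.group s - CB.group s) = -Complex.I * (s * ∫ x, expChar s x ∂ν) := by
  let S : ℕ → H →L[ℂ] H := fun n => ∑ k ∈ Finset.range n, rankOneOp (ψ k)
  have hS : ∀ n, IsSelfAdjoint (S n) := fun n =>
    isSelfAdjoint_sum _ fun k _ => isSelfAdjoint_rankOneOp _
  let D : ℕ → H →ₗ.[ℂ] H := fun n => addBounded B (S n)
  have hD : ∀ n, IsSelfAdjoint (D n) := fun n => isSelfAdjoint_addBounded hB (hS n)
  choose C hC using fun n => exists_borelCalculus (hD n)
  have hP : ∀ n, IsPerturbation (D (n + 1)) (D n) (rankOneOp (ψ n)) := by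
    intro n
    have h1 := isPerturbation_addBounded B (S n) (S (n + 1))
    simp only [S, Finset.sum_range_succ, add_sub_cancel_left] at h1
    simpa only [D, S, Finset.sum_range_succ] using h1
  have hPA : ∀ n, IsPerturbation A (D n) (P - S n) := by
    refine fun n => ⟨h.1, fun x hx hx' => ?_⟩
    rw [addBounded_apply, h.2 x hx hx', sub_apply]
    abel
  choose ν hfin hac huniv hν using fun n =>
    exists_spectralShift_rankOne (hD (n + 1)) (hD n) (hC (n + 1)) (hC n) (hP n)
  have h0 : ∀ s, (C 0).group s = CB.group s := by
    refine fun s => group_eq_of_isPerturbation_zero (hD 0) hB (hC 0) hCB ⟨rfl, fun x hx hx' => ?_⟩ s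
    rw [addBounded_apply]
    simp [S]
  have hstep : ∀ s n, TraceBound ((C (n + 1)).group s - (C n).group s) (|s| * ‖ψ n‖ ^ 2) :=
    fun s n => traceBound_group_sub (hD _) (hD _) (hC _) (hC _) (hP n) (traceBound_rankOneOp _) s
  have hpart : ∀ s n, (∃ K, TraceBound ((C n).group s - CB.group s) K) ∧
      opTrace ((C n).group s - CB.group s) =
        ∑ k ∈ Finset.range n, -Complex.I * (s * ∫ x, expChar s x ∂(ν k)) := by
    intro s n
    induction n with
    | zero =>
      rw [h0, sub_self]
      exact ⟨⟨0, traceBound_zero⟩, by simp [opTrace]⟩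
    | succ n ih =>
      obtain ⟨⟨K, hK⟩, ih⟩ := ih
      have e : (C (n + 1)).group s - CB.group s =
          ((C n).group s - CB.group s) + ((C (n + 1)).group s - (C n).group s) := by abel
      rw [e]
      exact ⟨⟨_, hK.add (hstep s n)⟩, by
        rw [hK.opTrace_add (hstep s n), ih, hν, Finset.sum_range_succ]⟩
  have hmass : Measure.sum ν Set.univ = ENNReal.ofReal c := by
    rw [Measure.sum_apply _ MeasurableSet.univ, ← hc.tsum_eq,
      ENNReal.ofReal_tsum_of_nonneg (fun _ => by positivity) hc.summable]
    refine tsum_congr fun n => ?_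
    rw [huniv, ENNReal.ofReal_pow (norm_nonneg _), ofReal_norm]
  have hfinS : IsFiniteMeasure (Measure.sum ν) := ⟨by rw [hmass]; exact ENNReal.ofReal_lt_top⟩
  refine ⟨Measure.sum ν, hfinS, Measure.absolutelyContinuous_sum_left hac, hmass, fun s => ?_⟩
  have hi : Integrable (expChar s) (Measure.sum ν) :=
    Integrable.of_bound (measurable_expChar s).aestronglyMeasurable 1
      (Eventually.of_forall fun p => by simp)
  have h1 : Tendsto (fun n => opTrace (CA.group s - (C n).group s) +
      opTrace ((C n).group s - CB.group s)) atTop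
      (𝓝 (0 + -Complex.I * (s * ∫ x, expChar s x ∂(Measure.sum ν)))) := by
    refine Tendsto.add ?_ ?_
    · have h2 : Tendsto (fun n => |s| * (c - ∑ k ∈ Finset.range n, ‖ψ k‖ ^ 2)) atTop (𝓝 0) := by
        simpa using (hc.tendsto_sum_nat.const_sub c).const_mul |s|
      exact squeeze_zero_norm (fun n => (traceBound_group_sub hA (hD n) hCA (hC n) (hPA n)
        (hψ.traceBound_sub_sum hc n) s).norm_opTrace_le) h2
    · simp_rw [(hpart s _).2]
      exact (((hasSum_integral_measure hi).mul_left _).mul_left _).tendsto_sum_nat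
  have h2 : ∀ n, opTrace (CA.group s - (C n).group s) + opTrace ((C n).group s - CB.group s) =
      opTrace (CA.group s - CB.group s) := by
    intro n
    obtain ⟨K, hK⟩ := (hpart s n).1
    rw [← (traceBound_group_sub hA (hD n) hCA (hC n) (hPA n)
        (hψ.traceBound_sub_sum hc n) s).opTrace_add hK, sub_add_sub_cancel]
  simp_rw [h2, zero_add] at h1
  exact tendsto_nhds_unique tendsto_const_nhds h1

/-- The density of a finite absolutely continuous measure represents its integrals. -/
theorem integral_mul_rnDeriv {ν : Measure ℝ} [IsFiniteMeasure ν] (hν : ν ≪ volume) (g : ℝ → ℂ) :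
    ∫ t, g t * ((ν.rnDeriv volume t).toReal : ℂ) = ∫ t, g t ∂ν := by
  rw [← integral_rnDeriv_smul hν]
  refine integral_congr_ae (Eventually.of_forall fun t => ?_)
  simp [mul_comm]

/-- The spectral shift function of a trace class perturbation, through the intermediate operator
`B + V⁺ = A + V⁻`. -/
theorem exists_spectralShift [TopologicalSpace.SeparableSpace H] (hA : IsSelfAdjoint A)
    (hB : IsSelfAdjoint B) (hCA : CA.Represents A) (hCB : CB.Represents B) {V : H →L[ℂ] H}
    (hV : IsSelfAdjoint V) (htr : traceNorm V < ∞) (h : IsPerturbation A B V) :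
    ∃ ξ : ℝ → ℝ, Integrable ξ ∧
      (∀ s, opTrace (CA.group s - CB.group s) =
        -Complex.I * (s * ∫ t, expChar s t * (ξ t : ℂ))) ∧
      opTrace V = ((∫ t, ξ t : ℝ) : ℂ) ∧ ∫⁻ t, ‖ξ t‖ₑ ≤ traceNorm V ∧
      (0 ≤ V → ∀ᵐ t : ℝ, 0 ≤ ξ t) := by
  have hp : 0 ≤ V⁺ := CFC.posPart_nonneg V
  have hn : 0 ≤ V⁻ := CFC.negPart_nonneg V
  have hsub : V⁺ - V⁻ = V := CFC.posPart_sub_negPart V hV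
  have hsum := traceNorm_eq_posPart_add_negPart hV
  have htr2 := htr
  rw [hsum, ENNReal.add_lt_top] at htr2
  obtain ⟨ψ, hψ, hψc⟩ := exists_nat_isRankOneSum hp htr2.1
  obtain ⟨φ, hφ, hφc⟩ := exists_nat_isRankOneSum hn htr2.2
  have hD : IsSelfAdjoint (addBounded B V⁺) := isSelfAdjoint_addBounded hB (IsSelfAdjoint.of_nonneg hp)
  obtain ⟨C, hC⟩ := exists_borelCalculus hD
  have hDB : IsPerturbation (addBounded B V⁺) B V⁺ :=
    ⟨rfl, fun x hx hx' => addBounded_apply B _ x hx⟩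
  have hDA : IsPerturbation (addBounded B V⁺) A V⁻ := by
    refine ⟨h.1.symm, fun x hx hx' => ?_⟩
    rw [addBounded_apply, h.2 x hx' hx]
    nth_rewrite 2 [← hsub]
    rw [sub_apply]
    abel
  obtain ⟨μ, hμf, hμ, hμu, hμs⟩ :=
    exists_spectralShift_of_isRankOneSum hD hB hC hCB hDB hψ hψc
  obtain ⟨ν, hνf, hν, hνu, hνs⟩ :=
    exists_spectralShift_of_isRankOneSum hD hA hC hCA hDA hφ hφc
  rw [ENNReal.ofReal_toReal htr2.1.ne] at hμu
  rw [ENNReal.ofReal_toReal htr2.2.ne] at hνu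
  have hiμ : Integrable fun t => (μ.rnDeriv volume t).toReal := Measure.integrable_toReal_rnDeriv
  have hiν : Integrable fun t => (ν.rnDeriv volume t).toReal := Measure.integrable_toReal_rnDeriv
  refine ⟨fun t => (μ.rnDeriv volume t).toReal - (ν.rnDeriv volume t).toReal, hiμ.sub hiν,
    fun s => ?_, ?_, ?_, fun hV0 => ?_⟩
  · have hb1 := traceBound_group_sub hD hB hC hCB hDB (hψ.traceBound hψc) s
    have hb2 := (traceBound_group_sub hD hA hC hCA hDA (hφ.traceBound hφc) s).smul (-1)
    have e : CA.group s - CB.group s =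
        (C.group s - CB.group s) + (-1 : ℂ) • (C.group s - CA.group s) := by
      rw [neg_one_smul]
      abel
    rw [e, hb1.opTrace_add hb2, opTrace_smul, hμs, hνs, ← integral_mul_rnDeriv hμ,
      ← integral_mul_rnDeriv hν]
    have hi : ∀ r : ℝ → ℝ, Integrable r → Integrable fun t => expChar s t * (r t : ℂ) :=
      fun r hr => hr.ofReal.bdd_mul (c := 1) (measurable_expChar s).aestronglyMeasurable
        (Eventually.of_forall fun t => by simp)
    simp_rw [Complex.ofReal_sub, mul_sub]
    rw [integral_sub (hi _ hiμ) (hi _ hiν)]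
    ring
  · have hb2 := (hφ.traceBound hφc).smul (-1)
    have e : V = V⁺ + (-1 : ℂ) • V⁻ := by
      rw [neg_one_smul, ← sub_eq_add_neg, hsub]
    rw [integral_sub hiμ hiν, Measure.integral_toReal_rnDeriv hμ, Measure.integral_toReal_rnDeriv hν]
    conv_lhs => rw [e]
    rw [(hψ.traceBound hψc).opTrace_add hb2, opTrace_smul, hψ.opTrace_eq hψc, hφ.opTrace_eq hφc,
      measureReal_def, measureReal_def, hμu, hνu]
    push_cast
    ring
  · rw [hsum, ← hμu, ← hνu]
    calc _ ≤ ∫⁻ t, (μ.rnDeriv volume t + ν.rnDeriv volume t) := by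
          refine lintegral_mono_ae ?_
          filter_upwards [μ.rnDeriv_lt_top volume, ν.rnDeriv_lt_top volume] with t h1 h2
          refine (enorm_sub_le).trans_eq ?_
          rw [Real.enorm_eq_ofReal ENNReal.toReal_nonneg,
            Real.enorm_eq_ofReal ENNReal.toReal_nonneg, ENNReal.ofReal_toReal h1.ne,
            ENNReal.ofReal_toReal h2.ne]
      _ = _ := by
          rw [lintegral_add_left (Measure.measurable_rnDeriv _ _), Measure.lintegral_rnDeriv hμ,
            Measure.lintegral_rnDeriv hν]
  · have h1 : V⁻ = 0 := (CFC.negPart_eq_zero_iff V hV).mpr hV0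
    have h2 : ν = 0 := by
      rw [← Measure.measure_univ_eq_zero, hνu, h1]
      simp [traceNorm]
    subst h2
    filter_upwards [Measure.rnDeriv_zero (volume : Measure ℝ)] with t ht
    rw [ht]
    simp

end SpectralShift

/-! ### The kernel of Krein's class -/

section Kernel

theorem kreinKernel_of_ne (x : ℝ) {s : ℝ} (hs : s ≠ 0) :
    kreinKernel x s = (s : ℂ)⁻¹ * (expChar s x - 1) := by
  rw [kreinKernel, if_neg hs, div_eq_inv_mul]
  rfl

theorem kreinKernel_zero (x : ℝ) : kreinKernel x 0 = -(Complex.I * x) := by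
  rw [kreinKernel, if_pos rfl]

theorem norm_kreinKernel_le (x s : ℝ) : ‖kreinKernel x s‖ ≤ |x| := by
  rcases eq_or_ne s 0 with rfl | hs
  · simp [kreinKernel_zero]
  · rw [kreinKernel_of_ne x hs, norm_mul, norm_inv, Complex.norm_real, Real.norm_eq_abs,
      inv_mul_le_iff₀ (abs_pos.mpr hs)]
    exact norm_expChar_sub_one_le s x

theorem measurable_kreinKernel : Measurable fun p : ℝ × ℝ => kreinKernel p.1 p.2 := by
  unfold kreinKernel
  refine Measurable.ite (measurableSet_eq_fun measurable_snd measurable_const) ?_ ?_ <;> fun_prop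

theorem hasDerivAt_kreinKernel (x s : ℝ) :
    HasDerivAt (fun x => kreinKernel x s) (-Complex.I * expChar s x) x := by
  rcases eq_or_ne s 0 with rfl | hs
  · simp_rw [kreinKernel_zero, expChar_zero]
    exact ((Complex.ofRealCLM.hasDerivAt (x := x)).const_mul Complex.I).neg.congr_deriv (by simp)
  · simp_rw [fun x => kreinKernel_of_ne x hs]
    have h1 : HasDerivAt (fun x : ℝ => -(Complex.I * s * (x : ℂ))) (-(Complex.I * s * 1)) x :=
      ((Complex.ofRealCLM.hasDerivAt (x := x)).const_mul (Complex.I * s)).neg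
    refine ((h1.cexp.sub_const 1).const_mul (s : ℂ)⁻¹).congr_deriv ?_
    have : (s : ℂ) ≠ 0 := by exact_mod_cast hs
    rw [expChar]
    field_simp

variable {μ : Measure ℝ} {h : ℝ → ℂ}

/-- The transform `x ↦ i ∫ (e^{-isx} - 1) / s · h(s) dμ(s)`; its derivative is the Fourier
transform of `h μ`. -/
noncomputable def kreinTransform (μ : Measure ℝ) (h : ℝ → ℂ) (x : ℝ) : ℂ :=
  Complex.I * ∫ s, kreinKernel x s * h s ∂μ

theorem integrable_kreinKernel_mul (hh : Integrable h μ) (x : ℝ) :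
    Integrable (fun s => kreinKernel x s * h s) μ :=
  hh.bdd_mul (c := |x|)
    (measurable_kreinKernel.comp (measurable_const.prodMk measurable_id)).aestronglyMeasurable
    (Eventually.of_forall fun s => norm_kreinKernel_le x s)

theorem measurable_expChar_prod : Measurable fun p : ℝ × ℝ => expChar p.1 p.2 := by
  unfold expChar
  fun_prop

theorem integrable_expChar_mul (hh : Integrable h μ) (x : ℝ) :
    Integrable (fun s => expChar s x * h s) μ :=
  hh.bdd_mul (c := 1)
    (measurable_expChar_prod.comp (measurable_id.prodMk measurable_const)).aestronglyMeasurable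
    (Eventually.of_forall fun s => (norm_expChar s x).le)

theorem hasDerivAt_kreinTransform (hh : Integrable h μ) (x : ℝ) :
    HasDerivAt (kreinTransform μ h) (∫ s, expChar s x * h s ∂μ) x := by
  have h1 := hasDerivAt_integral_of_dominated_loc_of_deriv_le (μ := μ) (s := Set.univ)
    (F := fun x s => kreinKernel x s * h s) (F' := fun x s => -Complex.I * expChar s x * h s)
    (bound := fun s => ‖h s‖) (x₀ := x) Filter.univ_mem
    (Eventually.of_forall fun y => (integrable_kreinKernel_mul hh y).aestronglyMeasurable)
    (integrable_kreinKernel_mul hh x)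
    (by
      simp_rw [mul_assoc]
      exact ((integrable_expChar_mul hh x).const_mul _).aestronglyMeasurable)
    (Eventually.of_forall fun s y _ => by simp)
    hh.norm
    (Eventually.of_forall fun s y _ => (hasDerivAt_kreinKernel y s).mul_const (h s))
  refine (h1.2.const_mul Complex.I).congr_deriv ?_
  simp_rw [mul_assoc]
  rw [integral_const_mul, ← mul_assoc]
  simp

theorem measurable_kreinTransform (hh : Integrable h μ) : Measurable (kreinTransform μ h) :=
  (continuous_iff_continuousAt.mpr fun x =>
    (hasDerivAt_kreinTransform hh x).continuousAt).measurable

theorem norm_kreinTransform_le (hh : Integrable h μ) (x : ℝ) :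
    ‖kreinTransform μ h x‖ ≤ (∫ s, ‖h s‖ ∂μ) * |x| := by
  rw [kreinTransform, norm_mul, Complex.norm_I, one_mul, mul_comm, ← integral_const_mul]
  refine (norm_integral_le_integral_norm _).trans
    (integral_mono (integrable_kreinKernel_mul hh x).norm (hh.norm.const_mul _) fun s => ?_)
  rw [norm_mul]
  gcongr
  exact norm_kreinKernel_le x s

theorem integrable_prod_kreinKernel [SFinite μ] (hh : Integrable h μ) {m : Measure ℝ}
    [IsFiniteMeasure m] (hm : Integrable (fun t : ℝ => t) m) :
    Integrable (Function.uncurry fun t s => kreinKernel t s * h s) (m.prod μ) := by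
  refine (hm.norm.mul_prod hh.norm).mono ?_ (Eventually.of_forall fun p => ?_)
  · exact measurable_kreinKernel.aestronglyMeasurable.mul hh.aestronglyMeasurable.comp_snd
  · change ‖kreinKernel p.1 p.2 * h p.2‖ ≤ ‖‖p.1‖ * ‖h p.2‖‖
    rw [norm_mul, norm_mul, norm_norm, norm_norm, Real.norm_eq_abs]
    gcongr
    exact norm_kreinKernel_le _ _

theorem integrable_mul_integral_kreinKernel [SFinite μ] (hh : Integrable h μ) {m : Measure ℝ}
    [IsFiniteMeasure m] (hm : Integrable (fun t : ℝ => t) m) :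
    Integrable (fun s => h s * ∫ t, kreinKernel t s ∂m) μ := by
  refine (integrable_prod_kreinKernel hh hm).integral_prod_right.congr
    (Eventually.of_forall fun s => ?_)
  change ∫ t, kreinKernel t s * h s ∂m = _
  rw [integral_mul_const, mul_comm]

theorem integral_kreinTransform [SFinite μ] (hh : Integrable h μ) {m : Measure ℝ}
    [IsFiniteMeasure m] (hm : Integrable (fun t : ℝ => t) m) :
    ∫ t, kreinTransform μ h t ∂m =
      Complex.I * ∫ s, h s * ∫ t, kreinKernel t s ∂m ∂μ := by
  unfold kreinTransform
  rw [integral_const_mul, integral_integral_swap (integrable_prod_kreinKernel hh hm)]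
  congr 1
  refine integral_congr_ae (Eventually.of_forall fun s => ?_)
  simp only
  rw [integral_mul_const, mul_comm]

end Kernel

/-! ### The trace formula -/

section TraceFormula

variable {H : Type*} [NormedAddCommGroup H] [InnerProductSpace ℂ H] [CompleteSpace H]

/-- The difference quotient `(e^{-isA} - e^{-isB}) / s`, with its limit `-iV` at `s = 0`. -/
noncomputable def groupQuotient (CA CB : BorelCalculus H) (V : H →L[ℂ] H) (s : ℝ) : H →L[ℂ] H :=
  if s = 0 then -Complex.I • V else (s : ℂ)⁻¹ • (CA.group s - CB.group s)

variable {A B : H →ₗ.[ℂ] H} {CA CB : BorelCalculus H} {V : H →L[ℂ] H}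

theorem groupQuotient_zero : groupQuotient CA CB V 0 = -Complex.I • V := if_pos rfl

theorem groupQuotient_of_ne {s : ℝ} (hs : s ≠ 0) :
    groupQuotient CA CB V s = (s : ℂ)⁻¹ • (CA.group s - CB.group s) := if_neg hs

theorem norm_groupQuotient_le (hA : IsSelfAdjoint A) (hB : IsSelfAdjoint B)
    (hCA : CA.Represents A) (hCB : CB.Represents B) (h : IsPerturbation A B V) (s : ℝ) :
    ‖groupQuotient CA CB V s‖ ≤ ‖V‖ := by
  rcases eq_or_ne s 0 with rfl | hs
  · rw [groupQuotient_zero, norm_smul]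
    simp
  · rw [groupQuotient_of_ne hs, norm_smul, norm_inv, Complex.norm_real, Real.norm_eq_abs,
      inv_mul_le_iff₀ (abs_pos.mpr hs)]
    exact norm_group_sub_le hA hB hCA hCB h s

theorem traceBound_groupQuotient (hA : IsSelfAdjoint A) (hB : IsSelfAdjoint B)
    (hCA : CA.Represents A) (hCB : CB.Represents B) (h : IsPerturbation A B V) {K : ℝ}
    (hV : TraceBound V K) (s : ℝ) : TraceBound (groupQuotient CA CB V s) K := by
  rcases eq_or_ne s 0 with rfl | hs
  · rw [groupQuotient_zero]
    simpa using hV.smul (-Complex.I)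
  · rw [groupQuotient_of_ne hs]
    have h1 := (traceBound_group_sub hA hB hCA hCB h hV s).smul (s : ℂ)⁻¹
    rwa [norm_inv, Complex.norm_real, Real.norm_eq_abs, inv_mul_cancel_left₀ (by simpa using hs)]
      at h1

theorem opTrace_groupQuotient {ξ : ℝ → ℝ}
    (hξ : ∀ s, opTrace (CA.group s - CB.group s) =
      -Complex.I * (s * ∫ t, expChar s t * (ξ t : ℂ)))
    (hξV : opTrace V = ((∫ t, ξ t : ℝ) : ℂ)) (s : ℝ) :
    opTrace (groupQuotient CA CB V s) = -Complex.I * ∫ t, expChar s t * (ξ t : ℂ) := by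
  rcases eq_or_ne s 0 with rfl | hs
  · simp_rw [groupQuotient_zero, opTrace_smul, hξV, expChar_zero, one_mul]
    rw [integral_complex_ofReal]
  · have : (s : ℂ) ≠ 0 := by exact_mod_cast hs
    rw [groupQuotient_of_ne hs, opTrace_smul, hξ]
    field_simp

theorem stronglyMeasurable_groupQuotient (CA CB : BorelCalculus H) (V : H →L[ℂ] H) (x : H) :
    StronglyMeasurable fun s => groupQuotient CA CB V s x := by
  have h1 : ∀ s, groupQuotient CA CB V s x = if s ∈ ({0} : Set ℝ) then -Complex.I • V x else
      (s : ℂ)⁻¹ • (CA.group s x - CB.group s x) := by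
    intro s
    rcases eq_or_ne s 0 with rfl | hs
    · simp [groupQuotient_zero]
    · simp [groupQuotient_of_ne hs, hs]
  simp_rw [h1]
  refine StronglyMeasurable.ite (measurableSet_singleton 0) stronglyMeasurable_const ?_
  refine StronglyMeasurable.smul ?_ ?_
  · exact Complex.measurable_ofReal.inv.stronglyMeasurable
  · exact ((CA.continuous_group_apply x).sub (CB.continuous_group_apply x)).stronglyMeasurable

/-- The quadratic form of the difference quotient is the difference of the integrals of the
kernel. -/
theorem inner_groupQuotient (hCA : CA.Represents A) (hCB : CB.Represents B)
    (h : IsPerturbation A B V) {x : H} (hx : x ∈ B.domain) (s : ℝ) :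
    ⟪x, groupQuotient CA CB V s x⟫_ℂ =
      ∫ t, kreinKernel t s ∂(CA.meas x) - ∫ t, kreinKernel t s ∂(CB.meas x) := by
  rcases eq_or_ne s 0 with rfl | hs
  · have hxA : x ∈ A.domain := by rw [h.1]; exact hx
    have h1 := CA.inner_fn (hCA.memLp ⟨x, hxA⟩)
    have h2 := CB.inner_fn (hCB.memLp ⟨x, hx⟩)
    rw [← hCA.2, h.2 x hxA hx, inner_add_right] at h1
    rw [← hCB.2] at h2
    simp_rw [kreinKernel_zero, groupQuotient_zero]
    rw [integral_neg, integral_neg, integral_const_mul, integral_const_mul, ← h1, ← h2,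
      smul_apply, inner_smul_right]
    ring
  · have h1 : ∀ C : BorelCalculus H, ∫ t, kreinKernel t s ∂(C.meas x) =
        (s : ℂ)⁻¹ * (⟪x, C.group s x⟫_ℂ - ⟪x, x⟫_ℂ) := by
      intro C
      have h3 := memLp_one_iff_integrable.mp
        (C.memLp_of_bound (measurable_expChar s) (fun t => (norm_expChar s t).le) x 1)
      have h4 := C.inner_fn (x := x) (f := fun _ => 1) (memLp_const _)
      rw [C.fn_const, one_smul] at h4
      simp_rw [fun t => kreinKernel_of_ne t hs]
      rw [integral_const_mul, integral_sub h3 (integrable_const _), C.inner_group, h4]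
    rw [h1, h1, groupQuotient_of_ne hs, smul_apply, inner_smul_right, sub_apply, inner_sub_right]
    ring

/-- The operator `∫ (e^{-isA} - e^{-isB}) / s · h(s) dμ(s)` multiplied by `i`, as a weak
integral. -/
theorem exists_integral_groupQuotient (hA : IsSelfAdjoint A) (hB : IsSelfAdjoint B)
    (hCA : CA.Represents A) (hCB : CB.Represents B) (h : IsPerturbation A B V) {μ : Measure ℝ}
    {w : ℝ → ℂ} (hw : Integrable w μ) :
    ∃ T : H →L[ℂ] H, ∀ x y : H,
      ⟪y, T x⟫_ℂ = Complex.I * ∫ s, w s * ⟪y, groupQuotient CA CB V s x⟫_ℂ ∂μ := by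
  have hi : ∀ x, Integrable (fun s => w s • groupQuotient CA CB V s x) μ := by
    intro x
    refine (hw.norm.mul_const (‖V‖ * ‖x‖)).mono'
      (hw.aestronglyMeasurable.smul
        (stronglyMeasurable_groupQuotient CA CB V x).aestronglyMeasurable)
      (Eventually.of_forall fun s => ?_)
    rw [norm_smul]
    gcongr
    exact (ContinuousLinearMap.le_opNorm _ _).trans
      (by gcongr; exact norm_groupQuotient_le hA hB hCA hCB h s)
  let T : H →L[ℂ] H := LinearMap.mkContinuous
    { toFun := fun x => Complex.I • ∫ s, w s • groupQuotient CA CB V s x ∂μ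
      map_add' := fun x y => by
        simp_rw [map_add, smul_add]
        rw [integral_add (hi x) (hi y), smul_add]
      map_smul' := fun c x => by
        simp_rw [map_smul, smul_comm _ c]
        rw [integral_smul, smul_comm _ c]
        rfl }
    ((∫ s, ‖w s‖ ∂μ) * ‖V‖) fun x => by
      change ‖Complex.I • ∫ s, w s • groupQuotient CA CB V s x ∂μ‖ ≤ _
      rw [norm_smul, Complex.norm_I, one_mul, mul_assoc, ← integral_mul_const]
      refine norm_integral_le_of_norm_le (hw.norm.mul_const _) (Eventually.of_forall fun s => ?_)
      rw [norm_smul]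
      gcongr
      exact (ContinuousLinearMap.le_opNorm _ _).trans
        (by gcongr; exact norm_groupQuotient_le hA hB hCA hCB h s)
  refine ⟨T, fun x y => ?_⟩
  change ⟪y, Complex.I • ∫ s, w s • groupQuotient CA CB V s x ∂μ⟫_ℂ = _
  rw [inner_smul_right, ← integral_inner (hi x)]
  simp_rw [inner_smul_right]

theorem integrable_mul_inner_groupQuotient (hA : IsSelfAdjoint A) (hB : IsSelfAdjoint B)
    (hCA : CA.Represents A) (hCB : CB.Represents B) (h : IsPerturbation A B V) {μ : Measure ℝ}
    {w : ℝ → ℂ} (hw : Integrable w μ) (x y : H) :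
    Integrable (fun s => w s * ⟪y, groupQuotient CA CB V s x⟫_ℂ) μ := by
  refine hw.mul_bdd (c := ‖y‖ * (‖V‖ * ‖x‖)) ?_ (Eventually.of_forall fun s => ?_)
  · exact (stronglyMeasurable_const.inner
      (stronglyMeasurable_groupQuotient CA CB V x)).aestronglyMeasurable
  · refine (norm_inner_le_norm _ _).trans ?_
    gcongr
    exact (ContinuousLinearMap.le_opNorm _ _).trans
        (by gcongr; exact norm_groupQuotient_le hA hB hCA hCB h s)

variable {μ : Measure ℝ} {w : ℝ → ℂ} {T : H →L[ℂ] H}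

theorem traceBound_of_integral (hA : IsSelfAdjoint A) (hB : IsSelfAdjoint B)
    (hCA : CA.Represents A) (hCB : CB.Represents B) (h : IsPerturbation A B V)
    (hw : Integrable w μ) {K : ℝ} (hV : TraceBound V K)
    (hT : ∀ x y : H, ⟪y, T x⟫_ℂ = Complex.I * ∫ s, w s * ⟪y, groupQuotient CA CB V s x⟫_ℂ ∂μ) :
    TraceBound T ((∫ s, ‖w s‖ ∂μ) * K) := by
  intro I a b ha hb
  have hi := fun i => integrable_mul_inner_groupQuotient hA hB hCA hCB h hw (b i) (a i)
  calc ∑ i ∈ I, ‖⟪a i, T (b i)⟫_ℂ‖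
      ≤ ∑ i ∈ I, ∫ s, ‖w s * ⟪a i, groupQuotient CA CB V s (b i)⟫_ℂ‖ ∂μ := by
        refine Finset.sum_le_sum fun i _ => ?_
        rw [hT, norm_mul, Complex.norm_I, one_mul]
        exact norm_integral_le_integral_norm _
    _ = ∫ s, ∑ i ∈ I, ‖w s * ⟪a i, groupQuotient CA CB V s (b i)⟫_ℂ‖ ∂μ :=
        (integral_finsetSum _ fun i _ => (hi i).norm).symm
    _ ≤ ∫ s, ‖w s‖ * K ∂μ := by
        refine integral_mono (integrable_finsetSum _ fun i _ => (hi i).norm)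
          (hw.norm.mul_const _) fun s => ?_
        simp_rw [norm_mul]
        rw [← Finset.mul_sum]
        gcongr
        exact traceBound_groupQuotient hA hB hCA hCB h hV s I a b ha hb
    _ = _ := integral_mul_const _ _

theorem opTrace_of_integral [TopologicalSpace.SeparableSpace H] [SFinite μ]
    (hA : IsSelfAdjoint A) (hB : IsSelfAdjoint B)
    (hCA : CA.Represents A) (hCB : CB.Represents B) (h : IsPerturbation A B V)
    (hw : Integrable w μ) {K : ℝ} (hV : TraceBound V K)
    (hT : ∀ x y : H, ⟪y, T x⟫_ℂ = Complex.I * ∫ s, w s * ⟪y, groupQuotient CA CB V s x⟫_ℂ ∂μ)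
    {ξ : ℝ → ℝ} (hξi : Integrable ξ)
    (hξ : ∀ s, opTrace (CA.group s - CB.group s) =
      -Complex.I * (s * ∫ t, expChar s t * (ξ t : ℂ)))
    (hξV : opTrace V = ((∫ t, ξ t : ℝ) : ℂ)) :
    opTrace T = ∫ t, (∫ s, expChar s t * w s ∂μ) * (ξ t : ℂ) := by
  have : Countable (onbIndex H) := countable_onbIndex H
  have hi := fun i : onbIndex H =>
    integrable_mul_inner_groupQuotient hA hB hCA hCB h hw (onb H i) (onb H i)
  have hsum : Summable fun i : onbIndex H =>
      ∫ s, ‖w s * ⟪onb H i, groupQuotient CA CB V s (onb H i)⟫_ℂ‖ ∂μ := by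
    refine summable_of_sum_le (c := ∫ s, ‖w s‖ * K ∂μ)
      (fun i => integral_nonneg fun r => norm_nonneg _) fun I => ?_
    rw [← integral_finsetSum _ fun i _ => (hi i).norm]
    refine integral_mono (integrable_finsetSum _ fun i _ => (hi i).norm)
      (hw.norm.mul_const _) fun s => ?_
    simp_rw [norm_mul]
    rw [← Finset.mul_sum]
    gcongr
    exact traceBound_groupQuotient hA hB hCA hCB h hV s I _ _ isBessel_onb isBessel_onb
  have h1 := (hasSum_integral_of_summable_integral_norm hi hsum).tsum_eq
  have h2 : opTrace T = Complex.I * ∫ s, w s * opTrace (groupQuotient CA CB V s) ∂μ := by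
    unfold opTrace
    simp_rw [hT]
    rw [tsum_mul_left, h1]
    simp_rw [tsum_mul_left]
  have hprod : Integrable (Function.uncurry fun s t => expChar s t * w s * (ξ t : ℂ))
      (μ.prod volume) := by
    refine (hw.mul_prod (hξi.ofReal (𝕜 := ℂ))).bdd_mul (c := 1)
      (f := fun p : ℝ × ℝ => expChar p.1 p.2) measurable_expChar_prod.aestronglyMeasurable
      (Eventually.of_forall fun p => (norm_expChar _ _).le) |>.congr ?_
    exact Eventually.of_forall fun p => (mul_assoc _ _ _).symm
  have h3 : ∀ s, w s * opTrace (groupQuotient CA CB V s) =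
      -Complex.I * ∫ t, expChar s t * w s * (ξ t : ℂ) := by
    intro s
    rw [opTrace_groupQuotient hξ hξV]
    have : ∀ t, expChar s t * w s * (ξ t : ℂ) = w s * (expChar s t * (ξ t : ℂ)) := fun t => by ring
    simp_rw [this]
    rw [integral_const_mul]
    ring
  simp_rw [h2, h3]
  rw [integral_const_mul, integral_integral_swap hprod, ← mul_assoc]
  simp_rw [integral_mul_const]
  simp

theorem inner_self_of_integral [SFinite μ] (hCA : CA.Represents A) (hCB : CB.Represents B)
    (h : IsPerturbation A B V) (hw : Integrable w μ)
    (hT : ∀ x y : H, ⟪y, T x⟫_ℂ = Complex.I * ∫ s, w s * ⟪y, groupQuotient CA CB V s x⟫_ℂ ∂μ)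
    {x : H} (hx : x ∈ B.domain) :
    ⟪x, T x⟫_ℂ = ∫ t, kreinTransform μ w t ∂(CA.meas x) -
      ∫ t, kreinTransform μ w t ∂(CB.meas x) := by
  have hm : ∀ {C : BorelCalculus H} {D : H →ₗ.[ℂ] H}, C.Represents D → x ∈ D.domain →
      Integrable (fun t : ℝ => t) (C.meas x) := by
    intro C D hC hxD
    have h1 := (hC.memLp ⟨x, hxD⟩).integrable one_le_two
    exact h1.re
  have hmA := hm hCA (by rw [h.1]; exact hx)
  have hmB := hm hCB hx
  rw [hT, integral_kreinTransform hw hmA, integral_kreinTransform hw hmB, ← mul_sub,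
    ← integral_sub (integrable_mul_integral_kreinKernel hw hmA)
      (integrable_mul_integral_kreinKernel hw hmB)]
  simp_rw [inner_groupQuotient hCA hCB h hx, mul_sub]

end TraceFormula

/-! ### The difference of functions of the two operators -/

section Difference

variable {H : Type*} [NormedAddCommGroup H] [InnerProductSpace ℂ H] [CompleteSpace H]

/-- Polarization for a densely defined operator. -/
theorem eq_zero_of_inner_self_of_dense {D : Submodule ℂ H} (hD : Dense (D : Set H))
    {S : D →ₗ[ℂ] H} (h : ∀ x : D, ⟪(x : H), S x⟫_ℂ = 0) (x : D) : S x = 0 := by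
  refine hD.eq_zero_of_inner_right (𝕜 := ℂ) fun v hv => ?_
  obtain ⟨y, rfl⟩ : ∃ y : D, (y : H) = v := ⟨⟨v, hv⟩, rfl⟩
  have h1 := h (x + y)
  have h2 := h (x + Complex.I • y)
  simp only [map_add, map_smul, Submodule.coe_add, Submodule.coe_smul, inner_add_left,
    inner_add_right, inner_smul_left, inner_smul_right, h, Complex.conj_I] at h1 h2
  have h3 : Complex.I * (⟪(x : H), S y⟫_ℂ - ⟪(y : H), S x⟫_ℂ) = 0 := by linear_combination h2
  have h4 : ⟪(x : H), S y⟫_ℂ - ⟪(y : H), S x⟫_ℂ = 0 :=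
    (mul_eq_zero.mp h3).resolve_left Complex.I_ne_zero
  linear_combination (h1 - h4) / 2

variable {A B : H →ₗ.[ℂ] H} {CA CB : BorelCalculus H} {V : H →L[ℂ] H} {T : H →L[ℂ] H}

theorem BorelCalculus.Represents.memLp_of_le {C : BorelCalculus H} (hC : C.Represents A)
    {g : ℝ → ℂ} (hg : Measurable g) {c : ℝ} (hgc : ∀ t, ‖g t‖ ≤ c * |t|) (x : A.domain) :
    MemLp g 2 (C.meas (x : H)) := by
  refine ((hC.memLp x).const_mul (c : ℂ)).mono hg.aestronglyMeasurable
    (Eventually.of_forall fun t => (hgc t).trans ?_)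
  rw [norm_mul, Complex.norm_real, Complex.norm_real, Real.norm_eq_abs, Real.norm_eq_abs]
  gcongr
  exact le_abs_self c

theorem fn_sub_fn_eq (hB : IsSelfAdjoint B) (hCA : CA.Represents A) (hCB : CB.Represents B)
    (hdom : A.domain = B.domain) {g : ℝ → ℂ} (hg : Measurable g) {c : ℝ}
    (hgc : ∀ t, ‖g t‖ ≤ c * |t|)
    (hT : ∀ x ∈ B.domain, ⟪x, T x⟫_ℂ = ∫ t, g t ∂(CA.meas x) - ∫ t, g t ∂(CB.meas x))
    {x : H} (hx : x ∈ B.domain) : CA.fn g x - CB.fn g x = T x := by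
  have hmA : ∀ x : B.domain, MemLp g 2 (CA.meas (x : H)) := fun x =>
    hCA.memLp_of_le hg hgc ⟨x, by rw [hdom]; exact x.2⟩
  have hmB : ∀ x : B.domain, MemLp g 2 (CB.meas (x : H)) := hCB.memLp_of_le hg hgc
  let S : B.domain →ₗ[ℂ] H :=
    { toFun := fun x => CA.fn g x - CB.fn g x - T x
      map_add' := fun x y => by
        rw [Submodule.coe_add, CA.fn_vec_add (hmA x) (hmA y), CB.fn_vec_add (hmB x) (hmB y),
          map_add]
        abel
      map_smul' := fun a x => by
        rw [Submodule.coe_smul, CA.fn_vec_smul a (hmA x), CB.fn_vec_smul a (hmB x), map_smul]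
        simp only [RingHom.id_apply, smul_sub] }
  have h0 := eq_zero_of_inner_self_of_dense (S := S) hB.dense_domain (fun x => by
    change ⟪(x : H), CA.fn g x - CB.fn g x - T x⟫_ℂ = 0
    rw [inner_sub_right, inner_sub_right, CA.inner_fn (hmA x), CB.inner_fn (hmB x), hT x x.2,
      sub_self]) ⟨x, hx⟩
  exact sub_eq_zero.mp h0

/-- A bounded operator whose quadratic form on the common domain is that of `f(A) - f(B)` extends
`f(A) - f(B)`, on the whole of its domain. -/
theorem isBoundedExtension_pmap_sub (hB : IsSelfAdjoint B) (hCA : CA.Represents A)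
    (hCB : CB.Represents B) (hdom : A.domain = B.domain) {f : ℝ → ℂ} (hf : Measurable f) {c : ℝ}
    (hfc : ∀ t, ‖f t‖ ≤ c * |t|)
    (hT : ∀ x ∈ B.domain, ⟪x, T x⟫_ℂ = ∫ t, f t ∂(CA.meas x) - ∫ t, f t ∂(CB.meas x)) :
    IsBoundedExtension (CA.pmap f - CB.pmap f) T := by
  have hmA : ∀ x ∈ B.domain, MemLp f 2 (CA.meas x) := fun x hx =>
    hCA.memLp_of_le hf hfc ⟨x, by rw [hdom]; exact hx⟩
  have hmB : ∀ x ∈ B.domain, MemLp f 2 (CB.meas x) := fun x hx => hCB.memLp_of_le hf hfc ⟨x, hx⟩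
  have hsub : B.domain ≤ (CA.pmap f - CB.pmap f).domain := fun x hx =>
    ⟨(CA.mem_pmap_domain f x).mpr (hmA x hx), (CB.mem_pmap_domain f x).mpr (hmB x hx)⟩
  refine ⟨hB.dense_domain.mono hsub, fun x => ?_⟩
  -- The adjoint operator extends the difference of the functions `conj ∘ f` on `B.domain`.
  have hadj : ∀ y ∈ B.domain, CA.fn (fun t => conj (f t)) y - CB.fn (fun t => conj (f t)) y =
      ContinuousLinearMap.adjoint T y := by
    intro y hy
    refine fn_sub_fn_eq hB hCA hCB hdom (Complex.continuous_conj.measurable.comp hf) (c := c)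
      (fun t => by simpa using hfc t) (fun z hz => ?_) hy
    rw [ContinuousLinearMap.adjoint_inner_right, ← inner_conj_symm, hT z hz, map_sub,
      ← integral_conj, ← integral_conj]
    rfl
  have hxA := (CA.mem_pmap_domain f x).mp x.2.1
  have hxB := (CB.mem_pmap_domain f x).mp x.2.2
  have e : (CA.pmap f - CB.pmap f) x = CA.fn f x - CB.fn f x := rfl
  rw [e, ← sub_eq_zero]
  refine hB.dense_domain.eq_zero_of_inner_right (𝕜 := ℂ) fun y hy => ?_
  rw [inner_sub_right, inner_sub_right, ← CA.inner_fn_left hxA (hmA y hy),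
    ← CB.inner_fn_left hxB (hmB y hy), ← inner_sub_left, hadj y hy,
    ContinuousLinearMap.adjoint_inner_left, sub_self]

end Difference

/-! ### The support of the spectral shift function -/

section Support

/-- A smooth function with compact support is a Fourier transform, in the normalization of the
characters `e^{-isx}`, of an integrable function. -/
theorem exists_integrable_fourier {g : ℝ → ℝ} (hg : ContDiff ℝ (⊤ : ℕ∞) g)
    (hc : HasCompactSupport g) :
    ∃ w : ℝ → ℂ, Integrable w ∧ ∀ x, ∫ s, expChar s x * w s = (g x : ℂ) := by
  have hc' : HasCompactSupport fun x => (g x : ℂ) := hc.comp_left (g := Complex.ofReal) rfl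
  have hg' : ContDiff ℝ (⊤ : ℕ∞) fun x => (g x : ℂ) := Complex.ofRealCLM.contDiff.comp hg
  let φ : SchwartzMap ℝ ℂ := hc'.toSchwartzMap hg'
  let ψ : SchwartzMap ℝ ℂ := FourierTransformInv.fourierInv φ
  have h1 : ∀ x, ∫ s : ℝ, Complex.exp (((-2 * Real.pi * s * x : ℝ) : ℂ) * Complex.I) * ψ s
      = (g x : ℂ) := by
    intro x
    have h2 : FourierTransform.fourier ψ = φ := FourierTransform.fourier_fourierInv_eq φ
    have h3 : FourierTransform.fourier (ψ : ℝ → ℂ) x = φ x := by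
      rw [← SchwartzMap.fourier_coe, h2]
    rw [Real.fourier_real_eq_integral_exp_smul] at h3
    exact h3
  have hpi : (2 * Real.pi)⁻¹ ≠ 0 := by
    have := Real.pi_pos
    positivity
  refine ⟨fun s => ((2 * Real.pi)⁻¹ : ℝ) * ψ ((2 * Real.pi)⁻¹ * s),
    ((ψ.integrable (μ := volume)).comp_mul_left' hpi).const_mul _, fun x => ?_⟩
  rw [← h1]
  have h4 := Measure.integral_comp_mul_left
    (fun s : ℝ => Complex.exp (((-2 * Real.pi * s * x : ℝ) : ℂ) * Complex.I) * ψ s)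
    (2 * Real.pi)⁻¹
  rw [inv_inv, abs_of_pos (by have := Real.pi_pos; positivity)] at h4
  have h5 : ∀ s : ℝ, expChar s x * (((2 * Real.pi)⁻¹ : ℝ) * ψ ((2 * Real.pi)⁻¹ * s)) =
      ((2 * Real.pi)⁻¹ : ℝ) * (Complex.exp (((-2 * Real.pi * ((2 * Real.pi)⁻¹ * s) * x : ℝ) : ℂ)
        * Complex.I) * ψ ((2 * Real.pi)⁻¹ * s)) := by
    intro s
    have e : -2 * Real.pi * ((2 * Real.pi)⁻¹ * s) * x = -(s * x) := by
      have := Real.pi_pos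
      field_simp
    rw [e, expChar_eq]
    ring
  simp_rw [h5]
  rw [integral_const_mul, h4, Complex.real_smul, ← mul_assoc, ← Complex.ofReal_mul,
    inv_mul_cancel₀ (by have := Real.pi_pos; positivity), Complex.ofReal_one, one_mul]

theorem exists_const_of_hasDerivAt_zero {J : Set ℝ} (hJ : Convex ℝ J) {f f' : ℝ → ℂ}
    (hf : ∀ x, HasDerivAt f (f' x) x) (h0 : ∀ x ∈ J, f' x = 0) : ∃ c, ∀ x ∈ J, f x = c := by
  rcases J.eq_empty_or_nonempty with rfl | ⟨y, hy⟩
  · exact ⟨0, fun x hx => hx.elim⟩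
  · refine ⟨f y, fun x hx => ?_⟩
    have h1 := hJ.norm_image_sub_le_of_norm_hasDerivWithin_le (f := f) (C := 0)
      (fun z _ => (hf z).hasDerivWithinAt) (fun z hz => by rw [h0 z hz, norm_zero]) hy hx
    rw [zero_mul, norm_le_zero_iff, sub_eq_zero] at h1
    exact h1

variable {H : Type*} [NormedAddCommGroup H] [InnerProductSpace ℂ H] [CompleteSpace H]
variable {A B : H →ₗ.[ℂ] H} {CA CB : BorelCalculus H} {V : H →L[ℂ] H}

/-- The spectral shift function vanishes outside every closed interval that carries the spectra:
for a test function `f'` supported there `f` is constant on both spectra, so that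
`f(A) - f(B) = 0`. -/
theorem ae_eq_zero_of_spectrum_subset [TopologicalSpace.SeparableSpace H]
    (hA : IsSelfAdjoint A) (hB : IsSelfAdjoint B) (hCA : CA.Represents A)
    (hCB : CB.Represents B) (h : IsPerturbation A B V) {K : ℝ} (hV : TraceBound V K)
    {ξ : ℝ → ℝ} (hξi : Integrable ξ)
    (hξ : ∀ s, opTrace (CA.group s - CB.group s) =
      -Complex.I * (s * ∫ t, expChar s t * (ξ t : ℂ)))
    (hξV : opTrace V = ((∫ t, ξ t : ℝ) : ℂ)) {J : Set ℝ} (hJ : Convex ℝ J) (hJc : IsClosed J)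
    (hJA : ∀ t ∈ Jᶜ, (t : ℂ) ∈ unboundedResolventSet A)
    (hJB : ∀ t ∈ Jᶜ, (t : ℂ) ∈ unboundedResolventSet B) :
    ∀ᵐ t : ℝ, t ∈ Jᶜ → ξ t = 0 := by
  refine hJc.isOpen_compl.ae_eq_zero_of_integral_contDiff_smul_eq_zero
    (hξi.locallyIntegrable.locallyIntegrableOn _) fun g hg hgc hgs => ?_
  obtain ⟨w, hw, hwg⟩ := exists_integrable_fourier hg hgc
  obtain ⟨T, hT⟩ := exists_integral_groupQuotient hA hB hCA hCB h hw
  have htr := opTrace_of_integral hA hB hCA hCB h hw hV hT hξi hξ hξV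
  simp_rw [hwg] at htr
  obtain ⟨c, hc⟩ := exists_const_of_hasDerivAt_zero hJ (hasDerivAt_kreinTransform hw)
    fun x hx => by
      rw [hwg, image_eq_zero_of_notMem_tsupport fun hx' => hgs hx' hx, Complex.ofReal_zero]
  have hint : ∀ {C : BorelCalculus H} {D : H →ₗ.[ℂ] H}, C.Represents D →
      (∀ t ∈ Jᶜ, (t : ℂ) ∈ unboundedResolventSet D) → ∀ x,
      ∫ t, kreinTransform volume w t ∂(C.meas x) = c * ⟪x, x⟫_ℂ := by
    intro C D hC hD x
    have h1 := C.inner_fn (x := x) (f := fun _ => 1) (memLp_const _)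
    rw [C.fn_const, one_smul] at h1
    have h2 : ∀ᵐ t ∂(C.meas x), t ∈ J := hC.meas_eq_zero_of_subset hD x
    rw [h1, ← integral_const_mul]
    refine integral_congr_ae ?_
    filter_upwards [h2] with t ht
    rw [hc t ht, mul_one]
  have hT0 : ∀ x ∈ B.domain, T x = 0 := by
    intro x hx
    refine eq_zero_of_inner_self_of_dense (S := T.toLinearMap.comp B.domain.subtype)
      hB.dense_domain (fun y => ?_) ⟨x, hx⟩
    refine (inner_self_of_integral hCA hCB h hw hT y.2).trans ?_
    rw [hint hCA hJA, hint hCB hJB, sub_self]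
  have hT1 : T = 0 := DFunLike.coe_injective <|
    Continuous.ext_on hB.dense_domain T.continuous continuous_const fun x hx => hT0 x hx
  rw [hT1] at htr
  have h3 : opTrace (0 : H →L[ℂ] H) = 0 := by simp [opTrace]
  rw [h3] at htr
  have h4 : ((∫ t, g t • ξ t : ℝ) : ℂ) = 0 := by
    rw [htr, ← integral_complex_ofReal]
    simp
  exact_mod_cast h4

theorem ae_eq_zero_of_notMem_Ioo {ξ : ℝ → ℝ} {a b : EReal}
    (h : ∀ᵐ t : ℝ, t ∈ {t : ℝ | (t : EReal) ∈ Set.Icc a b}ᶜ → ξ t = 0) :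
    ∀ᵐ t : ℝ, (t : EReal) ∉ Set.Ioo a b → ξ t = 0 := by
  have hne : ∀ c : EReal, ∀ᵐ t : ℝ, (t : EReal) ≠ c := by
    intro c
    have hs : {t : ℝ | (t : EReal) = c}.Subsingleton := fun x hx y hy =>
      EReal.coe_injective (hx.trans hy.symm)
    exact hs.countable.ae_notMem volume
  filter_upwards [h, hne a, hne b] with t ht ha hb hn
  refine ht fun hI => hn ?_
  exact ⟨lt_of_le_of_ne hI.1 ha.symm, lt_of_le_of_ne hI.2 hb⟩

end Support

/-! ### Krein's trace formula -/

section Main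

variable {H : Type*} [NormedAddCommGroup H] [InnerProductSpace ℂ H] [CompleteSpace H]
variable {A B : H →ₗ.[ℂ] H} {V : H →L[ℂ] H}

theorem isPerturbation_of_isBoundedExtension (hdom : A.domain = B.domain)
    (hV : IsBoundedExtension (A - B) V) : IsPerturbation A B V := by
  refine ⟨hdom, fun x hx hx' => ?_⟩
  have h1 := hV.2 ⟨x, hx, hx'⟩
  have h2 : (A - B) ⟨x, hx, hx'⟩ = A ⟨x, hx⟩ - B ⟨x, hx'⟩ := rfl
  change V x = _ at h1
  rw [h1, h2]
  abel

theorem IsPerturbation.isSelfAdjoint (hA : IsSelfAdjoint A) (hB : IsSelfAdjoint B)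
    (h : IsPerturbation A B V) : IsSelfAdjoint V := by
  rw [ContinuousLinearMap.isSelfAdjoint_iff']
  refine DFunLike.coe_injective (Continuous.ext_on hB.dense_domain
    (ContinuousLinearMap.continuous _) V.continuous fun y hy => ?_)
  rw [← sub_eq_zero]
  refine hB.dense_domain.eq_zero_of_inner_right (𝕜 := ℂ) fun x hx => ?_
  have hxA : x ∈ A.domain := by rw [h.1]; exact hx
  have hyA : y ∈ A.domain := by rw [h.1]; exact hy
  have h1 := LinearPMap.inner_apply_eq hA ⟨x, hxA⟩ ⟨y, hyA⟩
  rw [h.2 x hxA hx, h.2 y hyA hy, inner_add_left, inner_add_right,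
    LinearPMap.inner_apply_eq hB ⟨x, hx⟩ ⟨y, hy⟩] at h1
  rw [inner_sub_right, ContinuousLinearMap.adjoint_inner_right, sub_eq_zero]
  exact add_left_cancel h1

theorem IsPerturbation.nonneg (hA : IsSelfAdjoint A) (hB : IsSelfAdjoint B)
    (h : IsPerturbation A B V) (hle : FormLE B A) : 0 ≤ V := by
  rw [ContinuousLinearMap.nonneg_iff_isPositive]
  refine ⟨(h.isSelfAdjoint hA hB).isSymmetric, fun x => ?_⟩
  have hcl : IsClosed {x : H | 0 ≤ V.reApplyInnerSelf x} :=
    isClosed_le continuous_const V.reApplyInnerSelf_continuous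
  refine hB.dense_domain.induction (fun x hx => ?_) hcl x
  have hxA : x ∈ A.domain := by rw [h.1]; exact hx
  have h1 := hle x hx hxA
  rw [h.2 x hxA hx, inner_add_right, Complex.add_re] at h1
  rw [ContinuousLinearMap.reApplyInnerSelf_apply, inner_re_symm]
  change 0 ≤ (⟪x, V x⟫_ℂ).re
  linarith

end Main

theorem mainTheorem1 {H : Type*} [NormedAddCommGroup H] [InnerProductSpace ℂ H] [CompleteSpace H]
    [TopologicalSpace.SeparableSpace H]
    (A B : H →ₗ.[ℂ] H) (hA : IsSelfAdjoint A) (hB : IsSelfAdjoint B)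
    (hdom : A.domain = B.domain)
    (V : H →L[ℂ] H) (hV : IsBoundedExtension (A - B) V) (hVtr : IsTraceClass V) :
    ∃ ξ : ℝ → ℝ, Integrable ξ volume ∧
      (∀ (μ : Measure ℝ) (f : ℝ → ℂ), IsFiniteMeasure μ →
        (∀ x : ℝ, f x = Complex.I * ∫ s, kreinKernel x s ∂μ) →
        Differentiable ℝ f ∧
        Integrable (fun t : ℝ => deriv f t * (ξ t : ℂ)) volume ∧
        ∃ (fA fB : H →ₗ.[ℂ] H) (T : H →L[ℂ] H),
          IsFunctionOf A f fA ∧ IsFunctionOf B f fB ∧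
          IsBoundedExtension (fA - fB) T ∧ IsTraceClass T ∧
          opTrace T = ∫ t : ℝ, deriv f t * (ξ t : ℂ)) ∧
      opTrace V = ((∫ t : ℝ, ξ t : ℝ) : ℂ) ∧
      ∫⁻ t : ℝ, ‖ξ t‖ₑ ≤ traceNorm V ∧
      (FormLE B A → ∀ᵐ t : ℝ, 0 ≤ ξ t) ∧
      (∀ᵐ t : ℝ, (t : EReal) ∉ Set.Ioo (sInf (realSpectrum A ∪ realSpectrum B))
          (sSup (realSpectrum A ∪ realSpectrum B)) → ξ t = 0) := by
  have h := isPerturbation_of_isBoundedExtension hdom hV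
  have hVsa := h.isSelfAdjoint hA hB
  obtain ⟨CA, hCA⟩ := exists_borelCalculus hA
  obtain ⟨CB, hCB⟩ := exists_borelCalculus hB
  obtain ⟨ξ, hξi, hξ, hξV, hξn, hξ0⟩ := exists_spectralShift hA hB hCA hCB hVsa hVtr h
  have hVb := traceBound_traceNorm hVsa hVtr
  refine ⟨ξ, hξi, fun μ f hμ hf => ?_, hξV, hξn, fun hle => hξ0 (h.nonneg hA hB hle), ?_⟩
  · have hw : Integrable (fun _ : ℝ => (1 : ℂ)) μ := integrable_const _
    obtain rfl : f = kreinTransform μ fun _ => 1 := funext fun x => by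
      simp [hf, kreinTransform]
    have hd := hasDerivAt_kreinTransform hw
    have hderiv : ∀ t, deriv (kreinTransform μ fun _ => 1) t = ∫ s, expChar s t * 1 ∂μ :=
      fun t => (hd t).deriv
    obtain ⟨T, hT⟩ := exists_integral_groupQuotient hA hB hCA hCB h hw
    have hmeas := measurable_kreinTransform hw
    refine ⟨fun x => (hd x).differentiableAt, ?_, CA.pmap _, CB.pmap _, T,
      hCA.isFunctionOf hmeas, hCB.isFunctionOf hmeas,
      isBoundedExtension_pmap_sub hB hCA hCB hdom hmeas (norm_kreinTransform_le hw)
        fun x hx => inner_self_of_integral hCA hCB h hw hT hx, ?_, ?_⟩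
    · refine hξi.ofReal.bdd_mul (c := μ.real Set.univ) (measurable_deriv _).aestronglyMeasurable
        (Eventually.of_forall fun t => ?_)
      rw [hderiv]
      refine (norm_integral_le_of_norm_le_const (C := 1)
        (Eventually.of_forall fun s => by simp)).trans_eq (one_mul _)
    · exact (traceBound_of_integral hA hB hCA hCB h hw hVb hT).traceNorm_le.trans_lt
        ENNReal.ofReal_lt_top
    · simp_rw [hderiv]
      exact opTrace_of_integral hA hB hCA hCB h hw hVb hT hξi hξ hξV
  · refine ae_eq_zero_of_notMem_Ioo ?_
    have hres : ∀ {D : H →ₗ.[ℂ] H}, realSpectrum D ⊆ realSpectrum A ∪ realSpectrum B →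
        ∀ t ∈ {t : ℝ | (t : EReal) ∈ Set.Icc (sInf (realSpectrum A ∪ realSpectrum B))
          (sSup (realSpectrum A ∪ realSpectrum B))}ᶜ, (t : ℂ) ∈ unboundedResolventSet D := by
      intro D hD t ht
      by_contra hn
      have h1 := hD ⟨t, hn, rfl⟩
      exact ht ⟨sInf_le h1, le_sSup h1⟩
    refine ae_eq_zero_of_spectrum_subset hA hB hCA hCB h hVb hξi hξ hξV ?_ ?_
      (hres Set.subset_union_left) (hres Set.subset_union_right)
    · refine Set.OrdConnected.convex ⟨fun x hx y hy z hz => ?_⟩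
      exact ⟨hx.1.trans (EReal.coe_le_coe hz.1), (EReal.coe_le_coe hz.2).trans hy.2⟩
    · exact isClosed_Icc.preimage continuous_coe_real_ereal
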